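/- \textbf{Definitions.} An instance of the Team Formula Game consists of finite sets of Boolean variables $X, X', Y_0, Y_1$ with initial values, two variables $h_0,h_1\in X$, and Boolean formulas $F(X,X',Y_0,Y_1)$, $F'(X,X')$, $G(X)$ such that $F$ implies $\lnot F'$. A policy $P$ consists of a deterministic automaton over a one-letter alphabet, with finite state set $\Pi$, start state $p_0$ and transition function $\pi:\Pi\to\Pi$, together with functions $P_{\mathrm{mid}},P_{\mathrm{end}}:\Pi\to\mathbb N\times\mathbb N$. An instance of the Team Formula Game with Communication (TFGC) is a pair of a Team Formula Game instance and a policy. It is played by team White, $\{W_0,W_1\}$, against Black. Starting from the initial values and from policy state $p=p_0$, each round proceeds as follows. \begin{enumerate} \item Black sets $X$ to any values. If $F$ and $G$ are true, Black wins; if $F$ is false, White wins. \item Black sets $X'$ to any values. If $F'$ is false, White wins. \item $W_0$ and $W_1$ simultaneously send each other messages of $n_{01}$ and $n_{10}$ bits respectively, where $(n_{01},n_{10})=P_{\mathrm{mid}}(p)$. \item $W_0$ sets $Y_0$ to any values; then $W_1$ sets $Y_1$ to any values. \item $W_0$ and $W_1$ simultaneously send each other messages of $n_{01}$ and $n_{10}$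 bits respectively, where $(n_{01},n_{10})=P_{\mathrm{end}}(p)$; then $p$ is replaced by $\pi(p)$. \end{enumerate} Black has perfect information. Player $W_i$ knows the instance and sees only the values of $Y_i$ and $h_i$ and the messages of the teammate. White has a \emph{forced win} if there are strategies for $W_0$ and $W_1$, each choosing every message and move as a function of what that player has learned so far, such that White wins after finitely many rounds whatever Black does. 2-EXPSPACE is the class of languages decided by a deterministic Turing machine in space $2^{2^{p(n)}}$ on inputs of length $n$, for some polynomial $p$. \textbf{Theorem.} The following problem is in 2-EXPSPACE (in particular, it is decidable): given a TFGC instance whose policy $P$ has a 1-bit mid-round exchange in both directions every round and no other communication, i.e. $P_{\mathrm{mid}}(p)=(1,1)$ and $P_{\mathrm{end}}(p)=(0,0)$ for all $p\in\Pi$, does White have a forced win? -/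

import Mathlib

/-! ## Doubly exponential space

The machine model is Mathlib's `Turing.FinTM2`, the multi-stack form of a multi-tape Turing machine
(finite control, finitely many stacks).  The space used by a configuration is the total number of
symbols held on all its stacks, the input stack included. -/

/-- The number of symbols stored in a configuration. -/
def Turing.FinTM2.spaceUsed (tm : Turing.FinTM2) (c : tm.Cfg) : ℕ :=
  ∑ k ∈ @Finset.univ tm.K tm.kFin, (Turing.TM2.Cfg.stk c k).length

/-- A Turing machine that decides the language `L` (on every word `w` it halts and outputs the truth
value of `w ∈ L`) and whose configurations on inputs of length `n` never hold more than `s n`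
symbols. -/
structure SpaceDecider {Γ : Type} (L : Language Γ) (s : ℕ → ℕ) extends
    Turing.TM2ComputableAux Γ Bool where
  finite_alphabet : ∀ k, Finite (tm.Γ k)
  decides : ∀ (w : List Γ) (b : Bool), (b = true ↔ w ∈ L) →
    Nonempty (Turing.TM2Outputs tm (w.map inputAlphabet.symm) (some [outputAlphabet.symm b]))
  space_le : ∀ (w : List Γ) (c : tm.Cfg),
    StateTransition.Reaches tm.step (Turing.initList tm (w.map inputAlphabet.symm)) c →
      tm.spaceUsed c ≤ s w.length

/-- The class 2-EXPSPACE: languages over a finite alphabet that a deterministic Turing machine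
decides in space `2 ^ 2 ^ p(n)` for some polynomial `p`. -/
def InTwoEXPSPACE {Γ : Type} [Finite Γ] (L : Language Γ) : Prop :=
  ∃ p : Polynomial ℕ, Nonempty (SpaceDecider L fun n => 2 ^ 2 ^ p.eval n)

/-! ## Boolean formulas -/

/-- Boolean formulas over the variables `α`. -/
inductive BoolFormula (α : Type) : Type
  | var (a : α)
  | const (b : Bool)
  | neg (φ : BoolFormula α)
  | conj (φ ψ : BoolFormula α)
  | disj (φ ψ : BoolFormula α)

/-- The truth value of a formula under an assignment. -/
def BoolFormula.eval {α : Type} (v : α → Bool) : BoolFormula α → Bool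
  | var a => v a
  | const b => b
  | neg φ => !φ.eval v
  | conj φ ψ => φ.eval v && ψ.eval v
  | disj φ ψ => φ.eval v || ψ.eval v

/-! ## Team Formula Games and policies -/

/-- An instance of the Team Formula Game.  The variable sets `X`, `X'`, `Y₀`, `Y₁` are
`Fin nX`, `Fin nX'`, `Fin (nY 0)`, `Fin (nY 1)`; White player `i` sets `Yᵢ` and sees `h i ∈ X`. -/
structure TeamFormulaGame where
  nX : ℕ
  nX' : ℕ
  nY : Fin 2 → ℕ
  initX : Fin nX → Bool
  initX' : Fin nX' → Bool
  initY : ∀ i, Fin (nY i) → Bool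
  h : Fin 2 → Fin nX
  F : BoolFormula (Fin nX ⊕ Fin nX' ⊕ Fin (nY 0) ⊕ Fin (nY 1))
  F' : BoolFormula (Fin nX ⊕ Fin nX')
  G : BoolFormula (Fin nX)
  F_implies_not_F' : ∀ (x : Fin nX → Bool) (x' : Fin nX' → Bool) (y : ∀ i, Fin (nY i) → Bool),
    F.eval (Sum.elim x (Sum.elim x' (Sum.elim (y 0) (y 1)))) = true →
      F'.eval (Sum.elim x x') = false

/-- A communication policy: a finite automaton over a one-letter alphabet with state set
`Fin numStates`, and for each state the number of bits sent by players 0 and 1 (in this order) to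
their teammate mid-round and at the end of the round. -/
structure CommPolicy where
  numStates : ℕ
  start : Fin numStates
  next : Fin numStates → Fin numStates
  midRound : Fin numStates → ℕ × ℕ
  endRound : Fin numStates → ℕ × ℕ

namespace CommPolicy

/-- The policy state in round `k` (rounds are numbered from 0). -/
def stateAt (P : CommPolicy) (k : ℕ) : Fin P.numStates := P.next^[k] P.start

/-- The number of bits that player `i` sends mid-round in round `k`. -/
def midBits (P : CommPolicy) (k : ℕ) (i : Fin 2) : ℕ :=
  if i = 0 then (P.midRound (P.stateAt k)).1 else (P.midRound (P.stateAt k)).2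

/-- The number of bits that player `i` sends at the end of round `k`. -/
def endBits (P : CommPolicy) (k : ℕ) (i : Fin 2) : ℕ :=
  if i = 0 then (P.endRound (P.stateAt k)).1 else (P.endRound (P.stateAt k)).2

end CommPolicy

/-! ## Play of the Team Formula Game with Communication -/

/-- One item of information that a White player learns: the value of their variable `h i` after
Black has moved, or a message from the teammate. -/
inductive Observation : Type
  | sawH (b : Bool)
  | received (m : List Bool)

namespace TeamFormulaGame

/-- A strategy of White player `i`: in each round `k` it prescribes a mid-round message, values for
`Yᵢ` and an end-of-round message, each as a function of everything the player has observed so far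
(latest observation first).  What a player knows of their own doings (the values of `Yᵢ`, messages
sent) is determined by the strategy and these observations. -/
structure Strategy (I : TeamFormulaGame) (P : CommPolicy) (i : Fin 2) where
  midMessage : (k : ℕ) → List Observation → Fin (P.midBits k i) → Bool
  move : ℕ → List Observation → Fin (I.nY i) → Bool
  endMessage : (k : ℕ) → List Observation → Fin (P.endBits k i) → Bool

/-- The situation between two rounds: the values of `X'`, `Y₀`, `Y₁`, and what each White player has
observed.  (The values of `X` play no role any more, as Black resets all of `X`.) -/
structure Position (I : TeamFormulaGame) where
  x' : Fin I.nX' → Bool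
  y : ∀ i, Fin (I.nY i) → Bool
  view : Fin 2 → List Observation

/-- The position before the first round. -/
def initialPosition (I : TeamFormulaGame) : I.Position where
  x' := I.initX'
  y := I.initY
  view _ := []

/-- The truth value of `F` after Black has set `X` to `x` in position `c`. -/
def evalF (I : TeamFormulaGame) (c : I.Position) (x : Fin I.nX → Bool) : Bool :=
  I.F.eval (Sum.elim x (Sum.elim c.x' (Sum.elim (c.y 0) (c.y 1))))

/-- In position `c`, Black sets `X` to `x` and then (if the game goes on) `X'` to `x'`; White wins
at one of these two moves. -/
def WhiteWinsRound (I : TeamFormulaGame) (c : I.Position) (x : Fin I.nX → Bool)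
    (x' : Fin I.nX' → Bool) : Prop :=
  I.evalF c x = false ∨
    (I.evalF c x = true ∧ I.G.eval x = false ∧ I.F'.eval (Sum.elim x x') = false)

/-- In position `c`, Black sets `X` to `x` and `X'` to `x'`, and neither team has won then. -/
def RoundContinues (I : TeamFormulaGame) (c : I.Position) (x : Fin I.nX → Bool)
    (x' : Fin I.nX' → Bool) : Prop :=
  I.evalF c x = true ∧ I.G.eval x = false ∧ I.F'.eval (Sum.elim x x') = true

/-- One full round, number `k`, from position `c`: Black sets `X` and `X'` to `x` and `x'`, player
`i` sees `h i`, the mid-round messages are exchanged simultaneously, the White players set `Y₀` and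
`Y₁`, and the end-of-round messages are exchanged simultaneously. -/
def playRound {I : TeamFormulaGame} {P : CommPolicy} (s : ∀ i, I.Strategy P i) (k : ℕ)
    (c : I.Position) (x : Fin I.nX → Bool) (x' : Fin I.nX' → Bool) : I.Position :=
  let view₁ (i : Fin 2) := Observation.sawH (x (I.h i)) :: c.view i
  let view₂ (i : Fin 2) :=
    Observation.received (List.ofFn ((s (1 - i)).midMessage k (view₁ (1 - i)))) :: view₁ i
  { x' := x'
    y := fun i => (s i).move k (view₂ i)
    view := fun i =>
      Observation.received (List.ofFn ((s (1 - i)).endMessage k (view₂ (1 - i)))) :: view₂ i }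

/-- The position before round `k` when White plays `s` and Black sets `X`, `X'` to `x j`, `x' j` in
each round `j`. -/
def positionAt {I : TeamFormulaGame} {P : CommPolicy} (s : ∀ i, I.Strategy P i)
    (x : ℕ → Fin I.nX → Bool) (x' : ℕ → Fin I.nX' → Bool) : ℕ → I.Position
  | 0 => I.initialPosition
  | k + 1 => playRound s k (positionAt s x x' k) (x k) (x' k)

/-- White has a forced win under the policy `P`: the two White players have strategies such that,
whatever Black does, White wins after finitely many rounds.  As White's strategies are fixed,
ranging over all sequences of Black's moves covers every way for Black to react to the play. -/
def WhiteHasForcedWin (I : TeamFormulaGame) (P : CommPolicy) : Prop :=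
  ∃ s : ∀ i, I.Strategy P i, ∀ (x : ℕ → Fin I.nX → Bool) (x' : ℕ → Fin I.nX' → Bool), ∃ n,
    (∀ k < n, I.RoundContinues (positionAt s x x' k) (x k) (x' k)) ∧
      I.WhiteWinsRound (positionAt s x x' n) (x n) (x' n)

end TeamFormulaGame

/-! ## Encoding of instances

Instances are written as words over a finite alphabet.  The numbers in it are in unary; indices of
variables and of policy states are bounded by the lengths of tables that are part of the same
word. -/

/-- The alphabet for instances. -/
inductive GameSym : Type
  | bit (b : Bool)
  | tick
  | sep
  | neg
  | conj
  | disj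
  | varX
  | varX'
  | varY (i : Fin 2)
  deriving DecidableEq, Fintype

/-- A natural number in unary. -/
def encodeNat (n : ℕ) : List GameSym := List.replicate n GameSym.tick ++ [GameSym.sep]

/-- A list of truth values. -/
def encodeBits {n : ℕ} (f : Fin n → Bool) : List GameSym := (List.ofFn f).map GameSym.bit ++ [GameSym.sep]

/-- A formula in prefix notation, with variables written by `v`. -/
def BoolFormula.encode {α : Type} (v : α → List GameSym) : BoolFormula α → List GameSym
  | var a => v a
  | const b => [GameSym.bit b]
  | neg φ => GameSym.neg :: φ.encode v
  | conj φ ψ => GameSym.conj :: (φ.encode v ++ ψ.encode v)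
  | disj φ ψ => GameSym.disj :: (φ.encode v ++ ψ.encode v)

/-- A variable: the set it belongs to and its index. -/
def encodeVar {n : ℕ} (kind : GameSym) (a : Fin n) : List GameSym := kind :: encodeNat a

/-- An instance of the Team Formula Game as a word. -/
def TeamFormulaGame.encode (I : TeamFormulaGame) : List GameSym :=
  encodeBits I.initX ++ encodeBits I.initX' ++ encodeBits (I.initY 0) ++ encodeBits (I.initY 1) ++
    encodeNat (I.h 0) ++ encodeNat (I.h 1) ++
    I.F.encode (Sum.elim (encodeVar GameSym.varX) (Sum.elim (encodeVar GameSym.varX')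
      (Sum.elim (encodeVar (GameSym.varY 0)) (encodeVar (GameSym.varY 1))))) ++
    I.F'.encode (Sum.elim (encodeVar GameSym.varX) (encodeVar GameSym.varX')) ++
    I.G.encode (encodeVar GameSym.varX)

/-- A policy as a word: the number of states, the start state, and a table with one row for each
state. -/
def CommPolicy.encode (P : CommPolicy) : List GameSym :=
  encodeNat P.numStates ++ encodeNat P.start ++
    (List.ofFn fun p => encodeNat (P.next p) ++
      encodeNat (P.midRound p).1 ++ encodeNat (P.midRound p).2 ++
      encodeNat (P.endRound p).1 ++ encodeNat (P.endRound p).2).flatten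

/-- The Team Formula Game with Communication as a decision problem, for policies in the class `C`:
the words that encode an instance consisting of a game and a policy in `C` such that White has a
forced win. -/
def tfgcLanguage (C : CommPolicy → Prop) : Language GameSym :=
  {w | ∃ (I : TeamFormulaGame) (P : CommPolicy),
    C P ∧ I.WhiteHasForcedWin P ∧ w = I.encode ++ P.encode}

/-!
# The Team Formula Game with one-bit mid-round exchanges is in 2-EXPSPACE

*The game.* The message that `W₀` sends in the middle of a round can be the value of `h 0`, and
likewise for `W₁`. So both players can know the values of both observed variables in all rounds
before they move, and nothing else that they could learn depends on Black's moves. White is thus a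
single player with partial information, whose knowledge is the set `S` of possible values of `X'`.
The positions of the resulting game of perfect information are pairs of a setting of `Y₀`, `Y₁` and
a set `S`, and there are doubly exponentially many of them; see `BeliefWin` and
`TeamFormulaGame.whiteHasForcedWin_iff`. A forced win gives a bound on the number of rounds by
compactness (`TeamFormulaGame.exists_bound_winsAt`), which allows the backward induction in
`TeamFormulaGame.beliefWin_possible`; conversely, the players share the observed values and follow
a common plan.

*The space bound.* Let `W` be the number with base `32` digits given by the letters of a word `u`,
so that `W` is exponential in the length of `u`. Positions in the word, and truth assignments to
variables of an instance, are numbers below `W`. Sets of these are numbers below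
`K = 2 ^ (W + 1)`, and sets of pairs of numbers below `K` are numbers below `M = 2 ^ (K * K)`.
The value of a formula and the set of winning positions are least fixed points, and hence can be
described by quantifying over all closed sets of pairs. In this way the game becomes a predicate
`Accepts M K W` that is built from arithmetic by quantifiers over numbers below `W`, `K` and `M`
(`accepts_iff`).

Such predicates are decided by register programs that store no number larger than a fixed power of
`M` (`LinDec`, `linDec_accepts`): a bounded quantifier is a loop. A Turing machine that keeps the
registers in binary on stacks simulates such a program with stacks of height `O(K * K)`, which is
doubly exponential in the length of `u` (`Prog.Exec.trace`, `inTwoEXPSPACE_of_linDec`).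
-/

/-! ### Register programs -/

/-- Structured programs on registers that hold natural numbers. -/
inductive Prog : Type
  | inc (r : ℕ)
  | dec (r : ℕ)
  | seq (p q : Prog)
  | loop (r : ℕ) (p : Prog)

namespace Prog

/-- A number that exceeds every register mentioned in the program. -/
def width : Prog → ℕ
  | inc r => r + 1
  | dec r => r + 1
  | seq p q => max p.width q.width
  | loop r p => max (r + 1) p.width

/-- `Exec B p s t`: the program `p`, started with register contents `s`, halts with contents `t`,
and no assignment ever stores a number larger than `B`. The command `loop r p` repeats `p` as long
as register `r` is nonzero. -/
inductive Exec (B : ℕ) : Prog → (ℕ → ℕ) → (ℕ → ℕ) → Prop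
  | inc {r s} : s r + 1 ≤ B → Exec B (inc r) s (Function.update s r (s r + 1))
  | dec {r s} : Exec B (dec r) s (Function.update s r (s r - 1))
  | seq {p q s t u} : Exec B p s t → Exec B q t u → Exec B (seq p q) s u
  | loop_done {r p s} : s r = 0 → Exec B (loop r p) s s
  | loop_step {r p s t u} : s r ≠ 0 → Exec B p s t → Exec B (loop r p) t u → Exec B (loop r p) s u

/-- The control points of the machine code of a program. -/
def Lbl : Prog → Type
  | inc _ => Bool
  | dec _ => Option Bool
  | seq p q => p.Lbl ⊕ q.Lbl
  | loop _ p => Option p.Lbl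

instance finite_lbl : (p : Prog) → Finite p.Lbl
  | inc _ => inferInstanceAs (Finite Bool)
  | dec _ => inferInstanceAs (Finite (Option Bool))
  | seq p q =>
    have := finite_lbl p
    have := finite_lbl q
    inferInstanceAs (Finite (p.Lbl ⊕ q.Lbl))
  | loop _ p =>
    have := finite_lbl p
    inferInstanceAs (Finite (Option p.Lbl))

/-- The control point at which a program starts. -/
def entry : (p : Prog) → p.Lbl
  | inc _ => false
  | dec _ => some false
  | seq p _ => Sum.inl p.entry
  | loop _ _ => none

end Prog

/-! ### Binary increment and decrement on stacks -/

/-- Binary successor on digit lists, least significant digit first. -/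
def succBits : List Bool → List Bool
  | [] => [true]
  | false :: l => true :: l
  | true :: l => false :: succBits l

/-- Binary predecessor on digit lists without leading zeros, least significant digit first. -/
def predBits : List Bool → List Bool
  | [] => []
  | false :: l => true :: predBits l
  | [true] => []
  | true :: b :: l => false :: b :: l

theorem bits_succ (n : ℕ) : (n + 1).bits = succBits n.bits := by
  induction n using Nat.strong_induction_on with
  | _ n ih =>
    obtain ⟨m, rfl | rfl⟩ : ∃ m, n = 2 * m ∨ n = 2 * m + 1 := ⟨n / 2, by omega⟩
    · rcases Nat.eq_zero_or_pos m with rfl | hm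
      · simp [succBits]
      · rw [Nat.bit1_bits, Nat.bit0_bits m hm.ne', succBits]
    · rw [show 2 * m + 1 + 1 = 2 * (m + 1) by ring, Nat.bit0_bits _ (by omega), Nat.bit1_bits,
        ih m (by omega), succBits]

theorem bits_pred (n : ℕ) : (n - 1).bits = predBits n.bits := by
  induction n using Nat.strong_induction_on with
  | _ n ih =>
    obtain ⟨m, rfl | rfl⟩ : ∃ m, n = 2 * m ∨ n = 2 * m + 1 := ⟨n / 2, by omega⟩
    · rcases Nat.eq_zero_or_pos m with rfl | hm
      · simp [predBits]
      · rw [show 2 * m - 1 = 2 * (m - 1) + 1 by omega, Nat.bit1_bits, Nat.bit0_bits m hm.ne',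
          ih m (by omega), predBits]
    · rcases Nat.eq_zero_or_pos m with rfl | hm
      · simp [predBits]
      · rw [Nat.bit1_bits, Nat.add_sub_cancel, Nat.bit0_bits _ hm.ne']
        rcases h : m.bits with _ | ⟨b, l⟩
        · have := congrArg List.length h
          rw [Nat.size_eq_bits_len, List.length_nil, Nat.size_eq_zero] at this
          omega
        · rfl

theorem length_le_length_succBits (l : List Bool) : l.length ≤ (succBits l).length := by
  induction l with
  | nil => simp [succBits]
  | cons b l ih => cases b <;> simp [succBits, ih]

theorem length_predBits_le (l : List Bool) : (predBits l).length ≤ l.length := by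
  induction l with
  | nil => simp [predBits]
  | cons b l ih =>
    cases b
    · simpa [predBits] using ih
    · cases l <;> simp [predBits]

theorem length_bits_le {m n : ℕ} (h : m ≤ n) : m.bits.length ≤ n.size := by
  rw [Nat.size_eq_bits_len]; exact Nat.size_le_size h

/-! ### Stack machines with binary registers -/

/-- The stacks: input, output, an auxiliary stack for carries, and `R` registers. -/
inductive StackIx (R : ℕ) : Type
  | inp
  | out
  | aux
  | reg (i : Fin R)
  deriving DecidableEq, Fintype

/-- The input stack holds letters, all other stacks hold binary digits. -/
abbrev StackAlphabet (A : Type) (R : ℕ) : StackIx R → Type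
  | .inp => A
  | .out => Bool
  | .aux => Bool
  | .reg _ => Bool

/-- The finite memory of the machine: the last symbol popped from a binary stack or the input. -/
abbrev PopMem (A : Type) : Type := Option Bool × Option A

section Machine

open Turing TM2.Stmt

variable {A Λ : Type} {R : ℕ}

/-- Statements of the machines considered here. -/
abbrev MStmt (A : Type) (R : ℕ) (Λ : Type) : Type := TM2.Stmt (StackAlphabet A R) Λ (PopMem A)

/-- Configurations of the machines considered here. -/
abbrev MCfg (A : Type) (R : ℕ) (Λ : Type) : Type := TM2.Cfg (StackAlphabet A R) Λ (PopMem A)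

/-- The stack contents with given input, auxiliary, output and register stacks. -/
def allStacks (i : List A) (a o : List Bool) (f : Fin R → List Bool) :
    ∀ k, List (StackAlphabet A R k)
  | .inp => i
  | .out => o
  | .aux => a
  | .reg r => f r

/-- A configuration with cleared memory. -/
def conf (l : Option Λ) (i : List A) (a o : List Bool) (f : Fin R → List Bool) : MCfg A R Λ :=
  ⟨l, (none, none), allStacks i a o f⟩

@[simp] theorem allStacks_inp (i : List A) (a o : List Bool) (f : Fin R → List Bool) :
    allStacks i a o f .inp = i := rfl

@[simp] theorem allStacks_aux (i : List A) (a o : List Bool) (f : Fin R → List Bool) :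
    allStacks i a o f .aux = a := rfl

@[simp] theorem allStacks_out (i : List A) (a o : List Bool) (f : Fin R → List Bool) :
    allStacks i a o f .out = o := rfl

@[simp] theorem allStacks_reg (i : List A) (a o : List Bool) (f : Fin R → List Bool) (r : Fin R) :
    allStacks i a o f (.reg r) = f r := rfl

@[simp] theorem update_allStacks_inp (i i' : List A) (a o : List Bool) (f : Fin R → List Bool) :
    Function.update (allStacks i a o f) .inp i' = allStacks i' a o f := by
  funext k; cases k <;> rfl

@[simp] theorem update_allStacks_aux (i : List A) (a a' o : List Bool) (f : Fin R → List Bool) :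
    Function.update (allStacks i a o f) .aux a' = allStacks i a' o f := by
  funext k; cases k <;> rfl

@[simp] theorem update_allStacks_out (i : List A) (a o o' : List Bool) (f : Fin R → List Bool) :
    Function.update (allStacks i a o f) .out o' = allStacks i a o' f := by
  funext k; cases k <;> rfl

@[simp] theorem update_allStacks_reg (i : List A) (a o : List Bool) (f : Fin R → List Bool)
    (r : Fin R) (x : List Bool) :
    Function.update (allStacks i a o f) (.reg r) x = allStacks i a o (Function.update f r x) := by
  funext k
  cases k with
  | reg j =>
    by_cases h : j = r
    · subst h; simp
    · rw [Function.update_of_ne (by simpa using h)]; simp [h]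
  | _ => rfl

/-- All stacks have height at most `N`. -/
def LowStacks (N : ℕ) (c : MCfg A R Λ) : Prop := ∀ k, (c.stk k).length ≤ N

theorem lowStacks_conf {N : ℕ} {l : Option Λ} {i : List A} {a o : List Bool}
    {f : Fin R → List Bool} :
    LowStacks N (conf l i a o f) ↔
      i.length ≤ N ∧ a.length ≤ N ∧ o.length ≤ N ∧ ∀ r, (f r).length ≤ N := by
  refine ⟨fun h => ⟨h .inp, h .aux, h .out, fun r => h (.reg r)⟩, ?_⟩
  rintro ⟨h1, h2, h3, h4⟩ (_ | _ | _ | r)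
  exacts [h1, h3, h2, h4 r]

/-- A run of the machine in which all configurations after the first have stacks of height at most
`N`. -/
def Trace (M : Λ → MStmt A R Λ) (N : ℕ) : MCfg A R Λ → MCfg A R Λ → Prop :=
  Relation.ReflTransGen fun a b => TM2.step M a = some b ∧ LowStacks N b

/-- Empties the auxiliary stack, pushing the digit `c` on register `r` for each of its elements. -/
def unwind (r : Fin R) (c : Bool) (back exit : Λ) : MStmt A R Λ :=
  pop .aux (fun _ b => (b, none)) <|
    branch (fun v => v.1.isSome)
      (push (.reg r) (fun _ => c) <| load (fun _ => (none, none)) <| goto fun _ => back)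
      (load (fun _ => (none, none)) <| goto fun _ => exit)

/-- The machine code of a program. To increment a register, the digits `1` at its low end are moved
to the auxiliary stack, the next digit becomes `1`, and `unwind` puts back digits `0`; to decrement
it, the roles of the digits are exchanged, and a leading zero is removed. The control points of the
program are embedded by `emb` into the labels of the machine, and control passes to `exit` at the
end. -/
def Prog.code [NeZero R] : (p : Prog) → (p.Lbl → Λ) → Λ → p.Lbl → MStmt A R Λ
  | .inc r, emb, _, false =>
    pop (.reg (Fin.ofNat R r)) (fun _ b => (b, none)) <|
      branch (fun v => v.1 == some true)
        (push .aux (fun _ => true) <| load (fun _ => (none, none)) <| goto fun _ => emb false)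
        (push (.reg (Fin.ofNat R r)) (fun _ => true) <| load (fun _ => (none, none)) <|
          goto fun _ => emb true)
  | .inc r, emb, exit, true => unwind (Fin.ofNat R r) false (emb true) exit
  | .dec r, emb, _, some false =>
    pop (.reg (Fin.ofNat R r)) (fun _ b => (b, none)) <|
      branch (fun v => v.1 == some false)
        (push .aux (fun _ => true) <| load (fun _ => (none, none)) <|
          goto fun _ => emb (some false))
        (branch (fun v => v.1 == some true)
          (load (fun _ => (none, none)) <| goto fun _ => emb (some true))
          (load (fun _ => (none, none)) <| goto fun _ => emb none))
  | .dec r, emb, _, some true =>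
    peek (.reg (Fin.ofNat R r)) (fun _ b => (b, none)) <|
      branch (fun v => v.1.isSome)
        (push (.reg (Fin.ofNat R r)) (fun _ => false) <| load (fun _ => (none, none)) <|
          goto fun _ => emb none)
        (load (fun _ => (none, none)) <| goto fun _ => emb none)
  | .dec r, emb, exit, none => unwind (Fin.ofNat R r) true (emb none) exit
  | .seq p q, emb, _, .inl l => p.code (fun l => emb (.inl l)) (emb (.inr q.entry)) l
  | .seq _ q, emb, exit, .inr l => q.code (fun l => emb (.inr l)) exit l
  | .loop r p, emb, exit, none =>
    peek (.reg (Fin.ofNat R r)) (fun _ b => (b, none)) <|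
      branch (fun v => v.1.isSome)
        (load (fun _ => (none, none)) <| goto fun _ => emb (some p.entry))
        (load (fun _ => (none, none)) <| goto fun _ => exit)
  | .loop _ p, emb, _, some l => p.code (fun l => emb (some l)) (emb none) l

variable {M : Λ → MStmt A R Λ} {N : ℕ}

theorem Trace.head {a b c : MCfg A R Λ} (h : TM2.step M a = some b) (hb : LowStacks N b)
    (hc : Trace M N b c) : Trace M N a c :=
  Relation.ReflTransGen.head ⟨h, hb⟩ hc

theorem lowStacks_update {l l' : Option Λ} {a a' : List Bool} {f : Fin R → List Bool} {r : Fin R}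
    {x : List Bool} (h : LowStacks (A := A) N (conf l [] a [] f)) (ha : a'.length ≤ N)
    (hx : x.length ≤ N) : LowStacks (A := A) N (conf l' [] a' [] (Function.update f r x)) := by
  rw [lowStacks_conf] at h ⊢
  refine ⟨h.1, ha, h.2.2.1, fun j => ?_⟩
  by_cases hj : j = r
  · subst hj; simpa using hx
  · simpa [hj] using h.2.2.2 j

/-- `unwind` replaces the contents of the auxiliary stack by as many digits `c` on register `r`. -/
theorem trace_unwind {r : Fin R} {c : Bool} {back exit : Λ} (hM : M back = unwind r c back exit)
    (a : List Bool) (f : Fin R → List Bool) (hs : LowStacks (A := A) N (conf (some back) [] a [] f))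
    (hN : a.length + (f r).length ≤ N) :
    Trace M N (conf (some back) [] a [] f)
      (conf (some exit) [] [] [] (Function.update f r (List.replicate a.length c ++ f r))) := by
  induction a generalizing f with
  | nil =>
    have hs' : LowStacks N (conf (A := A) (some exit) [] [] [] f) := by
      rw [lowStacks_conf] at hs ⊢; exact hs
    refine Trace.head ?_ hs' ?_
    · simp [conf, hM, unwind, allStacks]
    · simp only [List.length_nil, List.replicate_zero, List.nil_append, Function.update_eq_self]
      exact Relation.ReflTransGen.refl
  | cons b a ih =>
    have hs' : LowStacks N (conf (A := A) (some back) [] a [] (Function.update f r (c :: f r))) :=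
      lowStacks_update hs (by simp at hN; omega) (by simp at hN ⊢; omega)
    refine Trace.head (b := conf (some back) [] a [] (Function.update f r (c :: f r))) ?_ hs' ?_
    · simp [conf, hM, unwind, allStacks]
    · convert ih _ hs' (by simp at hN ⊢; omega) using 2
      simp [List.replicate_succ', List.append_assoc]

theorem trace_inc [NeZero R] {r : ℕ} {emb : (Prog.inc r).Lbl → Λ} {exit : Λ}
    (hM : ∀ l, M (emb l) = (Prog.inc r).code emb exit l) (l a : List Bool) (f : Fin R → List Bool)
    (hs : LowStacks (A := A) N (conf (some (emb false)) [] a [] f)) (hl : f (Fin.ofNat R r) = l)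
    (hN : a.length + (succBits l).length ≤ N) :
    Trace M N (conf (some (emb false)) [] a [] f)
      (conf (some exit) [] [] [] (Function.update f (Fin.ofNat R r)
        (List.replicate a.length false ++ succBits l))) := by
  have h0 := hM false
  have h1 := hM true
  simp only [Prog.code] at h0 h1
  clear hM
  generalize Fin.ofNat R r = q at *
  induction l generalizing a f with
  | nil =>
    have hs' : LowStacks N (conf (A := A) (some (emb true)) [] a []
        (Function.update f q [true])) :=
      lowStacks_update hs (by omega) (by simp [succBits] at hN ⊢; omega)
    refine Trace.head ?_ hs' ?_
    · simp [conf, h0, hl]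
    · convert trace_unwind h1 _ _ hs' (by simpa [succBits] using hN) using 2
      simp [succBits]
  | cons b l ih =>
    have hlen := length_le_length_succBits l
    cases b with
    | false =>
      have hs' : LowStacks N (conf (A := A) (some (emb true)) [] a []
          (Function.update f q (true :: l))) :=
        lowStacks_update hs (by omega) (by simp [succBits] at hN ⊢; omega)
      refine Trace.head ?_ hs' ?_
      · simp [conf, h0, hl]
      · convert trace_unwind h1 _ _ hs' (by simpa [succBits] using hN) using 2
        simp [succBits]
    | true =>
      have hs' : LowStacks N (conf (A := A) (some (emb false)) [] (true :: a) []
          (Function.update f q l)) :=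
        lowStacks_update hs (by simp [succBits] at hN ⊢; omega) (by simp [succBits] at hN ⊢; omega)
      refine Trace.head ?_ hs' ?_
      · simp [conf, h0, hl]
      · convert ih _ _ hs' (by simp [succBits] at hN ⊢; omega) (by simp) using 2
        simp [succBits, List.replicate_succ', List.append_assoc]

theorem trace_dec [NeZero R] {r : ℕ} {emb : (Prog.dec r).Lbl → Λ} {exit : Λ}
    (hM : ∀ l, M (emb l) = (Prog.dec r).code emb exit l) (l a : List Bool) (f : Fin R → List Bool)
    (hs : LowStacks (A := A) N (conf (some (emb (some false))) [] a [] f))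
    (hl : f (Fin.ofNat R r) = l)
    (hN : a.length + l.length ≤ N) :
    Trace M N (conf (some (emb (some false))) [] a [] f)
      (conf (some exit) [] [] [] (Function.update f (Fin.ofNat R r)
        (List.replicate a.length true ++ predBits l))) := by
  have h0 := hM (some false)
  have h1 := hM (some true)
  have h2 := hM none
  simp only [Prog.code] at h0 h1 h2
  clear hM
  generalize Fin.ofNat R r = q at *
  induction l generalizing a f with
  | nil =>
    have hf : Function.update f q [] = f := by rw [← hl, Function.update_eq_self]
    have hs' : LowStacks N (conf (A := A) (some (emb none)) [] a [] f) := by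
      rw [lowStacks_conf] at hs ⊢; exact hs
    refine Trace.head ?_ hs' ?_
    · simp [conf, h0, hl, hf]
    · convert trace_unwind h2 _ _ hs' (by simpa [hl] using hN) using 2
      simp [predBits, hl]
  | cons b l ih =>
    cases b with
    | false =>
      have hs' : LowStacks N (conf (A := A) (some (emb (some false))) [] (true :: a) []
          (Function.update f q l)) :=
        lowStacks_update hs (by simp at hN ⊢; omega) (by simp at hN ⊢; omega)
      refine Trace.head ?_ hs' ?_
      · simp [conf, h0, hl]
      · convert ih _ _ hs' (by simp at hN ⊢; omega) (by simp) using 2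
        simp [predBits, List.replicate_succ', List.append_assoc]
    | true =>
      have hs' : LowStacks N (conf (A := A) (some (emb (some true))) [] a []
          (Function.update f q l)) :=
        lowStacks_update hs (by omega) (by simp at hN ⊢; omega)
      refine Trace.head ?_ hs' ?_
      · simp [conf, h0, hl]
      · have hs2 : LowStacks N (conf (A := A) (some (emb none)) [] a []
            (Function.update f q (predBits (true :: l)))) :=
          lowStacks_update hs (by omega) (by have := length_predBits_le (true :: l); omega)
        refine Trace.head ?_ hs2 ?_
        · cases l <;> simp [conf, h1, predBits]
        · convert trace_unwind h2 _ _ hs2 ?_ using 2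
          · simp
          · have := length_predBits_le (true :: l)
            simp only [Function.update_self]; omega

/-- The register stacks that represent given register contents. -/
def regStacks (R : ℕ) (s : ℕ → ℕ) (r : Fin R) : List Bool := (s r).bits

theorem regStacks_update [NeZero R] {r : ℕ} (hr : r < R) (s : ℕ → ℕ) (x : ℕ) :
    regStacks R (Function.update s r x) =
      Function.update (regStacks R s) (Fin.ofNat R r) x.bits := by
  funext j
  have : (Fin.ofNat R r : ℕ) = r := Nat.mod_eq_of_lt hr
  by_cases hj : j = Fin.ofNat R r
  · subst hj; simp [regStacks, Nat.mod_eq_of_lt hr]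
  · have hj' : (j : ℕ) ≠ r := fun h => hj (Fin.ext (by rw [this, h]))
    rw [Function.update_of_ne hj, regStacks, regStacks, Function.update_of_ne hj']

/-- The machine code of a program simulates it, with stacks no higher than the binary length of the
largest number stored. -/
theorem Prog.Exec.trace [NeZero R] {B : ℕ} {p : Prog} {s t : ℕ → ℕ} (h : p.Exec B s t)
    (hp : p.width ≤ R) {emb : p.Lbl → Λ} {exit : Λ} (hM : ∀ l, M (emb l) = p.code emb exit l)
    (hs : ∀ r : Fin R, s r ≤ B) (hB : B.size ≤ N) :
    Trace M N (conf (some (emb p.entry)) [] [] [] (regStacks R s))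
      (conf (some exit) [] [] [] (regStacks R t)) ∧ ∀ r : Fin R, t r ≤ B := by
  have low : ∀ (s : ℕ → ℕ) (l : Option Λ), (∀ r : Fin R, s r ≤ B) →
      LowStacks (A := A) N (conf l [] [] [] (regStacks R s)) := fun s l hs =>
    lowStacks_conf.2 ⟨by simp, by simp, by simp, fun r => (length_bits_le (hs r)).trans hB⟩
  induction h generalizing exit with
  | @inc r s h =>
    have hr : r < R := hp
    constructor
    · rw [regStacks_update hr, bits_succ]
      refine trace_inc hM _ [] _ (low _ _ hs) (by simp [regStacks, Nat.mod_eq_of_lt hr]) ?_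
      rw [← bits_succ, List.length_nil, zero_add]
      exact (length_bits_le h).trans hB
    · intro j
      by_cases hj : (j : ℕ) = r
      · simpa [hj] using h
      · simpa [hj] using hs j
  | @dec r s =>
    have hr : r < R := hp
    constructor
    · rw [regStacks_update hr, bits_pred]
      refine trace_dec hM _ [] _ (low _ _ hs) (by simp [regStacks, Nat.mod_eq_of_lt hr]) ?_
      rw [List.length_nil, zero_add]
      exact (length_bits_le (hs ⟨r, hr⟩)).trans hB
    · intro j
      by_cases hj : (j : ℕ) = r
      · have := hs j
        simp [hj] at this ⊢; omega
      · simpa [hj] using hs j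
  | @seq p q s t u h1 h2 ih1 ih2 =>
    obtain ⟨a, b⟩ := ih1 ((le_max_left _ _).trans hp) (fun l => hM (.inl l)) hs
    obtain ⟨c, d⟩ := ih2 ((le_max_right _ _).trans hp) (fun l => hM (.inr l)) b
    exact ⟨a.trans c, d⟩
  | @loop_done r p s h =>
    have h0 := hM none
    simp only [Prog.code] at h0
    have hr : r < R := (le_max_left _ _).trans hp
    have hz : regStacks R s (Fin.ofNat R r) = [] := by
      simp [regStacks, Nat.mod_eq_of_lt hr, h]
    refine ⟨Trace.head ?_ (low _ _ hs) .refl, hs⟩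
    generalize Fin.ofNat R r = q at *
    simp [conf, h0, Prog.entry, hz]
  | @loop_step r p s t u h h1 h2 ih1 ih2 =>
    have h0 := hM none
    simp only [Prog.code] at h0
    have hr : r < R := (le_max_left _ _).trans hp
    have hz : ∃ b l, regStacks R s (Fin.ofNat R r) = b :: l := by
      rcases hc : regStacks R s (Fin.ofNat R r) with _ | ⟨b, l⟩
      · have := congrArg List.length hc
        simp only [regStacks, Fin.val_ofNat, Nat.mod_eq_of_lt hr] at this
        rw [Nat.size_eq_bits_len, List.length_nil, Nat.size_eq_zero] at this
        exact absurd this h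
      · exact ⟨b, l, rfl⟩
    obtain ⟨b, l, hz⟩ := hz
    obtain ⟨a, b'⟩ := ih1 ((le_max_right _ _).trans hp) (fun l => hM (some l)) hs
    obtain ⟨c, d⟩ := ih2 hp hM b'
    refine ⟨Trace.head ?_ (low _ (some (emb (some p.entry))) hs) (a.trans c), d⟩
    generalize Fin.ofNat R r = q at *
    simp [conf, h0, Prog.entry, hz]

end Machine

/-! ### The deciding machine -/

section Machine

open Turing TM2.Stmt

variable {A : Type}

/-- The labels of a machine that reads a word, runs the program `p` and gives an answer. -/
inductive MLbl (p : Prog) : Type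
  | read
  | run (l : p.Lbl)
  | answer

instance (p : Prog) : Finite (MLbl p) :=
  Finite.of_injective (β := Option (Option p.Lbl))
    (fun | .read => none | .answer => some none | .run l => some (some l)) (by
      rintro (_ | _ | _) (_ | _ | _) h <;> simp_all)

/-- The number with base-32 digits given by the letters of a word, the first letter being the most
significant one. -/
def wordNum (code : A → ℕ) (w : List A) : ℕ := w.foldl (fun W a => 32 * W + code a) 0

/-- Binary digit `j` of the code of the letter held in memory. -/
def memDigit (code : A → ℕ) (j : ℕ) (v : PopMem A) : Bool :=
  v.2.elim false fun a => decide (code a / 2 ^ j % 2 = 1)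

/-- A machine that computes the number of the input word in register 0, runs `p`, and outputs
whether register 1 is nonzero at the end. Since letter codes have five binary digits, reading a
letter means pushing these digits. -/
def solver (p : Prog) (R : ℕ) [NeZero R] (code : A → ℕ) : MLbl p → MStmt A R (MLbl p)
  | .read =>
    pop .inp (fun _ a => (none, a)) <|
      branch (fun v => v.2.isSome)
        (push (.reg (Fin.ofNat R 0)) (memDigit code 4) <|
          push (.reg (Fin.ofNat R 0)) (memDigit code 3) <|
          push (.reg (Fin.ofNat R 0)) (memDigit code 2) <|
          push (.reg (Fin.ofNat R 0)) (memDigit code 1) <|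
          push (.reg (Fin.ofNat R 0)) (memDigit code 0) <|
          load (fun _ => (none, none)) <| goto fun _ => .read)
        (load (fun _ => (none, none)) <| goto fun _ => .run p.entry)
  | .run l => p.code .run .answer l
  | .answer =>
    pop (.reg (Fin.ofNat R 1)) (fun _ b => (b, none)) <|
      branch (fun v => v.1.isSome)
        (push .out (fun _ => true) <| load (fun _ => (none, none)) halt)
        (push .out (fun _ => false) <| load (fun _ => (none, none)) halt)

theorem bits_eq_cons {n : ℕ} (hn : n ≠ 0) : n.bits = decide (n % 2 = 1) :: (n / 2).bits := by
  obtain ⟨m, rfl | rfl⟩ : ∃ m, n = 2 * m ∨ n = 2 * m + 1 := ⟨n / 2, by omega⟩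
  · rw [Nat.bit0_bits m (by omega)]; simp
  · rw [Nat.bit1_bits, show (2 * m + 1) / 2 = m by omega]; simp

theorem bits_append_letter (W : ℕ) {d : ℕ} (h : 16 ≤ d) (h' : d < 32) :
    (32 * W + d).bits = decide (d / 2 ^ 0 % 2 = 1) :: decide (d / 2 ^ 1 % 2 = 1) ::
      decide (d / 2 ^ 2 % 2 = 1) :: decide (d / 2 ^ 3 % 2 = 1) :: decide (d / 2 ^ 4 % 2 = 1) ::
        W.bits := by
  rw [bits_eq_cons (by omega), bits_eq_cons (by omega), bits_eq_cons (by omega),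
    bits_eq_cons (by omega), bits_eq_cons (by omega)]
  simp only [List.cons.injEq, decide_eq_decide]
  refine ⟨by omega, by omega, by omega, by omega, by omega, ?_⟩
  congr 1; omega

theorem trace_read {p : Prog} {R : ℕ} [NeZero R] {code : A → ℕ}
    (hcode : ∀ a, 16 ≤ code a ∧ code a < 32) (N : ℕ) (w : List A) (W : ℕ) (hw : w.length ≤ N)
    (hN : (w.foldl (fun W a => 32 * W + code a) W).size ≤ N) :
    Trace (solver p R code) N
      (conf (some .read) w [] [] (regStacks R (Function.update 0 0 W)))
      (conf (some (.run p.entry)) [] [] []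
        (regStacks R (Function.update 0 0 (w.foldl (fun W a => 32 * W + code a) W)))) := by
  have hR : 0 < R := Nat.pos_of_ne_zero (NeZero.ne R)
  have low : ∀ l (w : List A) (W : ℕ), w.length ≤ N → W.size ≤ N →
      LowStacks N (conf (Λ := MLbl p) l w [] [] (regStacks R (Function.update 0 0 W))) := by
    intro l w W hw hW
    refine lowStacks_conf.2 ⟨hw, by simp, by simp, fun r => ?_⟩
    by_cases hr : (r : ℕ) = 0
    · simpa [regStacks, hr, Nat.size_eq_bits_len] using hW
    · simp [regStacks, hr]
  induction w generalizing W with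
  | nil =>
    refine Trace.head ?_ (low _ _ _ hw hN) .refl
    simp [conf, solver]
  | cons a w ih =>
    have hle : ∀ (w : List A) (V : ℕ), V ≤ w.foldl (fun W a => 32 * W + code a) V := by
      intro w
      induction w with
      | nil => intro V; rfl
      | cons b w ih => intro V; exact le_trans (by omega) (ih (32 * V + code b))
    rw [List.foldl_cons] at hN ⊢
    refine Trace.head ?_ (low _ _ _ ?_ ?_) (ih (32 * W + code a) ?_ hN)
    · rw [regStacks_update hR, regStacks_update hR,
        bits_append_letter W (hcode a).1 (hcode a).2]
      have h1 : ∀ x, Function.update (regStacks R 0) (Fin.ofNat R 0) x (Fin.ofNat R 0) = x :=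
        fun x => by simp
      simp only [conf, TM2.step, solver]
      generalize Fin.ofNat R 0 = q at *
      simp [memDigit]
    · simp at hw ⊢; omega
    · exact (Nat.size_le_size (hle w _)).trans hN
    · simp at hw ⊢; omega

theorem trace_answer {p : Prog} {R : ℕ} [NeZero R] (hR : 1 < R) {code : A → ℕ} {N : ℕ}
    (hN : 1 ≤ N) (b : Bool) :
    Trace (solver p R code) N
      (conf (some .answer) [] [] [] (regStacks R (Function.update 0 1 b.toNat)))
      (conf none [] [] [b] fun _ => []) := by
  refine Trace.head ?_ (lowStacks_conf.2 ⟨by simp, by simp, by simpa using hN, by simp⟩) .refl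
  have hz : regStacks R 0 = fun _ => [] := by funext; simp [regStacks]
  rw [regStacks_update hR, hz]
  simp only [conf, TM2.step, solver]
  generalize Fin.ofNat R 1 = q at *
  cases b <;> simp

theorem Trace.reaches {Λ : Type} {R N : ℕ} {M : Λ → MStmt A R Λ} {a b : MCfg A R Λ}
    (h : Trace M N a b) : ∃ n, (flip bind (TM2.step M))^[n] (some a) = some b := by
  induction h using Relation.ReflTransGen.head_induction_on with
  | refl => exact ⟨0, rfl⟩
  | head h _ ih =>
    obtain ⟨n, hn⟩ := ih
    refine ⟨n + 1, ?_⟩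
    rw [Function.iterate_succ_apply, ← hn, ← h.1]
    rfl

/-- As the machine is deterministic, all configurations that it reaches occur in a halting run. -/
theorem Trace.lowStacks_of_reaches {Λ : Type} {R N : ℕ} {M : Λ → MStmt A R Λ} {a b c : MCfg A R Λ}
    (h : Trace M N a b) (ha : LowStacks N a) (hb : TM2.step M b = none)
    (hc : StateTransition.Reaches (TM2.step M) a c) : LowStacks N c := by
  induction h using Relation.ReflTransGen.head_induction_on with
  | refl =>
    rcases hc.cases_head with rfl | ⟨d, hd, -⟩
    · exact ha
    · simp [hb] at hd
  | head h _ ih =>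
    rcases hc.cases_head with rfl | ⟨d, hd, hc⟩
    · exact ha
    · rw [h.1, Option.mem_some_iff] at hd
      subst hd
      exact ih h.2 hc

theorem card_stackIx (R : ℕ) : Fintype.card (StackIx R) = R + 3 := by
  have e : StackIx R ≃ Fin R ⊕ Fin 3 :=
    { toFun := fun | .inp => .inr 0 | .out => .inr 1 | .aux => .inr 2 | .reg i => .inl i
      invFun := fun | .inr 0 => .inp | .inr 1 => .out | .inr 2 => .aux | .inl i => .reg i
      left_inv := by rintro (_ | _ | _ | _) <;> rfl
      right_inv := by
        rintro (i | i)
        · rfl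
        · fin_cases i <;> rfl }
  simpa using Fintype.card_congr e

/-- A program that decides a language when started on the numbers of the words yields a machine
that decides the language in space linear in the binary length of the numbers stored. -/
theorem nonempty_spaceDecider [Finite A] {L : Language A} {code : A → ℕ}
    (hcode : ∀ a, 16 ≤ code a ∧ code a < 32) (p : Prog) (B s : ℕ → ℕ) (b : List A → Bool)
    (hb : ∀ w, b w = true ↔ w ∈ L)
    (hp : ∀ w, p.Exec (B (wordNum code w)) (Function.update 0 0 (wordNum code w))
      (Function.update 0 1 (b w).toNat))
    (hB : ∀ W, W ≤ B W)
    (hs : ∀ w, (p.width + 5) * (max w.length (B (wordNum code w)).size + 1) ≤ s w.length) :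
    Nonempty (SpaceDecider L s) := by
  classical
  have : Fintype A := Fintype.ofFinite A
  have : Fintype (MLbl p) := Fintype.ofFinite _
  have hR : 1 < p.width + 2 := by omega
  let tm : FinTM2 :=
    { K := StackIx (p.width + 2), k₀ := .inp, k₁ := .out, Γ := StackAlphabet A _, Λ := MLbl p
      main := .read, σ := PopMem A, initialState := (none, none)
      Γk₀Fin := inferInstanceAs (Fintype A)
      m := solver p (p.width + 2) code }
  have init : ∀ w : List A, initList tm w =
      conf (some .read) w [] [] (regStacks (p.width + 2) (Function.update 0 0 0)) := by
    intro w
    have hz : regStacks (p.width + 2) (Function.update (0 : ℕ → ℕ) 0 0) = fun _ => [] := by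
      funext; simp [regStacks]
    rw [hz]
    refine congrArg (TM2.Cfg.mk _ _) (funext fun k => ?_)
    cases k <;> rfl
  have final : ∀ b : Bool, haltList tm [b] = conf none [] [] [b] fun _ => [] := by
    intro w
    refine congrArg (TM2.Cfg.mk _ _) (funext fun k => ?_)
    cases k <;> rfl
  have run : ∀ w : List A,
      Trace (solver p (p.width + 2) code) (max w.length (B (wordNum code w)).size + 1)
      (initList tm w) (haltList tm [b w]) := by
    intro w
    rw [init, final]
    have h1 : (wordNum code w).size ≤ (B (wordNum code w)).size := Nat.size_le_size (hB _)
    refine (trace_read hcode _ w 0 (by omega) (h1.trans (by omega))).trans ?_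
    refine ((hp w).trace (M := solver p (p.width + 2) code) (emb := .run) (exit := .answer)
      (Nat.le_add_right _ 2) (fun l => rfl) ?_ (by omega)).1.trans
      (trace_answer hR (by omega) _)
    intro r
    by_cases hr : (r : ℕ) = 0
    · simpa [hr] using hB _
    · simp [hr]
  refine ⟨⟨⟨tm, Equiv.refl A, Equiv.refl Bool⟩, ?_, ?_, ?_⟩⟩
  · rintro (_ | _ | _ | _)
    exacts [inferInstanceAs (Finite A), inferInstanceAs (Finite Bool),
      inferInstanceAs (Finite Bool), inferInstanceAs (Finite Bool)]
  · intro w c hc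
    have hcb : c = b w := by
      rw [Bool.eq_iff_iff]; exact hc.trans (hb w).symm
    subst hcb
    obtain ⟨n, hn⟩ := (run w).reaches
    refine ⟨⟨n, ?_⟩⟩
    have : w.map (Equiv.refl A).symm = w := by simp
    exact (congrArg (fun v => (flip bind tm.step)^[n] (some (initList tm v))) this).trans hn
  · intro w c hc
    have hw : w.map (Equiv.refl A).symm = w := by simp
    have hc' : StateTransition.Reaches (TM2.step (solver p (p.width + 2) code)) (initList tm w) c :=
      (congrArg (fun v => StateTransition.Reaches tm.step (initList tm v) c) hw).mp hc
    have low : LowStacks (max w.length (B (wordNum code w)).size + 1) c := by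
      refine (run w).lowStacks_of_reaches ?_ rfl hc'
      rw [init]
      refine lowStacks_conf.2 ⟨by omega, by simp, by simp, by simp [regStacks]⟩
    refine le_trans ?_ (hs w)
    have := Finset.sum_le_card_nsmul (@Finset.univ tm.K tm.kFin)
      (fun k => (TM2.Cfg.stk c k).length) _ (fun k _ => low k)
    refine this.trans (le_of_eq ?_)
    rw [smul_eq_mul]
    congr 1
    exact card_stackIx _

end Machine

/-! ### Functions computed by register programs -/

namespace Prog

/-- Sets register `r` to zero. -/
def clear (r : ℕ) : Prog := .loop r (.dec r)

/-- Adds register `r` to register `t` and sets register `r` to zero. -/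
def addTo (r t : ℕ) : Prog := .loop r (.seq (.dec r) (.inc t))

/-- Adds register `r` to register `t`, using register `u` to restore register `r`. -/
def copy (r t u : ℕ) : Prog :=
  .seq (.loop r (.seq (.dec r) (.seq (.inc t) (.inc u)))) (addTo u r)

namespace Exec

variable {B : ℕ}

theorem clear (r : ℕ) (s : ℕ → ℕ) : (Prog.clear r).Exec B s (Function.update s r 0) := by
  generalize hn : s r = n
  induction n generalizing s with
  | zero => rw [← hn, Function.update_eq_self]; exact loop_done hn
  | succ n ih =>
    have := ih (Function.update s r (s r - 1)) (by simp [hn])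
    rw [Function.update_idem] at this
    exact loop_step (by omega) dec this

theorem addTo {r t : ℕ} (hrt : r ≠ t) (s : ℕ → ℕ) (hB : s t + s r ≤ B) :
    (Prog.addTo r t).Exec B s
      (Function.update (Function.update s t (s t + s r)) r 0) := by
  generalize hn : s r = n
  induction n generalizing s with
  | zero =>
    have : Function.update (Function.update s t (s t + 0)) r 0 = s := by
      rw [add_zero, Function.update_eq_self, ← hn, Function.update_eq_self]
    rw [this]; exact loop_done hn
  | succ n ih =>
    refine loop_step (by omega) (seq dec (inc ?_)) ?_
    · simp [hrt.symm]; omega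
    · refine Eq.mp (congrArg (Exec B _ _) ?_) (ih _ ?_ ?_)
      · funext j; simp only [Function.update_apply]; split_ifs <;> simp_all; omega
      · simp [hrt, hrt.symm]; omega
      · simp [hrt, hn]

theorem copy {r t u : ℕ} (hrt : r ≠ t) (hru : r ≠ u) (htu : t ≠ u) (s : ℕ → ℕ)
    (ht : s t = 0) (hu : s u = 0) (hB : s r ≤ B) :
    (Prog.copy r t u).Exec B s
      (Function.update s t (s r)) := by
  have key : ∀ n s, s r = n → s t + s r ≤ B → s u + s r ≤ B →
      (Prog.loop r (.seq (.dec r) (.seq (.inc t) (.inc u)))).Exec B s (Function.update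
        (Function.update (Function.update s t (s t + s r)) u (s u + s r)) r 0) := by
    intro n
    induction n with
    | zero =>
      intro s hn _ _
      have : Function.update (Function.update (Function.update s t (s t + s r)) u (s u + s r)) r 0
          = s := by
        rw [hn, add_zero, Function.update_eq_self, add_zero, Function.update_eq_self, ← hn,
          Function.update_eq_self]
      rw [this]; exact loop_done hn
    | succ n ih =>
      intro s hn h1 h2
      refine loop_step (by omega) (seq dec (seq (inc ?_) (inc ?_))) ?_
      · simp [hrt.symm]; omega
      · simp [hru.symm, htu.symm]; omega
      · refine Eq.mp (congrArg (Exec B _ _) ?_) (ih _ ?_ ?_ ?_)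
        · funext j; simp only [Function.update_apply]; split_ifs <;> simp_all <;> omega
        · simp [hrt, hru, hn]
        · simp [hrt, hru, hrt.symm, htu]; omega
        · simp [hrt, hru, hru.symm, htu.symm]; omega
  refine seq (key _ s rfl (by omega) (by omega)) ?_
  refine Eq.mp (congrArg (Exec B _ _) ?_) (addTo hru.symm _ ?_)
  · funext j; simp only [Function.update_apply]; split_ifs <;> simp_all
  · simp [hru.symm, hu]; omega

theorem mono {B' : ℕ} (hB : B ≤ B') {p : Prog} {s t : ℕ → ℕ} (h : p.Exec B s t) :
    p.Exec B' s t := by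
  induction h with
  | inc h => exact inc (h.trans hB)
  | dec => exact dec
  | seq _ _ ih1 ih2 => exact seq ih1 ih2
  | loop_done h => exact loop_done h
  | loop_step h _ _ ih1 ih2 => exact loop_step h ih1 ih2

end Exec

end Prog

/-- `Comp f b`: the function `f` can be computed by programs that store no number larger than the
value of `b`. The arguments may lie in any registers `ρ` below `t`, and all registers from `t` on
are free to be used; the result is stored in register `t`, and no other register is changed in the
end. -/
def Comp {k : ℕ} (f b : (Fin k → ℕ) → ℕ) : Prop :=
  ∀ (ρ : Fin k → ℕ) (t : ℕ), (∀ i, ρ i < t) → ∃ p : Prog, ∀ (s : ℕ → ℕ) (B : ℕ),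
    (∀ i, t ≤ i → s i = 0) → b (fun i => s (ρ i)) ≤ B →
      p.Exec B s (Function.update s t (f fun i => s (ρ i)))

namespace Comp

open Prog.Exec

variable {k : ℕ} {f b : (Fin k → ℕ) → ℕ}

theorem mono (h : Comp f b) {b' : (Fin k → ℕ) → ℕ} (hb : ∀ e, b e ≤ b' e) : Comp f b' :=
  fun ρ t hρ => (h ρ t hρ).imp fun _ hp s B hs hB => hp s B hs ((hb _).trans hB)

theorem zero : Comp (fun _ : Fin k → ℕ => 0) fun _ => 0 := fun _ t _ =>
  ⟨.dec t, fun s B hs _ => by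
    convert dec using 2
    rw [hs t le_rfl]⟩

theorem var (i : Fin k) : Comp (fun e => e i) fun e => e i := fun ρ t hρ =>
  ⟨.copy (ρ i) t (t + 1), fun s B hs hB =>
    copy (u := t + 1) (hρ i).ne (by have := hρ i; omega) (by omega) s
    (hs t le_rfl) (hs _ (by omega)) hB⟩

theorem succ (h : Comp f b) : Comp (fun e => f e + 1) fun e => max (b e) (f e + 1) :=
  fun ρ t hρ => by
    obtain ⟨p, hp⟩ := h ρ t hρ
    refine ⟨.seq p (.inc t), fun s B hs hB => ?_⟩
    refine seq (hp s B hs (le_trans (le_max_left _ _) hB)) ?_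
    convert inc ?_ using 1
    · simp
    · simpa using le_trans (le_max_right _ _) hB

theorem reindex (h : Comp f b) {m : ℕ} (σ : Fin k → Fin m) :
    Comp (fun e => f fun i => e (σ i)) fun e => b fun i => e (σ i) :=
  fun ρ t hρ => h (fun i => ρ (σ i)) t fun _ => hρ _

theorem cons_apply (s : ℕ → ℕ) (t : ℕ) (ρ : Fin k → ℕ) :
    (fun i => s ((Fin.cons t ρ : Fin (k + 1) → ℕ) i)) = Fin.cons (s t) fun i => s (ρ i) := by
  funext i
  refine Fin.cases ?_ (fun i => ?_) i <;> simp

theorem bind {f b : (Fin (k + 1) → ℕ) → ℕ} {g b' : (Fin k → ℕ) → ℕ} (hf : Comp f b)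
    (hg : Comp g b') :
    Comp (fun e => f (Fin.cons (g e) e))
      fun e => b' e + b (Fin.cons (g e) e) + f (Fin.cons (g e) e) := fun ρ t hρ => by
  obtain ⟨p, hp⟩ := hg ρ t hρ
  obtain ⟨q, hq⟩ := hf (Fin.cons t ρ) (t + 1) fun i =>
    Fin.cases (by simp) (fun i => by have := hρ i; simp; omega) i
  refine ⟨.seq p (.seq q (.seq (.clear t) (.addTo (t + 1) t))), fun s B hs hB => ?_⟩
  simp only at hB
  have hρ' : ∀ x, (fun i => Function.update s t x (ρ i)) = fun i => s (ρ i) := fun x => by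
    funext i; exact Function.update_of_ne (hρ i).ne _ _
  have h2 := hq (Function.update s t (g fun i => s (ρ i))) B
    (fun i hi => by rw [Function.update_of_ne (by omega)]; exact hs i (by omega))
    (by rw [cons_apply, hρ', Function.update_self]; omega)
  rw [cons_apply, hρ', Function.update_self] at h2
  refine seq (hp s B hs (by omega)) (seq h2 (seq (clear t _) ?_))
  refine Eq.mp (congrArg (Prog.Exec B _ _) ?_) (addTo (by omega) _ ?_)
  · funext j; simp only [Function.update_apply]
    split_ifs <;> first | rfl | omega | exact (hs j (by omega)).symm
  · simp; omega

/-- Primitive recursion. Only the intermediate results need to be bounded: each iteration clears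
its work registers, so the values of `bh` do not add up. -/
theorem prec {g r bg br b : (Fin k → ℕ) → ℕ} {h bh : (Fin (k + 2) → ℕ) → ℕ}
    (hg : Comp g bg) (hr : Comp r br) (hh : Comp h bh) {F : ℕ → (Fin k → ℕ) → ℕ}
    (F0 : ∀ e, F 0 e = g e) (F1 : ∀ n e, F (n + 1) e = h (Fin.cons n (Fin.cons (F n e) e)))
    (hbg : ∀ e, bg e ≤ b e) (hbr : ∀ e, br e ≤ b e) (hrb : ∀ e, r e ≤ b e)
    (hF : ∀ e n, n ≤ r e → F n e ≤ b e)
    (hbh : ∀ e n, n < r e → bh (Fin.cons n (Fin.cons (F n e) e)) ≤ b e) :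
    Comp (fun e => F (r e) e) b := fun ρ t hρ => by
  obtain ⟨p, hp⟩ := hg ρ t hρ
  obtain ⟨q, hq⟩ := hr ρ (t + 1) fun i => (hρ i).trans (by omega)
  obtain ⟨u, hu⟩ := hh (Fin.cons (t + 2) (Fin.cons t ρ)) (t + 3) fun i =>
    Fin.cases (by simp) (fun i => Fin.cases (by simp) (fun i => by have := hρ i; simp; omega) i) i
  refine ⟨.seq p (.seq q (.seq (.loop (t + 1) (.seq u (.seq (.clear t)
    (.seq (.addTo (t + 3) t) (.seq (.inc (t + 2)) (.dec (t + 1)))))))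
    (.clear (t + 2)))), fun s B hs hB => ?_⟩
  set e : Fin k → ℕ := fun i => s (ρ i) with he
  -- The registers after `n` iterations, with `m` iterations left: the value of `F n` in `t`, then
  -- the two counters.
  let S : ℕ → ℕ → ℕ → ℕ := fun n m => Function.update (Function.update
    (Function.update s t (F n e)) (t + 1) m) (t + 2) n
  have hSe : ∀ n m, (fun i => S n m (ρ i)) = e := fun n m => by
    funext i
    have := hρ i
    simp only [S]
    rw [Function.update_of_ne (by omega), Function.update_of_ne (by omega),
      Function.update_of_ne (by omega)]
  have loop : ∀ m n, n + m = r e → (Prog.loop (t + 1) (.seq u (.seq (.clear t)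
      (.seq (.addTo (t + 3) t) (.seq (.inc (t + 2)) (.dec (t + 1))))))).Exec B
      (S n m) (S (n + m) 0) := by
    intro m
    induction m with
    | zero => intro n hn; exact loop_done (by simp [S])
    | succ m ih =>
      intro n hn
      have hstep := hu (S n (m + 1)) B
        (fun i hi => by
          simp only [S]
          rw [Function.update_of_ne (by omega), Function.update_of_ne (by omega),
            Function.update_of_ne (by omega)]
          exact hs i (by omega))
        (by
          rw [cons_apply, cons_apply, hSe]
          have : S n (m + 1) (t + 2) = n := by simp [S]
          rw [this]
          have : S n (m + 1) t = F n e := by simp [S]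
          rw [this]
          exact (hbh e n (by omega)).trans hB)
      rw [cons_apply, cons_apply, hSe] at hstep
      have h1 : S n (m + 1) (t + 2) = n := by simp [S]
      have h2 : S n (m + 1) t = F n e := by simp [S]
      rw [h1, h2, ← F1] at hstep
      have hFB := (hF e (n + 1) (by omega)).trans hB
      have hrB := (hrb e).trans hB
      refine loop_step (by simp [S]) (seq hstep (seq (clear t _) (seq (addTo (by omega) _ ?_)
        (seq (inc ?_) dec)))) ?_
      · simpa using hFB
      · simpa [S] using (show n + 1 ≤ B by omega)
      · have h := ih (n + 1) (by omega)
        rw [show n + 1 + m = n + (m + 1) by ring] at h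
        refine Eq.mp (congrArg (fun x => Prog.Exec B _ x _) ?_) h
        funext j
        simp only [Function.update_apply, S]
        split_ifs <;> first | rfl | omega | exact hs j (by omega)
  have h2 := hq (Function.update s t (g e)) B
    (fun i hi => by rw [Function.update_of_ne (by omega)]; exact hs i (by omega))
  have hρ' : (fun i => Function.update s t (g e) (ρ i)) = e := by
    funext i; exact Function.update_of_ne (hρ i).ne _ _
  rw [hρ'] at h2
  have h3 := (loop (r e) 0 (by omega)).seq (clear (t + 2) _)
  have h4 : S 0 (r e) = Function.update (Function.update s t (g e)) (t + 1) (r e) := by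
    funext j
    simp only [Function.update_apply, S, F0]
    split_ifs <;> first | rfl | omega | exact (hs j (by omega)).symm
  have h5 : Function.update (S (0 + r e) 0) (t + 2) 0 = Function.update s t (F (r e) e) := by
    funext j
    simp only [Function.update_apply, S, zero_add]
    split_ifs <;> first | rfl | omega | exact (hs j (by omega)).symm
  rw [h4, h5] at h3
  exact seq (hp s B hs ((hbg e).trans hB)) (seq (h2 ((hbr e).trans hB)) h3)

end Comp

/-! ### Polynomially bounded computations -/

/-- A measure of the size of a list of arguments. -/
def argSize {k : ℕ} (e : Fin k → ℕ) : ℕ := ∑ i, e i + 2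

/-- Functions bounded by a power of the size of their arguments. -/
def PolyBdd {k : ℕ} (f : (Fin k → ℕ) → ℕ) : Prop := ∃ c, ∀ e, f e ≤ argSize e ^ c

theorem two_le_argSize {k : ℕ} (e : Fin k → ℕ) : 2 ≤ argSize e := Nat.le_add_left _ _

theorem argSize_cons {k : ℕ} (v : ℕ) (e : Fin k → ℕ) :
    argSize (Fin.cons v e : Fin (k + 1) → ℕ) = v + argSize e := by
  simp [argSize, Fin.sum_univ_succ, add_assoc]

namespace PolyBdd

variable {k : ℕ} {f g : (Fin k → ℕ) → ℕ}

theorem mono (hg : PolyBdd g) (h : ∀ e, f e ≤ g e) : PolyBdd f :=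
  hg.imp fun _ hc e => (h e).trans (hc e)

theorem argSize : PolyBdd (argSize (k := k)) := ⟨1, fun e => by simp⟩

theorem const (n : ℕ) : PolyBdd fun _ : Fin k → ℕ => n :=
  ⟨n, fun e => (Nat.lt_two_pow_self).le.trans (Nat.pow_le_pow_left (two_le_argSize e) n)⟩

theorem mul (hf : PolyBdd f) (hg : PolyBdd g) : PolyBdd fun e => f e * g e := by
  obtain ⟨c, hc⟩ := hf
  obtain ⟨d, hd⟩ := hg
  exact ⟨c + d, fun e => by rw [pow_add]; exact Nat.mul_le_mul (hc e) (hd e)⟩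

theorem pow (hf : PolyBdd f) (n : ℕ) : PolyBdd fun e => f e ^ n := by
  obtain ⟨c, hc⟩ := hf
  exact ⟨c * n, fun e => by rw [pow_mul]; exact Nat.pow_le_pow_left (hc e) n⟩

theorem add (hf : PolyBdd f) (hg : PolyBdd g) : PolyBdd fun e => f e + g e := by
  obtain ⟨c, hc⟩ := hf
  obtain ⟨d, hd⟩ := hg
  refine ⟨c + d + 1, fun e => ?_⟩
  have h1 := two_le_argSize e
  have h2 : _root_.argSize e ^ c ≤ _root_.argSize e ^ (c + d) :=
    Nat.pow_le_pow_right (by omega) (by omega)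
  have h3 : _root_.argSize e ^ d ≤ _root_.argSize e ^ (c + d) :=
    Nat.pow_le_pow_right (by omega) (by omega)
  rw [pow_succ]
  nlinarith [hc e, hd e]

theorem reindex_sum {m : ℕ} (σ : Fin k → Fin m) :
    PolyBdd fun e : Fin m → ℕ => _root_.argSize fun i => e (σ i) := by
  refine ((const k).mul argSize |>.add (const 2)).mono fun e => ?_
  have : ∑ i, e (σ i) ≤ ∑ _i : Fin k, _root_.argSize e := Finset.sum_le_sum fun i _ =>
    (Finset.single_le_sum (f := e) (fun _ _ => Nat.zero_le _) (Finset.mem_univ _)).trans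
      (Nat.le_add_right _ _)
  simpa [_root_.argSize] using this

theorem reindex (hf : PolyBdd f) {m : ℕ} (σ : Fin k → Fin m) :
    PolyBdd fun e : Fin m → ℕ => f fun i => e (σ i) := by
  obtain ⟨c, hc⟩ := hf
  exact ((reindex_sum σ).pow c).mono fun e => hc _

end PolyBdd

/-- Functions that are computed by register programs in which all stored numbers are polynomially
bounded in the arguments, so that the space used is linear in the binary length of the arguments.
-/
def LinSpace {k : ℕ} (f : (Fin k → ℕ) → ℕ) : Prop :=
  ∃ b, PolyBdd b ∧ (∀ e, f e ≤ b e) ∧ Comp f b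

namespace LinSpace

variable {k : ℕ} {f g : (Fin k → ℕ) → ℕ}

theorem polyBdd : LinSpace f → PolyBdd f := fun ⟨_, hb, h, _⟩ => hb.mono h

theorem of_eq (hf : LinSpace f) (h : ∀ e, g e = f e) : LinSpace g :=
  (funext h : g = f) ▸ hf

theorem var (i : Fin k) : LinSpace fun e => e i :=
  ⟨_, PolyBdd.argSize.mono fun e => (Finset.single_le_sum (f := e) (fun _ _ => Nat.zero_le _)
    (Finset.mem_univ i)).trans (Nat.le_add_right _ _), fun _ => le_rfl, Comp.var i⟩

theorem succ : LinSpace f → LinSpace fun e => f e + 1 := fun ⟨b, hb, hf, h⟩ =>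
  ⟨fun e => b e + 1, hb.add (PolyBdd.const 1), fun e => Nat.succ_le_succ (hf e),
    h.succ.mono fun e => by have := hf e; simp; omega⟩

theorem const : ∀ n : ℕ, LinSpace fun _ : Fin k → ℕ => n
  | 0 => ⟨_, PolyBdd.const 0, fun _ => le_rfl, Comp.zero⟩
  | n + 1 => (const n).succ

theorem reindex (hf : LinSpace f) {m : ℕ} (σ : Fin k → Fin m) :
    LinSpace fun e : Fin m → ℕ => f fun i => e (σ i) :=
  let ⟨_, hb, h, hc⟩ := hf
  ⟨_, hb.reindex σ, fun _ => h _, hc.reindex σ⟩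

theorem tail (hf : LinSpace f) : LinSpace fun e : Fin (k + 1) → ℕ => f fun i => e i.succ :=
  hf.reindex Fin.succ

/-- Bounded primitive recursion: the defining recursion of `F` may be used if the values that occur
are polynomially bounded. -/
theorem prec {r : (Fin k → ℕ) → ℕ} {h : ℕ → ℕ → (Fin k → ℕ) → ℕ} (hg : LinSpace g)
    (hr : LinSpace r)
    (hh : LinSpace fun e : Fin (k + 2) → ℕ => h (e 0) (e 1) fun i => e i.succ.succ)
    {F : ℕ → (Fin k → ℕ) → ℕ} (F0 : ∀ e, F 0 e = g e) (F1 : ∀ n e, F (n + 1) e = h n (F n e) e)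
    {β : (Fin k → ℕ) → ℕ} (hβ : PolyBdd β) (hF : ∀ e n, n ≤ r e → F n e ≤ β e) :
    LinSpace fun e => F (r e) e := by
  obtain ⟨bg, pg, g1, g2⟩ := id hg
  obtain ⟨br, pr, r1, r2⟩ := id hr
  obtain ⟨bh, ⟨c, ph⟩, h1, h2⟩ := id hh
  refine ⟨fun e => bg e + br e + β e + (br e + β e + argSize e) ^ c,
    ((pg.add pr).add hβ).add (((pr.add hβ).add .argSize).pow c),
    fun e => (hF e _ le_rfl).trans (by simp only; omega), ?_⟩
  refine Comp.prec g2 r2 h2 F0 (fun n e => ?_) (fun e => by omega) (fun e => by omega)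
    (fun e => (r1 e).trans (by omega)) (fun e n hn => (hF e n hn).trans (by omega))
    fun e n hn => ?_
  · rw [F1]; rfl
  · refine (ph _).trans (le_trans (Nat.pow_le_pow_left ?_ c) (Nat.le_add_left _ _))
    rw [argSize_cons, argSize_cons]
    have := hF e n hn.le
    have := r1 e
    omega

theorem add (hf : LinSpace f) (hg : LinSpace g) : LinSpace fun e => f e + g e :=
  prec (h := fun _ a _ => a + 1) (F := fun n e => f e + n) hf hg (succ (var 1)) (fun _ => rfl)
    (fun _ _ => rfl) (hf.polyBdd.add hg.polyBdd) fun _ _ hn => Nat.add_le_add_left hn _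

theorem mul (hf : LinSpace f) (hg : LinSpace g) : LinSpace fun e => f e * g e :=
  prec (h := fun _ a e => a + f e) (F := fun n e => f e * n) (const 0) hg
    ((var 1).add hf.tail.tail) (fun _ => rfl) (fun _ _ => Nat.mul_succ _ _)
    (hf.polyBdd.mul hg.polyBdd) fun _ _ hn => Nat.mul_le_mul_left _ hn

theorem pred (hf : LinSpace f) : LinSpace fun e => f e - 1 :=
  prec (h := fun n _ _ => n) (F := fun n _ => n - 1) (const 0) hf (var 0) (fun _ => rfl)
    (fun _ _ => rfl) hf.polyBdd fun _ _ hn => (Nat.sub_le _ _).trans hn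

theorem sub (hf : LinSpace f) (hg : LinSpace g) : LinSpace fun e => f e - g e :=
  prec (h := fun _ a _ => a - 1) (F := fun n e => f e - n) hf hg (pred (var 1)) (fun _ => rfl)
    (fun _ _ => rfl) hf.polyBdd fun _ _ _ => Nat.sub_le _ _

theorem half (hf : LinSpace f) : LinSpace fun e => f e / 2 :=
  prec (h := fun n a _ => n - a) (F := fun n _ => n / 2) (const 0) hf (sub (var 0) (var 1))
    (fun _ => rfl) (fun _ _ => by omega) hf.polyBdd fun _ _ hn => (Nat.div_le_self _ _).trans hn

theorem div_two_pow (hf : LinSpace f) (hg : LinSpace g) : LinSpace fun e => f e / 2 ^ g e :=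
  prec (h := fun _ a _ => a / 2) (F := fun n e => f e / 2 ^ n) hf hg (half (var 1))
    (fun _ => by simp) (fun _ _ => by rw [pow_succ, Nat.div_div_eq_div_mul]) hf.polyBdd
    fun _ _ _ => Nat.div_le_self _ _

theorem mod_two_pow (hf : LinSpace f) (n : ℕ) : LinSpace fun e => f e % 2 ^ n := by
  exact (hf.sub ((const (2 ^ n)).mul (hf.div_two_pow (const n)))).of_eq fun e => Nat.mod_def _ _

end LinSpace

/-! ### Predicates decidable in linear space -/

open Classical in
/-- Predicates on numbers that are decidable in linear space. -/
def LinDec {k : ℕ} (P : (Fin k → ℕ) → Prop) : Prop := LinSpace fun e => if P e then 1 else 0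

namespace LinDec

variable {k : ℕ} {P Q : (Fin k → ℕ) → Prop} {f g : (Fin k → ℕ) → ℕ}

theorem of_iff (hP : LinDec P) (h : ∀ e, Q e ↔ P e) : LinDec Q :=
  (funext fun e => propext (h e) : Q = P) ▸ hP

theorem not (hP : LinDec P) : LinDec fun e => ¬ P e := by
  refine ((LinSpace.const 1).sub hP).of_eq fun e => ?_
  by_cases h : P e <;> simp [h]

theorem and (hP : LinDec P) (hQ : LinDec Q) : LinDec fun e => P e ∧ Q e := by
  refine (LinSpace.mul hP hQ).of_eq fun e => ?_
  by_cases h : P e <;> by_cases h' : Q e <;> simp [h, h']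

theorem or (hP : LinDec P) (hQ : LinDec Q) : LinDec fun e => P e ∨ Q e :=
  (hP.not.and hQ.not).not.of_iff fun e => by tauto

theorem imp (hP : LinDec P) (hQ : LinDec Q) : LinDec fun e => P e → Q e :=
  (hP.and hQ.not).not.of_iff fun e => by tauto

theorem iff (hP : LinDec P) (hQ : LinDec Q) : LinDec fun e => (P e ↔ Q e) :=
  ((hP.imp hQ).and (hQ.imp hP)).of_iff fun e => by tauto

theorem le (hf : LinSpace f) (hg : LinSpace g) : LinDec fun e => f e ≤ g e := by
  refine ((LinSpace.const 1).sub (hf.sub hg)).of_eq fun e => ?_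
  by_cases h : f e ≤ g e
  · simp [h]
  · simp only [h, if_false]; omega

theorem lt (hf : LinSpace f) (hg : LinSpace g) : LinDec fun e => f e < g e := le hf.succ hg

theorem eq (hf : LinSpace f) (hg : LinSpace g) : LinDec fun e => f e = g e :=
  ((le hf hg).and (le hg hf)).of_iff fun e => by omega

theorem ex {P : ℕ → (Fin k → ℕ) → Prop} (hg : LinSpace g)
    (hP : LinDec fun e : Fin (k + 1) → ℕ => P (e 0) fun i => e i.succ) :
    LinDec fun e => ∃ v, v < g e ∧ P v e := by
  classical
  refine LinSpace.of_eq (LinSpace.prec (h := fun n a e => if a = 1 ∨ P n e then 1 else 0)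
    (F := fun n e => if ∃ v, v < n ∧ P v e then 1 else 0) (LinSpace.const 0) hg ?_ (by simp)
    (fun n e => ?_) (PolyBdd.const 1) fun e n _ => by split_ifs <;> simp)
    fun e => by congr
  · have h1 : LinDec fun e : Fin (k + 2) → ℕ => e 1 = 1 := eq (.var 1) (.const 1)
    have h2 : LinDec fun e : Fin (k + 2) → ℕ => P (e 0) fun i => e i.succ.succ :=
      LinSpace.reindex hP (Fin.cons 0 fun i => i.succ.succ)
    exact LinSpace.of_eq (h1.or h2) fun e => by congr
  · congr 1
    simp only [Nat.lt_succ_iff_lt_or_eq, eq_iff_iff]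
    constructor
    · rintro ⟨v, hv | rfl, h⟩
      · left; rw [if_pos ⟨v, hv, h⟩]
      · exact .inr h
    · rintro (h | h)
      · by_contra! hc
        rw [if_neg] at h
        · simp at h
        · rintro ⟨v, hv, hP⟩; exact hc v (.inl hv) hP
      · exact ⟨n, .inr rfl, h⟩

theorem all {P : ℕ → (Fin k → ℕ) → Prop} (hg : LinSpace g)
    (hP : LinDec fun e : Fin (k + 1) → ℕ => P (e 0) fun i => e i.succ) :
    LinDec fun e => ∀ v, v < g e → P v e :=
  (ex (P := fun v e => ¬ P v e) hg hP.not).not.of_iff fun e => by push Not; rfl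

theorem testBit (hf : LinSpace f) (hg : LinSpace g) :
    LinDec fun e => (f e).testBit (g e) = true :=
  (eq ((hf.div_two_pow hg).mod_two_pow 1) (.const 1)).of_iff fun e => by
    rw [Nat.testBit_eq_decide_div_mod_eq, decide_eq_true_iff, pow_one]

end LinDec

/-! ### Linear space in a doubly exponential parameter -/

namespace LinSpace

variable {k : ℕ} {f : (Fin k → ℕ) → ℕ}

/-- Powers of two are computed with numbers polynomial in the arguments and the result. They are not
polynomially bounded in the arguments, hence not in `LinSpace`. -/
theorem exists_comp_two_pow (hf : LinSpace f) : ∃ β : (Fin (k + 1) → ℕ) → ℕ, PolyBdd β ∧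
    Comp (fun e => 2 ^ f e) fun e => β (Fin.cons (2 ^ f e) e) := by
  obtain ⟨b, pb, hfb, hc⟩ := id hf
  have hd : LinSpace fun e : Fin (k + 2) → ℕ => e 1 + e 1 := (var 1).add (var 1)
  obtain ⟨bh, ⟨c, ph⟩, -, hh⟩ := hd
  obtain ⟨b1, pb1, hb1, hc1⟩ := const (k := k) 1
  have tl : ∀ {g : (Fin k → ℕ) → ℕ}, PolyBdd g →
      PolyBdd fun u : Fin (k + 1) → ℕ => g fun i => u i.succ := fun h => h.reindex Fin.succ
  refine ⟨fun u => b1 (fun i => u i.succ) + b (fun i => u i.succ) +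
    (u 0 + f (fun i => u i.succ) + argSize fun i => u i.succ) ^ c + u 0,
    (((tl pb1).add (tl pb)).add
      ((((var 0).polyBdd.add (tl hf.polyBdd)).add (tl .argSize)).pow c)).add (var 0).polyBdd, ?_⟩
  refine Comp.prec (F := fun n _ => 2 ^ n) hc1 hc hh (fun _ => rfl)
    (fun n e => by simp [pow_succ, mul_two]) (fun e => ?_) (fun e => ?_) (fun e => ?_)
    (fun e n hn => ?_) fun e n hn => ?_
  · change b1 e ≤ b1 e + b e + (2 ^ f e + f e + argSize e) ^ c + 2 ^ f e
    generalize 2 ^ f e = Y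
    omega
  · change b e ≤ b1 e + b e + (2 ^ f e + f e + argSize e) ^ c + 2 ^ f e
    generalize 2 ^ f e = Y
    omega
  · have := hfb e
    change f e ≤ b1 e + b e + (2 ^ f e + f e + argSize e) ^ c + 2 ^ f e
    generalize 2 ^ f e = Y
    omega
  · have := Nat.pow_le_pow_right (n := 2) (by omega) hn
    simp only [Fin.cons_zero]; omega
  · refine (ph _).trans ((Nat.pow_le_pow_left (m := 2 ^ f e + f e + argSize e) ?_ c).trans ?_)
    · rw [argSize_cons, argSize_cons]
      have := Nat.pow_le_pow_right (n := 2) (by omega) hn.le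
      omega
    · change _ ≤ b1 e + b e + (2 ^ f e + f e + argSize e) ^ c + 2 ^ f e
      generalize 2 ^ f e = Y
      omega

end LinSpace

/-- The bound for quantifiers over sets of numbers below the number `W` of the word. -/
def expBound (W : ℕ) : ℕ := 2 ^ (W + 1)

/-- The bound for quantifiers over sets of pairs of numbers below `expBound W`. -/
def dexpBound (W : ℕ) : ℕ := 2 ^ (expBound W * expBound W)

theorem lt_expBound (W : ℕ) : W < expBound W :=
  (Nat.lt_two_pow_self).trans (Nat.pow_lt_pow_right (by omega) (by omega))

theorem expBound_lt_dexpBound (W : ℕ) : expBound W < dexpBound W :=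
  lt_of_le_of_lt (Nat.le_mul_self _) Nat.lt_two_pow_self

open Classical in
/-- The three parameters `dexpBound W`, `expBound W` and `W` are computed from `W`, and then the
numbers that occur in deciding `P` are polynomial in the largest parameter. -/
theorem LinDec.exists_prog {P : ℕ → ℕ → ℕ → Prop}
    (hP : LinDec fun e : Fin 3 → ℕ => P (e 0) (e 1) (e 2)) :
    ∃ (p : Prog) (c : ℕ), ∀ W, p.Exec (2 ^ (c * (expBound W * expBound W))) (Function.update 0 0 W)
      (Function.update 0 1 (if P (dexpBound W) (expBound W) W then 1 else 0)) := by
  obtain ⟨b, ⟨c, pb⟩, -, hc⟩ := hP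
  obtain ⟨β₁, ⟨c₁, p₁⟩, h₁⟩ := ((LinSpace.var (k := 1) 0).succ).exists_comp_two_pow
  obtain ⟨β₂, ⟨c₂, p₂⟩, h₂⟩ :=
    ((LinSpace.var (k := 2) 0).mul (.var 0)).exists_comp_two_pow
  obtain ⟨p, hp⟩ := ((hc.bind h₂).bind h₁) (fun _ => 0) 1 (by simp)
  refine ⟨.seq p (.clear 0), 2 * (c + c₁ + c₂ + 1), fun W => ?_⟩
  have h : p.Exec (2 ^ (2 * (c + c₁ + c₂ + 1) * (expBound W * expBound W)))
      (Function.update 0 0 W) (Function.update (Function.update 0 0 W) 1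
        (if P (dexpBound W) (expBound W) W then 1 else 0)) := hp _ _
          (fun i hi => by rw [Function.update_of_ne (by omega)]; rfl) ?_
  · refine .seq h ?_
    convert Prog.Exec.clear 0 _ using 1
    funext j
    simp only [Function.update_apply]
    split_ifs <;> first | omega | rfl
  · simp only [Function.update_self, Fin.cons_zero]
    have e2 : ∀ M K : ℕ, (Fin.cons M (Fin.cons K fun _ : Fin 1 => W) : Fin 3 → ℕ) 2 = W :=
      fun _ _ => rfl
    have hK := lt_expBound W
    have hM := expBound_lt_dexpBound W
    have hK0 : 2 ≤ expBound W := Nat.le_self_pow (by omega) 2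
    have hpow : 2 ^ (2 * (c + c₁ + c₂ + 1) * (expBound W * expBound W)) =
        (dexpBound W ^ 2) ^ (c + c₁ + c₂) * dexpBound W ^ 2 := by
      rw [← pow_succ, dexpBound, ← pow_mul, ← pow_mul]
      congr 1; ring
    rw [← expBound, ← dexpBound, hpow]
    set K := expBound W
    set M := dexpBound W
    -- Each of the five summands of the bound is at most `(M ^ 2) ^ (c + c₁ + c₂)`.
    have hM4 : 4 ≤ M := by
      have : 2 ^ (2 * 2) ≤ M := Nat.pow_le_pow_right (by omega) (Nat.mul_le_mul hK0 hK0)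
      omega
    have hS : ∀ d, d ≤ c + c₁ + c₂ → (M + K + W + 2) ^ d ≤ (M ^ 2) ^ (c + c₁ + c₂) := fun d hd =>
      (Nat.pow_le_pow_left (by nlinarith) d).trans (Nat.pow_le_pow_right (by nlinarith) hd)
    have sz : argSize (fun _ : Fin 1 => W) = W + 2 := by simp [argSize]
    have q₁ : β₁ (Fin.cons K fun _ => W) ≤ (M ^ 2) ^ (c + c₁ + c₂) := by
      refine (p₁ _).trans (le_trans (Nat.pow_le_pow_left ?_ _) (hS c₁ (by omega)))
      rw [argSize_cons, sz]; omega
    have q₂ : β₂ (Fin.cons M (Fin.cons K fun _ => W)) ≤ (M ^ 2) ^ (c + c₁ + c₂) := by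
      refine (p₂ _).trans (le_trans (Nat.pow_le_pow_left ?_ _) (hS c₂ (by omega)))
      rw [argSize_cons, argSize_cons, sz]; omega
    have q₃ : b (Fin.cons M (Fin.cons K fun _ => W)) ≤ (M ^ 2) ^ (c + c₁ + c₂) := by
      refine (pb _).trans (le_trans (Nat.pow_le_pow_left ?_ _) (hS c (by omega)))
      rw [argSize_cons, argSize_cons, sz]; omega
    have h1 : ∀ Q : Prop, (if Q then 1 else 0) ≤ 1 := fun Q => by split_ifs <;> simp
    have h2 := h1 (P M K W)
    have h3 : 1 ≤ (M ^ 2) ^ (c + c₁ + c₂) := Nat.one_le_pow _ _ (by positivity)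
    have h4 : 5 * (M ^ 2) ^ (c + c₁ + c₂) ≤ (M ^ 2) ^ (c + c₁ + c₂) * M ^ 2 := by
      rw [mul_comm]; exact Nat.mul_le_mul_left _ (by nlinarith)
    refine le_trans ?_ h4
    exact le_trans
      (Nat.add_le_add (Nat.add_le_add q₁ (Nat.add_le_add (Nat.add_le_add q₂ q₃) h2)) h2)
      (by omega)

theorem wordNum_lt {A : Type} {code : A → ℕ} (hcode : ∀ a, 16 ≤ code a ∧ code a < 32)
    (w : List A) : wordNum code w < 32 ^ w.length := by
  have key : ∀ (w : List A) (V m : ℕ), V < 32 ^ m →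
      w.foldl (fun W a => 32 * W + code a) V < 32 ^ (m + w.length) := by
    intro w
    induction w with
    | nil => intro V m h; simpa using h
    | cons a w ih =>
      intro V m h
      have := ih (32 * V + code a) (m + 1) (by have := (hcode a).2; rw [pow_succ]; omega)
      rwa [List.foldl_cons, List.length_cons, ← add_assoc, add_right_comm]
  simpa [wordNum] using key w 0 0 (by simp)

/-- If membership of a word in a language can be decided in space linear in the doubly exponential
parameter `dexpBound W`, where `W` is the number of the word, then the language is in 2-EXPSPACE. -/
theorem inTwoEXPSPACE_of_linDec {A : Type} [Finite A] {L : Language A} {code : A → ℕ}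
    (hcode : ∀ a, 16 ≤ code a ∧ code a < 32) {P : ℕ → ℕ → ℕ → Prop}
    (hP : LinDec fun e : Fin 3 → ℕ => P (e 0) (e 1) (e 2))
    (hL : ∀ w, w ∈ L ↔
      P (dexpBound (wordNum code w)) (expBound (wordNum code w)) (wordNum code w)) :
    InTwoEXPSPACE L := by
  classical
  obtain ⟨p, c, hp⟩ := hP.exists_prog
  set E := (p.width + 5) * (c + 5) with hE
  refine ⟨.C 5 * .X + .C (E + 1), nonempty_spaceDecider hcode p
    (fun W => 2 ^ ((c + 1) * (expBound W * expBound W))) _ (fun w => decide (w ∈ L)) (by simp)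
    (fun w => ?_) (fun W => ?_) fun w => ?_⟩
  · have := (hp (wordNum code w)).mono (Nat.pow_le_pow_right (n := 2) (by omega)
      (Nat.mul_le_mul_right (expBound (wordNum code w) * expBound (wordNum code w))
        (Nat.le_succ c)))
    convert this using 2
    by_cases h : w ∈ L
    · simp [h, (hL w).1 h]
    · simp [h, mt (hL w).2 h]
  · refine (lt_expBound W).le.trans ((expBound_lt_dexpBound W).le.trans ?_)
    exact Nat.pow_le_pow_right (by omega) (Nat.le_mul_of_pos_left _ (by omega))
  · have hW := wordNum_lt hcode w
    set W := wordNum code w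
    set n := w.length
    have hK : expBound W * expBound W ≤ 2 ^ 2 ^ (5 * n + 1) := by
      rw [expBound, ← pow_add]
      refine Nat.pow_le_pow_right (by omega) ?_
      rw [pow_succ, pow_mul]
      norm_num
      omega
    have hn : n ≤ 2 ^ 2 ^ (5 * n + 1) :=
      (Nat.lt_two_pow_self.le.trans (Nat.pow_le_pow_right (by omega) (by omega))).trans
        Nat.lt_two_pow_self.le
    have h1 : 1 ≤ 2 ^ 2 ^ (5 * n + 1) := Nat.one_le_two_pow
    simp only [Nat.size_pow, Polynomial.eval_add, Polynomial.eval_mul, Polynomial.eval_C,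
      Polynomial.eval_X]
    set X := 2 ^ 2 ^ (5 * n + 1) with hX
    have h2 : (c + 1) * (expBound W * expBound W) ≤ (c + 1) * X := Nat.mul_le_mul_left _ hK
    have h3 : max n ((c + 1) * (expBound W * expBound W) + 1) + 1 ≤ (c + 5) * X := by
      have : (c + 5) * X = (c + 1) * X + 4 * X := by ring
      omega
    calc _ ≤ (p.width + 5) * ((c + 5) * X) := Nat.mul_le_mul_left _ h3
      _ = E * X := by rw [hE]; ring
      _ ≤ 2 ^ 2 ^ E * X := Nat.mul_le_mul_right _
          (Nat.lt_two_pow_self.le.trans Nat.lt_two_pow_self.le)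
      _ = 2 ^ (2 ^ E + 2 ^ (5 * n + 1)) := by rw [hX, ← pow_add]
      _ ≤ 2 ^ 2 ^ (5 * n + (E + 1)) := by
          refine Nat.pow_le_pow_right (by omega) ?_
          have a : 2 ^ E ≤ 2 ^ (5 * n + E) := Nat.pow_le_pow_right (by omega) (by omega)
          have b : 2 ^ (5 * n + 1) ≤ 2 ^ (5 * n + E) :=
            Nat.pow_le_pow_right (by omega) (by have : 0 < E := by positivity
                                                omega)
          rw [← add_assoc, pow_succ]
          omega

/-! ### Games of a single player with partial information -/

section Belief

variable {A C O : Type}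

/-- The states that are possible after observation `o`, when the player has made the choice `c` and
the state was in `S` before. -/
def beliefSucc (step : A → C → O → A → Prop) (c : C) (S : Set A) (o : O) : Set A :=
  {a' | ∃ a ∈ S, step a c o a'}

/-- The player, whose last choice was `c` and who knows that the state is in `S`, can force the
opponent to run out of moves within `n` rounds. The opponent wins in the states given by `bad`,
and otherwise moves along `step`, of which the player learns the observation before making the next
choice. -/
def BeliefWin (bad : A → C → Prop) (step : A → C → O → A → Prop) : ℕ → C → Set A → Prop
  | 0, _, _ => False
  | n + 1, c, S => (∀ a ∈ S, ¬ bad a c) ∧ ∀ o, (beliefSucc step c S o).Nonempty →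
      ∃ c', BeliefWin bad step n c' (beliefSucc step c S o)

variable {bad : A → C → Prop} {step : A → C → O → A → Prop}

theorem BeliefWin.mono {m n : ℕ} (hmn : m ≤ n) {c : C} {S : Set A}
    (h : BeliefWin bad step m c S) : BeliefWin bad step n c S := by
  induction m generalizing n c S with
  | zero => exact h.elim
  | succ m ih =>
    obtain ⟨n, rfl⟩ : ∃ k, n = k + 1 := ⟨n - 1, by omega⟩
    exact ⟨h.1, fun o ho => (h.2 o ho).imp fun c' hc => ih (by omega) hc⟩

theorem BeliefWin.anti {n : ℕ} {c : C} {S T : Set A} (hST : S ⊆ T)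
    (h : BeliefWin bad step n c T) : BeliefWin bad step n c S := by
  induction n generalizing c S T with
  | zero => exact h
  | succ n ih =>
    have hs : ∀ o, beliefSucc step c S o ⊆ beliefSucc step c T o :=
      fun o a ⟨b, hb, hs⟩ => ⟨b, hST hb, hs⟩
    exact ⟨fun a ha => h.1 a (hST ha), fun o ho =>
      (h.2 o (ho.mono (hs o))).imp fun c' hc => ih (hs o) hc⟩

/-- The winning positions are closed under the rule that defines them. -/
theorem exists_beliefWin [Finite O] {c : C} {S : Set A} (h : ∀ a ∈ S, ¬ bad a c)
    (h' : ∀ o, (beliefSucc step c S o).Nonempty →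
      ∃ c' n, BeliefWin bad step n c' (beliefSucc step c S o)) :
    ∃ n, BeliefWin bad step n c S := by
  have hn : ∀ o, ∃ n, (beliefSucc step c S o).Nonempty →
      ∃ c', BeliefWin bad step n c' (beliefSucc step c S o) := fun o => by
    by_cases ho : (beliefSucc step c S o).Nonempty
    · obtain ⟨c', n, hn⟩ := h' o ho
      exact ⟨n, fun _ => ⟨c', hn⟩⟩
    · exact ⟨0, fun h => (ho h).elim⟩
  choose n hn using hn
  have := Fintype.ofFinite O
  refine ⟨Finset.univ.sup n + 1, h, fun o ho => ?_⟩
  obtain ⟨c', hc⟩ := hn o ho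
  exact ⟨c', hc.mono (Finset.le_sup (f := n) (Finset.mem_univ o))⟩

/-- Winning is not affected by giving several names to the same state or choice. -/
theorem beliefWin_comp_iff {A' C' : Type} {f : A' → A} {g : C' → C} (hf : f.Surjective)
    (hg : g.Surjective) (n : ℕ) (c : C') (S : Set A') :
    BeliefWin (fun a c => bad (f a) (g c)) (fun a c o a' => step (f a) (g c) o (f a')) n c S ↔
      BeliefWin bad step n (g c) (f '' S) := by
  induction n generalizing c S with
  | zero => exact Iff.rfl
  | succ n ih =>
    have hs : ∀ o, f '' beliefSucc (fun a c o a' => step (f a) (g c) o (f a')) c S o =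
        beliefSucc step (g c) (f '' S) o := fun o => by
      ext a'
      obtain ⟨a', rfl⟩ := hf a'
      constructor
      · rintro ⟨b, ⟨a, ha, h⟩, hb⟩
        exact ⟨f a, ⟨a, ha, rfl⟩, hb ▸ h⟩
      · rintro ⟨_, ⟨a, ha, rfl⟩, h⟩
        exact ⟨a', ⟨a, ha, h⟩, rfl⟩
    refine and_congr (by simp) (forall_congr' fun o => imp_congr ?_ ?_)
    · rw [← hs, Set.image_nonempty]
    · constructor
      · rintro ⟨c', h⟩
        exact ⟨g c', by rw [← hs]; exact (ih c' _).1 h⟩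
      · rintro ⟨c', h⟩
        obtain ⟨c', rfl⟩ := hg c'
        exact ⟨c', (ih c' _).2 (by rw [hs]; exact h)⟩

end Belief

/-! ### One-bit exchanges give both players the same information -/

namespace TeamFormulaGame

/-- Black wins at once from this position, for some setting of `X`. -/
def Bad (I : TeamFormulaGame) (x' : Fin I.nX' → Bool) (y : ∀ i, Fin (I.nY i) → Bool) : Prop :=
  ∃ x, I.evalF ⟨x', y, fun _ => []⟩ x = true ∧ I.G.eval x = true

/-- Black can continue the play by changing `X'` to `x''`, with the White players seeing `o`. -/
def Step (I : TeamFormulaGame) (x' : Fin I.nX' → Bool) (y : ∀ i, Fin (I.nY i) → Bool)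
    (o : Fin 2 → Bool) (x'' : Fin I.nX' → Bool) : Prop :=
  ∃ x, I.evalF ⟨x', y, fun _ => []⟩ x = true ∧ I.F'.eval (Sum.elim x x'') = true ∧
    ∀ i, x (I.h i) = o i

variable {I : TeamFormulaGame} {P : CommPolicy}

section Run

variable (s : ∀ i, I.Strategy P i) {x z : ℕ → Fin I.nX → Bool} {x' z' : ℕ → Fin I.nX' → Bool}

theorem positionAt_congr {k : ℕ} (h : ∀ j < k, x j = z j) (h' : ∀ j < k, x' j = z' j) :
    positionAt s x x' k = positionAt s z z' k := by
  induction k with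
  | zero => rfl
  | succ k ih =>
    rw [positionAt, positionAt, ih (fun j hj => h j (by omega)) (fun j hj => h' j (by omega)),
      h k (by omega), h' k (by omega)]

/-- The White players' knowledge and moves depend on the observed variables only. -/
theorem view_positionAt_congr {k : ℕ} (h : ∀ j < k, ∀ i, x j (I.h i) = z j (I.h i)) :
    (positionAt s x x' k).y = (positionAt s z z' k).y ∧
      (positionAt s x x' k).view = (positionAt s z z' k).view := by
  induction k with
  | zero => exact ⟨rfl, rfl⟩
  | succ k ih =>
    obtain ⟨-, hv⟩ := ih fun j hj => h j (by omega)
    simp only [positionAt, playRound, hv, h k (by omega), and_self]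

/-- White wins in round `n`. -/
def WinsAt (x : ℕ → Fin I.nX → Bool) (x' : ℕ → Fin I.nX' → Bool) (n : ℕ) : Prop :=
  (∀ k < n, I.RoundContinues (positionAt s x x' k) (x k) (x' k)) ∧
    I.WhiteWinsRound (positionAt s x x' n) (x n) (x' n)

theorem winsAt_congr {n : ℕ} (h : ∀ j ≤ n, x j = z j) (h' : ∀ j ≤ n, x' j = z' j) :
    WinsAt s x x' n ↔ WinsAt s z z' n := by
  have hp : ∀ k ≤ n, positionAt s x x' k = positionAt s z z' k := fun k hk =>
    positionAt_congr s (fun j hj => h j (by omega)) (fun j hj => h' j (by omega))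
  refine and_congr (forall₂_congr fun k hk => ?_) ?_
  · rw [hp k hk.le, h k hk.le, h' k hk.le]
  · rw [hp n le_rfl, h n le_rfl, h' n le_rfl]

/-- As Black has finitely many moves in each round, a forced win takes a bounded number of rounds.
-/
theorem exists_bound_winsAt (hs : ∀ x x', ∃ n, WinsAt s x x' n) :
    ∃ N, ∀ x x', ∃ n ≤ N, WinsAt s x x' n := by
  -- Black's sequences of moves form a compact space, covered by the open sets of those sequences
  -- against which White wins in round `n`.
  let T := (Fin I.nX → Bool) × (Fin I.nX' → Bool)
  let U : ℕ → Set (ℕ → T) := fun n => {t | WinsAt s (fun k => (t k).1) (fun k => (t k).2) n}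
  have hU : ∀ n, IsOpen (U n) := fun n => by
    let ext : (Fin (n + 1) → T) → ℕ → T := fun r k =>
      if h : k < n + 1 then r ⟨k, h⟩ else (fun _ => false, fun _ => false)
    have : U n = (fun (t : ℕ → T) (i : Fin (n + 1)) => t i) ⁻¹' {r | ext r ∈ U n} := by
      ext t
      have he : ∀ k ≤ n, ext (fun i => t i) k = t k := fun k hk => by
        simp only [ext]
        rw [dif_pos (Nat.lt_succ_of_le hk)]
      exact winsAt_congr s (fun k hk => by rw [he k hk]) (fun k hk => by rw [he k hk])
    rw [this]
    exact (isOpen_discrete _).preimage (continuous_pi fun i => continuous_apply _)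
  obtain ⟨F, hF⟩ := isCompact_univ.elim_finite_subcover U hU fun t _ =>
    Set.mem_iUnion.2 (hs _ _)
  refine ⟨F.sup id, fun x x' => ?_⟩
  obtain ⟨n, hn, h⟩ := Set.mem_iUnion₂.1 (hF (Set.mem_univ fun k => (x k, x' k)))
  exact ⟨n, Finset.le_sup (f := id) hn, h⟩

/-- The values of `X'` before round `k` that are possible for the White players. -/
def possible (z : ℕ → Fin I.nX → Bool) (k : ℕ) : Set (Fin I.nX' → Bool) :=
  {a | ∃ x x', (∀ j < k, ∀ i, x j (I.h i) = z j (I.h i)) ∧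
    (∀ j < k, I.RoundContinues (positionAt s x x' j) (x j) (x' j)) ∧ (positionAt s x x' k).x' = a}

/-- If the strategies `s` win within `N` rounds, then even a player who knows the observed values of
both White players wins from each position of the play, by making the same moves. -/
theorem beliefWin_possible {N : ℕ} (hN : ∀ x x', ∃ n ≤ N, WinsAt s x x' n) (j k : ℕ)
    (hk : k + j = N + 1) (z : ℕ → Fin I.nX → Bool) (z' : ℕ → Fin I.nX' → Bool)
    (hz : ∀ j < k, I.RoundContinues (positionAt s z z' j) (z j) (z' j)) :
    BeliefWin I.Bad I.Step j (positionAt s z z' k).y (possible s z k) := by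
  induction j generalizing k z z' with
  | zero =>
    obtain ⟨n, hn, -, h⟩ := hN z z'
    have := hz n (by omega)
    rcases h with h | h
    · simp [this.1] at h
    · simp [this.2.2] at h
  | succ j ih =>
    have safe : ∀ x x', (∀ j < k, ∀ i, x j (I.h i) = z j (I.h i)) →
        (∀ j < k, I.RoundContinues (positionAt s x x' j) (x j) (x' j)) →
        I.evalF (positionAt s x x' k) (x k) = true → I.G.eval (x k) = false := by
      intro x x' _ h2 h3
      obtain ⟨n, -, h4, h5⟩ := hN x x'
      rcases lt_trichotomy n k with hnk | rfl | hnk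
      · have := h2 n hnk
        rcases h5 with h | h
        · simp [this.1] at h
        · simp [this.2.2] at h
      · rcases h5 with h | h
        · simp [h3] at h
        · exact h.2.1
      · exact (h4 k hnk).2.1
    have extend : ∀ a ∈ possible s z k, ∀ x₁ a',
        I.evalF ⟨a, (positionAt s z z' k).y, fun _ => []⟩ x₁ = true → ∃ x x',
          (∀ j < k, ∀ i, x j (I.h i) = z j (I.h i)) ∧
          (∀ j < k, I.RoundContinues (positionAt s x x' j) (x j) (x' j)) ∧
          x k = x₁ ∧ x' k = a' ∧ I.evalF (positionAt s x x' k) (x k) = true := by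
      rintro a ⟨x, x', h1, h2, rfl⟩ x₁ a' hF
      -- Only the moves of round `k` are changed, so the position before that round is the same.
      have e1 : ∀ i, i ≠ k → Function.update x k x₁ i = x i :=
        fun i hi => Function.update_of_ne hi _ _
      have e2 : ∀ i, i ≠ k → Function.update x' k a' i = x' i :=
        fun i hi => Function.update_of_ne hi _ _
      have e3 : ∀ i ≤ k, positionAt s (Function.update x k x₁) (Function.update x' k a') i =
          positionAt s x x' i := fun i hi =>
        positionAt_congr s (fun j hj => e1 j (by omega)) (fun j hj => e2 j (by omega))
      refine ⟨Function.update x k x₁, Function.update x' k a', fun j hj i => ?_, fun j hj => ?_,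
        Function.update_self .., Function.update_self .., ?_⟩
      · rw [e1 j hj.ne, h1 j hj]
      · rw [e1 j hj.ne, e2 j hj.ne, e3 j hj.le]; exact h2 j hj
      · rw [e3 k le_rfl, Function.update_self]
        have := (view_positionAt_congr s (x' := x') (z' := z') h1).1
        rw [← this] at hF
        exact hF
    refine ⟨?_, ?_⟩
    · rintro a ha ⟨x₁, hF, hG⟩
      obtain ⟨x, x', h1, h2, rfl, -, h3⟩ := extend a ha x₁ a hF
      simp [safe x x' h1 h2 h3] at hG
    · have step : ∀ o a', (a' ∈ beliefSucc I.Step (positionAt s z z' k).y (possible s z k) o) →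
          ∃ x x', (∀ j < k, ∀ i, x j (I.h i) = z j (I.h i)) ∧
          (∀ j < k + 1, I.RoundContinues (positionAt s x x' j) (x j) (x' j)) ∧
          (∀ i, x k (I.h i) = o i) ∧ x' k = a' := by
        rintro o a' ⟨a, ha, x₁, hF, hF', ho⟩
        obtain ⟨x, x', h1, h2, rfl, rfl, h3⟩ := extend a ha x₁ a' hF
        refine ⟨x, x', h1, fun j hj => ?_, ho, rfl⟩
        rcases Nat.lt_succ_iff_lt_or_eq.1 hj with hj | rfl
        · exact h2 j hj
        · exact ⟨h3, safe x x' h1 h2 h3, hF'⟩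
      rintro o ⟨a', ha'⟩
      obtain ⟨x, x', h1, h2, h3, -⟩ := step o a' ha'
      refine ⟨_, (ih (k + 1) (by omega) x x' h2).anti fun b hb => ?_⟩
      obtain ⟨w, w', g1, g2, g3, rfl⟩ := step o b hb
      refine ⟨w, w', fun j hj i => ?_, g2, rfl⟩
      rcases Nat.lt_succ_iff_lt_or_eq.1 hj with hj | rfl
      · rw [g1 j hj, h1 j hj]
      · rw [g3, h3]

end Run

/-- The sequence of values of `h 0` and `h 1`, latest first, as known to player `i` after each
exchange of bits. -/
def decodeView (i : Fin 2) : List Observation → List (Fin 2 → Bool)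
  | .received [b] :: .sawH a :: l => (fun j => if j = i then a else b) :: decodeView i l
  | .received [] :: l => decodeView i l
  | _ => []

open Classical in
/-- The number of remaining rounds, the joint move, and the belief after the given observations,
in a winning play of `n` rounds. -/
noncomputable def plan (I : TeamFormulaGame) (n : ℕ) :
    List (Fin 2 → Bool) → ℕ × (∀ i, Fin (I.nY i) → Bool) × Set (Fin I.nX' → Bool)
  | [] => (n, I.initY, {I.initX'})
  | o :: l =>
    let p := plan I n l
    let S := beliefSucc I.Step p.2.1 p.2.2 o
    (p.1 - 1, if h : ∃ c, BeliefWin I.Bad I.Step (p.1 - 1) c S then h.choose else p.2.1, S)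

/-- Player `i` tells the value of `h i` to the teammate mid-round and follows the joint plan, which
depends only on what both players then know. -/
noncomputable def sharing (I : TeamFormulaGame) (P : CommPolicy) (n : ℕ) (i : Fin 2) :
    I.Strategy P i where
  midMessage _ l _ := match l with
    | .sawH b :: _ => b
    | _ => false
  move _ l := (I.plan n (decodeView i l)).2.1 i
  endMessage _ _ _ := false

/-- The observed values before round `k`, latest first. -/
def history (I : TeamFormulaGame) (x : ℕ → Fin I.nX → Bool) : ℕ → List (Fin 2 → Bool)
  | 0 => []
  | k + 1 => (fun i => x k (I.h i)) :: history I x k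

/-- When the observed values are shared, both players know all of them, and play the joint plan. -/
theorem positionAt_sharing (hP : ∀ p, P.midRound p = (1, 1) ∧ P.endRound p = (0, 0)) (n : ℕ)
    (x : ℕ → Fin I.nX → Bool) (x' : ℕ → Fin I.nX' → Bool) (k : ℕ) :
    (positionAt (I.sharing P n) x x' k).y = (I.plan n (I.history x k)).2.1 ∧
      ∀ i, decodeView i ((positionAt (I.sharing P n) x x' k).view i) = I.history x k := by
  have hm : ∀ k i, P.midBits k i = 1 := fun k i => by simp [CommPolicy.midBits, hP]
  have he : ∀ k i, P.endBits k i = 0 := fun k i => by simp [CommPolicy.endBits, hP]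
  induction k with
  | zero => exact ⟨rfl, fun _ => rfl⟩
  | succ k ih =>
    have hd : ∀ i, (fun j => if j = i then x k (I.h i) else x k (I.h (1 - i))) =
        fun i => x k (I.h i) := fun i => by
      funext j
      split_ifs with h
      · rw [h]
      · congr 2
        fin_cases i <;> fin_cases j <;> simp_all
    simp only [positionAt, playRound, sharing, List.ofFn_const, hm, he, List.replicate_one,
      List.replicate_zero, decodeView, history, hd, ih.2, implies_true, and_true]

/-- With one-bit exchanges in the middle of the rounds, the White players are as strong as a single
player who sees both `h 0` and `h 1`. -/
theorem whiteHasForcedWin_iff (hP : ∀ p, P.midRound p = (1, 1) ∧ P.endRound p = (0, 0)) :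
    I.WhiteHasForcedWin P ↔ ∃ n, BeliefWin I.Bad I.Step n I.initY {I.initX'} := by
  constructor
  · rintro ⟨s, hs⟩
    obtain ⟨N, hN⟩ := exists_bound_winsAt s hs
    refine ⟨N + 1, (beliefWin_possible s hN (N + 1) 0 (by omega) (fun _ _ => false)
      (fun _ _ => false) (by simp)).anti ?_⟩
    rintro a rfl
    exact ⟨fun _ _ => false, fun _ _ => false, by simp, by simp, rfl⟩
  · rintro ⟨n, hn⟩
    refine ⟨I.sharing P n, fun x x' => ?_⟩
    have key : ∀ m k, (I.plan n (I.history x k)).1 = m →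
        BeliefWin I.Bad I.Step m (I.plan n (I.history x k)).2.1 (I.plan n (I.history x k)).2.2 →
        (positionAt (I.sharing P n) x x' k).x' ∈ (I.plan n (I.history x k)).2.2 →
        (∀ j < k, I.RoundContinues (positionAt (I.sharing P n) x x' j) (x j) (x' j)) →
        ∃ r, WinsAt (I.sharing P n) x x' r := by
      intro m
      induction m with
      | zero => intro k _ h; exact h.elim
      | succ m ih =>
        intro k hm hw hmem hc
        have hy := (positionAt_sharing hP n x x' k).1
        rw [← hy] at hw
        by_cases hF : I.evalF (positionAt (I.sharing P n) x x' k) (x k) = true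
        · have hG : I.G.eval (x k) = false := by
            have := hw.1 _ hmem
            by_contra hG
            exact this ⟨x k, hF, by simpa using hG⟩
          by_cases hF' : I.F'.eval (Sum.elim (x k) (x' k)) = true
          · have hsucc : x' k ∈ beliefSucc I.Step (I.plan n (I.history x k)).2.1
                (I.plan n (I.history x k)).2.2 fun i => x k (I.h i) :=
              ⟨_, hmem, x k, by rw [← hy]; exact hF, hF', fun _ => rfl⟩
            have hex := hw.2 (fun i => x k (I.h i)) ⟨_, by rw [hy]; exact hsucc⟩
            rw [hy] at hex
            refine ih (k + 1) (by simp [history, plan, hm]) ?_ hsucc fun j hj => ?_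
            · rw [show m = (I.plan n (I.history x k)).1 - 1 by omega] at hex ⊢
              simp only [history, plan]
              rw [dif_pos hex]
              exact hex.choose_spec
            · rcases Nat.lt_succ_iff_lt_or_eq.1 hj with hj | rfl
              · exact hc j hj
              · exact ⟨hF, hG, hF'⟩
          · exact ⟨k, hc, .inr ⟨hF, hG, by simpa using hF'⟩⟩
        · exact ⟨k, hc, .inl (by simpa using hF)⟩
    exact key n 0 rfl hn rfl (by simp)

end TeamFormulaGame

/-! ### The game as a predicate on numbers -/

/-- The letter number `i`, counted from the end, of the word with base `32` number `w`. -/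
def digit (w i : ℕ) : ℕ := w / 2 ^ (5 * i) % 2 ^ 5

/-- The letters from position `i` down to position `j` are `m` in unary. -/
def NatAt (w i j m : ℕ) : Prop :=
  i = j + 1 + m ∧ digit w j = 19 ∧ ∀ l < m, digit w (j + 1 + l) = 18

/-- The letters from position `i` down to position `j` are a list of `m` truth values. -/
def BitsAt (w i j m : ℕ) : Prop :=
  i = j + 1 + m ∧ digit w j = 19 ∧ ∀ l < m, digit w (j + 1 + l) = 16 ∨ digit w (j + 1 + l) = 17

/-- The first `m` binary digits of `z`, from digit `s` on, agree with the truth values listed from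
position `j + m` downwards. -/
def BitsMatch (w j m z s : ℕ) : Prop :=
  ∀ l < m, (z.testBit (s + l) = true ↔ digit w (j + m - l) = 17)

/-- The letters from position `i` down to position `j` are one of `n` variables of kind `c`, whose
values are the binary digits of `z` from digit `s` on, and `t` is the value of that variable. -/
def VarAt (w c n z s i j t : ℕ) : Prop :=
  ∃ m < n, i = j + 1 + m + 1 ∧ digit w (j + 1 + m) = c ∧ NatAt w (j + 1 + m) j m ∧
    (t = 1 ↔ z.testBit (s + m) = true)

/-- A word together with the sizes and positions of the parts of the instance that it encodes. The
set `K` bounds codes of sets of numbers below `W`, and `M` bounds codes of sets of pairs of numbers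
below `K`. The formulas `F`, `F'`, `G` stand at positions `pF`, `pF'`, `pG`, and `pP` is the
position that follows `G`. -/
structure Layout where
  (M K W nX nX' nY0 nY1 h0 h1 pF pF' pG pP : ℕ)

namespace Layout

variable (q : Layout)

/-- The set `Z` of triples is closed under the rules by which the values `t` of formulas between
positions `i` and `j` are found, for formulas in `q.nX + n₁ + n₂ + n₃` variables. -/
def EvalClosed (n₁ n₂ n₃ x v y Z : ℕ) : Prop :=
  (∀ i < q.W, ∀ j < q.W, ∀ t < 2,
    (VarAt q.W 23 q.nX x 0 i j t ∨ VarAt q.W 24 n₁ v 0 i j t ∨ VarAt q.W 25 n₂ y 0 i j t ∨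
      VarAt q.W 26 n₃ y n₂ i j t ∨ (i = j + 1 ∧ digit q.W j = 16 + t)) →
    Z.testBit (i * q.K + (2 * j + t)) = true) ∧
  (∀ i < q.W, ∀ j < q.W, ∀ t < 2, Z.testBit (i * q.K + (2 * j + t)) = true →
    digit q.W i = 20 → Z.testBit ((i + 1) * q.K + (2 * j + (1 - t))) = true) ∧
  (∀ i < q.W, ∀ j < q.W, ∀ k < q.W, ∀ t < 2, ∀ s < 2,
    Z.testBit (i * q.K + (2 * j + t)) = true → Z.testBit (j * q.K + (2 * k + s)) = true →
    (digit q.W i = 21 → Z.testBit ((i + 1) * q.K + (2 * k + t * s)) = true) ∧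
    (digit q.W i = 22 → Z.testBit ((i + 1) * q.K + (2 * k + (t + s - t * s))) = true))

/-- The letters from position `i` down to position `j` are a formula with value `t`. -/
def Eval (n₁ n₂ n₃ x v y i j t : ℕ) : Prop :=
  ∀ Z < q.M, q.EvalClosed n₁ n₂ n₃ x v y Z → Z.testBit (i * q.K + (2 * j + t)) = true

/-- The formula `F` is true. -/
def EvalF (x v y : ℕ) : Prop := q.Eval q.nX' q.nY0 q.nY1 x v y q.pF q.pF' 1

/-- The formula `F'` is true. -/
def EvalF' (x v : ℕ) : Prop := q.Eval q.nX' 0 0 x v 0 q.pF' q.pG 1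

/-- The formula `G` is true. -/
def EvalG (x : ℕ) : Prop := q.Eval 0 0 0 x 0 0 q.pG q.pP 1

/-- Black has a move to `v'` from a state in the set `S`, where White sees `o₀` and `o₁`. -/
def Succ (y S o₀ o₁ v' : ℕ) : Prop :=
  ∃ v < q.W, S.testBit v = true ∧ ∃ x < q.W, q.EvalF x v y ∧ q.EvalF' x v' ∧
    (x.testBit q.h0 = true ↔ o₀ = 1) ∧ (x.testBit q.h1 = true ↔ o₁ = 1)

/-- The set `T` of pairs is closed under the rule that defines winning positions. -/
def WinClosed (T : ℕ) : Prop :=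
  ∀ y < q.W, ∀ S < q.K,
    (∀ v < q.W, S.testBit v = true → ∀ x < q.W, q.EvalF x v y → ¬ q.EvalG x) →
    (∀ o₀ < 2, ∀ o₁ < 2, ∃ S' < q.K, (∀ v' < q.W, (S'.testBit v' = true ↔ q.Succ y S o₀ o₁ v')) ∧
      ((∃ v' < q.W, S'.testBit v' = true) → ∃ y' < q.W, T.testBit (y' * q.K + S') = true)) →
    T.testBit (y * q.K + S) = true

/-- White wins after the choice of `y`, when the state is known to be in the set `S`. -/
def Win (y S : ℕ) : Prop := ∀ T < q.M, q.WinClosed T → T.testBit (y * q.K + S) = true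

/-- The letters from position `i` down to position `j` are a formula. -/
def FormulaAt (n₁ n₂ n₃ i j : ℕ) : Prop := ∃ t < 2, q.Eval n₁ n₂ n₃ 0 0 0 i j t

/-- The letters from position `i` to the end of the word are `m` rows of the table of a policy
with `N` states, all of which prescribe a one-bit mid-round exchange and nothing else. -/
def Rows (N m i : ℕ) : Prop :=
  ∀ Z < q.M, Z.testBit 0 = true →
    (∀ m < q.W, ∀ i < q.W, ∀ j < q.W, ∀ r < N, Z.testBit (m * q.K + j) = true →
      NatAt q.W i (j + 6) r → NatAt q.W (j + 6) (j + 4) 1 → NatAt q.W (j + 4) (j + 2) 1 →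
      NatAt q.W (j + 2) (j + 1) 0 → NatAt q.W (j + 1) j 0 →
      Z.testBit ((m + 1) * q.K + i) = true) →
    Z.testBit (m * q.K + i) = true

/-- The letters from position `pP` to the end of the word are a policy with a one-bit exchange in
the middle of every round and no other communication. -/
def PolicyAt : Prop :=
  ∃ pN < q.W, ∃ pS < q.W, ∃ N < q.W, ∃ st < N,
    NatAt q.W q.pP pN N ∧ NatAt q.W pN pS st ∧ q.Rows N N pS

/-- The parts of the word that should be the observed variables and the formulas are so, and `F`
implies the negation of `F'`. -/
def WellFormed : Prop :=
  q.h0 < q.nX ∧ q.h1 < q.nX ∧ q.FormulaAt q.nX' q.nY0 q.nY1 q.pF q.pF' ∧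
    q.FormulaAt q.nX' 0 0 q.pF' q.pG ∧ q.FormulaAt 0 0 0 q.pG q.pP ∧
    ∀ x < q.W, ∀ v < q.W, ∀ y < q.W, q.EvalF x v y → ¬ q.EvalF' x v

/-- White wins from the initial position, where the lists of initial values of `X'`, `Y₀` and `Y₁`
end at positions `j`, `j₀` and `j₁`. -/
def WinInit (j j₀ j₁ : ℕ) : Prop :=
  ∃ y < q.W, ∃ S < q.K, BitsMatch q.W j₀ q.nY0 y 0 ∧ BitsMatch q.W j₁ q.nY1 y q.nY0 ∧
    (∀ v < q.W, (S.testBit v = true ↔ BitsMatch q.W j q.nX' v 0)) ∧ q.Win y S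

end Layout

/-- The number `n` is the length of the word with base `32` number `w`, whose letters are not zero.
-/
def LengthIs (w n : ℕ) : Prop := (∀ i < n, digit w i ≠ 0) ∧ digit w n = 0

/-- The word with number `W` is an instance in which White has a forced win. -/
def Accepts (M K W : ℕ) : Prop :=
  ∃ n < W, ∃ j < W, ∃ j' < W, ∃ j₀ < W, ∃ j₁ < W, ∃ j₂ < W, ∃ pF < W, ∃ pF' < W, ∃ pG < W,
    ∃ pP < W, ∃ nX < W, ∃ nX' < W, ∃ nY0 < W, ∃ nY1 < W, ∃ h0 < W, ∃ h1 < W, LengthIs W n ∧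
    BitsAt W n j nX ∧ BitsAt W j j' nX' ∧ BitsAt W j' j₀ nY0 ∧ BitsAt W j₀ j₁ nY1 ∧
    NatAt W j₁ j₂ h0 ∧ NatAt W j₂ pF h1 ∧
    (⟨M, K, W, nX, nX', nY0, nY1, h0, h1, pF, pF', pG, pP⟩ : Layout).WellFormed ∧
    (⟨M, K, W, nX, nX', nY0, nY1, h0, h1, pF, pF', pG, pP⟩ : Layout).PolicyAt ∧
    (⟨M, K, W, nX, nX', nY0, nY1, h0, h1, pF, pF', pG, pP⟩ : Layout).WinInit j' j₀ j₁

/-! ### The predicate can be decided in linear space -/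

section Lin

variable {k : ℕ} {w i j m z s c n t : (Fin k → ℕ) → ℕ}

theorem LinSpace.digit (hw : LinSpace w) (hi : LinSpace i) :
    LinSpace fun e => digit (w e) (i e) :=
  (hw.div_two_pow ((const 5).mul hi)).mod_two_pow 5

theorem LinDec.natAt (hw : LinSpace w) (hi : LinSpace i) (hj : LinSpace j) (hm : LinSpace m) :
    LinDec fun e => NatAt (w e) (i e) (j e) (m e) := by
  unfold NatAt
  apply_rules (maxDepth := 500) [LinDec.and, LinDec.all, LinDec.eq, LinSpace.const, LinSpace.succ,
    LinSpace.add, LinSpace.digit, LinSpace.var, hw.reindex, hj.reindex]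

theorem LinDec.bitsAt (hw : LinSpace w) (hi : LinSpace i) (hj : LinSpace j) (hm : LinSpace m) :
    LinDec fun e => BitsAt (w e) (i e) (j e) (m e) := by
  unfold BitsAt
  apply_rules (maxDepth := 500) [LinDec.and, LinDec.or, LinDec.all, LinDec.eq, LinSpace.const,
    LinSpace.succ, LinSpace.add, LinSpace.digit, LinSpace.var, hw.reindex, hj.reindex]

theorem LinDec.bitsMatch (hw : LinSpace w) (hj : LinSpace j) (hm : LinSpace m) (hz : LinSpace z)
    (hs : LinSpace s) : LinDec fun e => BitsMatch (w e) (j e) (m e) (z e) (s e) := by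
  unfold BitsMatch
  apply_rules (maxDepth := 500) [LinDec.iff, LinDec.testBit, LinDec.all, LinDec.eq, LinSpace.sub,
    LinSpace.const, LinSpace.succ, LinSpace.add, LinSpace.digit, LinSpace.var, hw.reindex,
    hj.reindex, hm.reindex, hz.reindex, hs.reindex]

theorem LinDec.varAt (hw : LinSpace w) (hc : LinSpace c) (hn : LinSpace n) (hz : LinSpace z)
    (hs : LinSpace s) (hi : LinSpace i) (hj : LinSpace j) (ht : LinSpace t) :
    LinDec fun e => VarAt (w e) (c e) (n e) (z e) (s e) (i e) (j e) (t e) := by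
  unfold VarAt
  apply_rules (maxDepth := 500) [LinDec.natAt, LinDec.and, LinDec.iff, LinDec.ex, LinDec.testBit,
    LinDec.eq, LinSpace.const, LinSpace.succ, LinSpace.add, LinSpace.digit, LinSpace.var,
    hw.reindex, hc.reindex, hz.reindex, hs.reindex, hi.reindex, hj.reindex, ht.reindex]

end Lin

namespace Layout

/-- All components of a layout that depends on parameters can be computed in linear space. -/
structure Lin {k : ℕ} (q : (Fin k → ℕ) → Layout) : Prop where
  M : LinSpace fun e => (q e).M
  K : LinSpace fun e => (q e).K
  W : LinSpace fun e => (q e).W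
  nX : LinSpace fun e => (q e).nX
  nX' : LinSpace fun e => (q e).nX'
  nY0 : LinSpace fun e => (q e).nY0
  nY1 : LinSpace fun e => (q e).nY1
  h0 : LinSpace fun e => (q e).h0
  h1 : LinSpace fun e => (q e).h1
  pF : LinSpace fun e => (q e).pF
  pF' : LinSpace fun e => (q e).pF'
  pG : LinSpace fun e => (q e).pG
  pP : LinSpace fun e => (q e).pP

namespace Lin

variable {k : ℕ} {q : (Fin k → ℕ) → Layout}
  {n₁ n₂ n₃ x v y i j t Z S T o₀ o₁ N m : (Fin k → ℕ) → ℕ}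

theorem reindex (hq : Lin q) {m : ℕ} (σ : Fin k → Fin m) :
    Lin fun e : Fin m → ℕ => q fun i => e (σ i) where
  M := hq.M.reindex σ
  K := hq.K.reindex σ
  W := hq.W.reindex σ
  nX := hq.nX.reindex σ
  nX' := hq.nX'.reindex σ
  nY0 := hq.nY0.reindex σ
  nY1 := hq.nY1.reindex σ
  h0 := hq.h0.reindex σ
  h1 := hq.h1.reindex σ
  pF := hq.pF.reindex σ
  pF' := hq.pF'.reindex σ
  pG := hq.pG.reindex σ
  pP := hq.pP.reindex σ

theorem evalClosed (hq : Lin q) (h₁ : LinSpace n₁) (h₂ : LinSpace n₂) (h₃ : LinSpace n₃)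
    (hx : LinSpace x) (hv : LinSpace v) (hy : LinSpace y) (hZ : LinSpace Z) :
    LinDec fun e => (q e).EvalClosed (n₁ e) (n₂ e) (n₃ e) (x e) (v e) (y e) (Z e) := by
  unfold EvalClosed
  apply_rules (maxDepth := 500) [LinDec.varAt, LinDec.and, LinDec.or, LinDec.not, LinDec.iff,
    LinDec.ex, LinDec.all, LinDec.eq, LinDec.lt, LinDec.testBit, LinSpace.const, LinSpace.succ,
    LinSpace.add, LinSpace.sub, LinSpace.mul, LinSpace.digit, LinSpace.var, hq.W.reindex,
    hq.K.reindex, hq.nX.reindex, h₁.reindex, h₂.reindex, h₃.reindex, hx.reindex, hv.reindex,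
    hy.reindex, hZ.reindex, LinDec.imp]

theorem eval (hq : Lin q) (h₁ : LinSpace n₁) (h₂ : LinSpace n₂) (h₃ : LinSpace n₃)
    (hx : LinSpace x) (hv : LinSpace v) (hy : LinSpace y) (hi : LinSpace i) (hj : LinSpace j)
    (ht : LinSpace t) :
    LinDec fun e => (q e).Eval (n₁ e) (n₂ e) (n₃ e) (x e) (v e) (y e) (i e) (j e) (t e) := by
  unfold Eval
  refine LinDec.all hq.M (LinDec.imp (evalClosed (hq.reindex _) (h₁.reindex _) (h₂.reindex _)
    (h₃.reindex _) (hx.reindex _) (hv.reindex _) (hy.reindex _) (.var 0)) ?_)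
  apply_rules (maxDepth := 500) [LinDec.testBit, LinSpace.const, LinSpace.succ, LinSpace.add,
    LinSpace.sub, LinSpace.mul, LinSpace.digit, LinSpace.var, hq.K.reindex, hi.reindex, hj.reindex,
    ht.reindex]

theorem evalF (hq : Lin q) (hx : LinSpace x) (hv : LinSpace v) (hy : LinSpace y) :
    LinDec fun e => (q e).EvalF (x e) (v e) (y e) :=
  hq.eval hq.nX' hq.nY0 hq.nY1 hx hv hy hq.pF hq.pF' (.const 1)

theorem evalF' (hq : Lin q) (hx : LinSpace x) (hv : LinSpace v) :
    LinDec fun e => (q e).EvalF' (x e) (v e) :=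
  hq.eval hq.nX' (.const 0) (.const 0) hx hv (.const 0) hq.pF' hq.pG (.const 1)

theorem evalG (hq : Lin q) (hx : LinSpace x) : LinDec fun e => (q e).EvalG (x e) :=
  hq.eval (.const 0) (.const 0) (.const 0) hx (.const 0) (.const 0) hq.pG hq.pP (.const 1)

theorem succ (hq : Lin q) (hy : LinSpace y) (hS : LinSpace S) (h₀ : LinSpace o₀)
    (h₁ : LinSpace o₁) (hv : LinSpace v) :
    LinDec fun e => (q e).Succ (y e) (S e) (o₀ e) (o₁ e) (v e) := by
  unfold Succ
  apply_rules (maxDepth := 500) [evalF, evalF', evalG, reindex, LinDec.and, LinDec.or, LinDec.not,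
    LinDec.iff, LinDec.ex, LinDec.all, LinDec.eq, LinDec.lt, LinDec.testBit, LinSpace.const,
    LinSpace.var, hq.W.reindex, hq.h0.reindex, hq.h1.reindex, hy.reindex, hS.reindex, hv.reindex,
    h₀.reindex, h₁.reindex]

theorem winClosed (hq : Lin q) (hT : LinSpace T) : LinDec fun e => (q e).WinClosed (T e) := by
  unfold WinClosed
  apply_rules (maxDepth := 500) [succ, evalF, evalG, hq.reindex, LinDec.and, LinDec.or,
    LinDec.not, LinDec.iff, LinDec.ex, LinDec.all, LinDec.eq, LinDec.lt, LinDec.testBit,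
    LinSpace.const, LinSpace.var, LinSpace.add, LinSpace.mul, hq.W.reindex, hq.K.reindex,
    hT.reindex, LinDec.imp]

theorem win (hq : Lin q) (hy : LinSpace y) (hS : LinSpace S) :
    LinDec fun e => (q e).Win (y e) (S e) := by
  unfold Win
  refine LinDec.all hq.M (LinDec.imp (winClosed (hq.reindex _) (.var 0)) ?_)
  apply_rules (maxDepth := 500) [LinDec.testBit, LinSpace.add, LinSpace.mul, hq.K.reindex,
    hy.reindex, hS.reindex, LinSpace.var]

theorem formulaAt (hq : Lin q) (h₁ : LinSpace n₁) (h₂ : LinSpace n₂) (h₃ : LinSpace n₃)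
    (hi : LinSpace i) (hj : LinSpace j) :
    LinDec fun e => (q e).FormulaAt (n₁ e) (n₂ e) (n₃ e) (i e) (j e) :=
  LinDec.ex (.const 2) (eval (hq.reindex _) (h₁.reindex _) (h₂.reindex _) (h₃.reindex _)
    (.const 0) (.const 0) (.const 0) (hi.reindex _) (hj.reindex _) (.var 0))

theorem rows (hq : Lin q) (hN : LinSpace N) (hm : LinSpace m) (hi : LinSpace i) :
    LinDec fun e => (q e).Rows (N e) (m e) (i e) := by
  unfold Rows
  apply_rules (maxDepth := 500) [LinDec.natAt, LinDec.all, LinDec.testBit, LinSpace.const,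
    LinSpace.succ, LinSpace.add, LinSpace.mul, LinSpace.var, hq.M.reindex, hq.W.reindex,
    hq.K.reindex, hN.reindex, hm.reindex, hi.reindex, LinDec.imp]

theorem policyAt (hq : Lin q) : LinDec fun e => (q e).PolicyAt := by
  unfold PolicyAt
  apply_rules (maxDepth := 500) [rows, LinDec.natAt, LinDec.ex, LinDec.and, LinSpace.var,
    hq.reindex, hq.W.reindex, hq.pP.reindex]

theorem wellFormed (hq : Lin q) : LinDec fun e => (q e).WellFormed := by
  unfold WellFormed
  apply_rules (maxDepth := 500) [evalF, evalF', formulaAt, LinDec.lt, LinDec.and, LinDec.all,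
    LinSpace.const, LinSpace.var, LinDec.not, hq.reindex, hq.W.reindex, hq.pP, hq.h0, hq.h1, hq.nX,
    hq.nX', hq.nY0, hq.nY1, hq.pF, hq.pF', hq.pG, LinDec.imp]

theorem winInit (hq : Lin q) (hj : LinSpace j) (h₀ : LinSpace o₀) (h₁ : LinSpace o₁) :
    LinDec fun e => (q e).WinInit (j e) (o₀ e) (o₁ e) := by
  unfold WinInit
  apply_rules (maxDepth := 500) [win, LinDec.bitsMatch, LinDec.testBit, LinDec.ex, LinDec.and,
    LinDec.iff, LinDec.all, LinSpace.const, LinSpace.var, hq.reindex, hq.W.reindex, hq.K.reindex,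
    hq.nX'.reindex, hq.nY0.reindex, hq.nY1.reindex, hj.reindex, h₀.reindex, h₁.reindex]

end Lin

end Layout

theorem LinDec.lengthIs {k : ℕ} {w n : (Fin k → ℕ) → ℕ} (hw : LinSpace w) (hn : LinSpace n) :
    LinDec fun e => LengthIs (w e) (n e) := by
  unfold LengthIs
  apply_rules (maxDepth := 500) [LinDec.and, LinDec.eq, LinDec.all, LinDec.not, LinSpace.digit,
    LinSpace.const, LinSpace.var, hw.reindex]

/-- The variables of the context are numbered from the innermost quantifier outwards. -/
theorem linDec_accepts : LinDec fun e : Fin 3 → ℕ => Accepts (e 0) (e 1) (e 2) := by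
  unfold Accepts
  iterate 16 refine LinDec.ex (.var _) ?_
  have hq : Layout.Lin fun e : Fin 19 → ℕ => ⟨e 16, e 17, e 18, e 5, e 4, e 3, e 2, e 1, e 0,
    e 9, e 8, e 7, e 6⟩ := by
    constructor <;> exact .var _
  refine (LinDec.lengthIs (.var _) (.var _)).and <| (LinDec.bitsAt (.var _) (.var _) (.var _)
    (.var _)).and <| (LinDec.bitsAt (.var _) (.var _) (.var _) (.var _)).and <| (LinDec.bitsAt
    (.var _) (.var _) (.var _) (.var _)).and <| (LinDec.bitsAt (.var _) (.var _) (.var _)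
    (.var _)).and <| (LinDec.natAt (.var _) (.var _) (.var _) (.var _)).and <| (LinDec.natAt
    (.var _) (.var _) (.var _) (.var _)).and <| hq.wellFormed.and <| hq.policyAt.and
    (hq.winInit (.var 13) (.var 12) (.var 11))

/-! ### Numbers as sets, and words as numbers -/

/-- Every set of numbers below `n` is the set of positions of ones in a number below `2 ^ n`. -/
theorem exists_testBit (n : ℕ) (P : ℕ → Prop) :
    ∃ S < 2 ^ n, ∀ v < n, (S.testBit v = true ↔ P v) := by
  classical
  refine ⟨Nat.ofBits fun i : Fin n => decide (P i), Nat.ofBits_lt_two_pow _, fun v hv => ?_⟩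
  rw [Nat.testBit_ofBits_lt _ _ hv, decide_eq_true_iff]

/-- Every set of pairs of numbers below `expBound W` has a code below `dexpBound W`. -/
theorem exists_testBit_pair (W : ℕ) (P : ℕ → ℕ → Prop) : ∃ Z < dexpBound W,
    ∀ a < expBound W, ∀ b < expBound W, (Z.testBit (a * expBound W + b) = true ↔ P a b) := by
  set K := expBound W with hK
  obtain ⟨Z, hZ, h⟩ := exists_testBit (K * K) fun c => P (c / K) (c % K)
  refine ⟨Z, hZ, fun a ha b hb => ?_⟩
  rw [h _ (by nlinarith), Nat.mul_comm a K, Nat.mul_add_div (by omega), Nat.mul_add_mod,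
    Nat.div_eq_of_lt hb, Nat.mod_eq_of_lt hb, Nat.add_zero]

/-- The digits by which the letters of instances are represented. -/
def GameSym.code : GameSym → ℕ
  | bit b => 16 + b.toNat
  | tick => 18
  | sep => 19
  | neg => 20
  | conj => 21
  | disj => 22
  | varX => 23
  | varX' => 24
  | varY i => 25 + i

theorem GameSym.code_bounds (a : GameSym) : 16 ≤ a.code ∧ a.code < 32 := by
  rcases a with (_ | _) | _ | _ | _ | _ | _ | _ | _ | i
  iterate 9 decide
  have := i.isLt
  simp only [code]
  omega

theorem GameSym.code_injective : Function.Injective GameSym.code := by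
  decide

namespace GameSym

open List

/-- The base `32` number of a word. -/
abbrev num (u : List GameSym) : ℕ := wordNum code u

theorem num_append (l t : List GameSym) : num (l ++ t) = num l * 32 ^ t.length + num t := by
  induction t using List.reverseRecOn with
  | nil => simp [num, wordNum]
  | append_singleton t a ih =>
    rw [← append_assoc]
    simp only [num, wordNum, foldl_append, foldl_cons, foldl_nil, length_append, length_singleton,
      pow_succ] at ih ⊢
    rw [ih]
    ring

theorem two_pow_length_le (u : List GameSym) (hu : u ≠ []) : 2 ^ u.length ≤ num u := by
  obtain ⟨a, u, rfl⟩ := exists_cons_of_ne_nil hu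
  have h1 : num (a :: u) = a.code * 32 ^ u.length + num u := by
    rw [← singleton_append, num_append]; simp [num, wordNum]
  have h2 : 2 ^ u.length ≤ 32 ^ u.length := Nat.pow_le_pow_left (by omega) _
  have h3 := a.code_bounds.1
  rw [h1, length_cons, pow_succ]
  nlinarith

variable {u l t : List GameSym} {a : GameSym} {i j n : ℕ}

theorem digit_of_isSuffix (h : a :: t <:+ u) : digit (num u) t.length = a.code := by
  obtain ⟨l, rfl⟩ := h
  have ha := a.code_bounds.2
  have ht : num t < 32 ^ t.length := wordNum_lt code_bounds t
  rw [digit, pow_mul, show l ++ a :: t = l ++ [a] ++ t by simp, num_append,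
    num_append]
  norm_num
  rw [Nat.mul_comm _ (32 ^ _), Nat.mul_add_div (by positivity), Nat.div_eq_of_lt ht]
  simp [num, wordNum]
  omega

theorem digit_of_length_le (h : u.length ≤ i) : digit (num u) i = 0 := by
  have hu : num u < 32 ^ u.length := wordNum_lt code_bounds u
  rw [digit, pow_mul, Nat.div_eq_of_lt]
  · simp
  · exact hu.trans_le (Nat.pow_le_pow_right (by omega) h)

theorem length_rtake (h : i ≤ u.length) : (u.rtake i).length = i := by
  simp [rtake]; omega

theorem rtake_isSuffix (u : List GameSym) (i : ℕ) : u.rtake i <:+ u := drop_suffix _ _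

theorem eq_rtake_of_append_eq (h : u.rtake i = l ++ t) : t = u.rtake t.length := by
  have : t <:+ u := (suffix_append l t).trans (h ▸ rtake_isSuffix u i)
  exact suffix_iff_eq_drop.1 this

theorem length_le_of_rtake_eq (h : u.rtake i = l ++ t) : t.length ≤ u.length :=
  ((suffix_append l t).trans (h ▸ rtake_isSuffix u i)).length_le

theorem rtake_succ (h : i < u.length) :
    ∃ a, u.rtake (i + 1) = a :: u.rtake i ∧ digit (num u) i = a.code := by
  obtain ⟨a, ha⟩ : ∃ a, u.rtake (i + 1) = a :: u.rtake i := by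
    refine ⟨u[u.length - (i + 1)], ?_⟩
    rw [rtake, rtake, drop_eq_getElem_cons (by omega)]
    congr 2
    omega
  have := digit_of_isSuffix (ha ▸ rtake_isSuffix u (i + 1))
  rw [length_rtake h.le] at this
  exact ⟨a, ha, this⟩

/-- Reading a letter of a word is reading a digit of its number. -/
theorem rtake_eq_cons_iff (hi : i ≤ u.length) (hj : j ≤ u.length) :
    u.rtake i = a :: u.rtake j ↔ i = j + 1 ∧ digit (num u) j = a.code := by
  constructor
  · intro h
    have hl := congrArg length h
    rw [length_cons, length_rtake hi, length_rtake hj] at hl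
    refine ⟨hl, ?_⟩
    have := digit_of_isSuffix (h ▸ rtake_isSuffix u i)
    rwa [length_rtake hj] at this
  · rintro ⟨rfl, h⟩
    obtain ⟨b, hb, hb'⟩ := rtake_succ hi
    rw [hb, code_injective (hb'.symm.trans h)]

theorem lt_length_of_digit_eq (h : digit (num u) i = a.code) : i < u.length := by
  by_contra hi
  have := a.code_bounds.1
  rw [digit_of_length_le (by omega)] at h
  omega

theorem exists_of_rtake_eq_cons (hi : i ≤ u.length) (h : u.rtake i = a :: t) :
    ∃ i', i = i' + 1 ∧ digit (num u) i' = a.code ∧ t = u.rtake i' := by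
  have ht := eq_rtake_of_append_eq (l := [a]) h
  have hl := length_le_of_rtake_eq (l := [a]) h
  rw [ht] at h
  obtain ⟨h1, h2⟩ := (rtake_eq_cons_iff hi hl).1 h
  exact ⟨t.length, h1, h2, ht⟩

theorem lengthIs_iff : LengthIs (num u) n ↔ n = u.length := by
  have h : ∀ i < u.length, digit (num u) i ≠ 0 := fun i hi => by
    obtain ⟨a, -, ha⟩ := rtake_succ hi
    have := a.code_bounds.1
    omega
  constructor
  · rintro ⟨h1, h2⟩
    by_contra hne
    rcases Nat.lt_or_gt_of_ne hne with hlt | hlt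
    · exact h n hlt h2
    · exact h1 _ hlt (digit_of_length_le le_rfl)
  · rintro rfl
    exact ⟨h, digit_of_length_le le_rfl⟩

end GameSym

/-! ### Parsing formulas -/

open GameSym List

/-- The letters of `u` from position `i` down to position `j` form the word `l`. -/
def Reads (u : List GameSym) (i j : ℕ) (l : List GameSym) : Prop :=
  i ≤ u.length ∧ j ≤ u.length ∧ u.rtake i = l ++ u.rtake j

namespace Reads

variable {u l l' : List GameSym} {a : GameSym} {i j k m n : ℕ}

theorem cons_iff : Reads u i j (a :: l) ↔
    ∃ i', i = i' + 1 ∧ digit (num u) i' = a.code ∧ Reads u i' j l := by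
  constructor
  · rintro ⟨hi, hj, h⟩
    obtain ⟨i', rfl, h1, h2⟩ := exists_of_rtake_eq_cons hi h
    exact ⟨i', rfl, h1, by omega, hj, h2.symm⟩
  · rintro ⟨i', rfl, h1, h2, h3, h4⟩
    have hi := lt_length_of_digit_eq h1
    exact ⟨hi, h3, by rw [(rtake_eq_cons_iff hi h2).2 ⟨rfl, h1⟩, h4, cons_append]⟩

theorem append_iff : Reads u i k (l ++ l') ↔ ∃ j, Reads u i j l ∧ Reads u j k l' := by
  constructor
  · rintro ⟨hi, hk, h⟩
    rw [append_assoc] at h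
    have ht := eq_rtake_of_append_eq h
    have hl := length_le_of_rtake_eq h
    exact ⟨_, ⟨hi, hl, by rw [← ht, h]⟩, hl, hk, ht.symm⟩
  · rintro ⟨j, ⟨h1, h2, h3⟩, h4, h5, h6⟩
    exact ⟨h1, h5, by rw [h3, h6, append_assoc]⟩

theorem nil_iff : Reads u i j [] ↔ i = j ∧ j ≤ u.length := by
  constructor
  · rintro ⟨h1, h2, h3⟩
    refine ⟨?_, h2⟩
    have := congrArg length h3
    rwa [nil_append, length_rtake h1, length_rtake h2] at this
  · rintro ⟨rfl, h⟩
    exact ⟨h, h, rfl⟩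

theorem length_eq (h : Reads u i j l) : i = l.length + j := by
  have := congrArg length h.2.2
  rwa [length_append, length_rtake h.1, length_rtake h.2.1] at this

theorem natAt_iff : NatAt (num u) i j m ↔ Reads u i j (encodeNat m) := by
  induction m generalizing i with
  | zero =>
    simp only [encodeNat, replicate_zero, nil_append, cons_iff, nil_iff]
    constructor
    · rintro ⟨rfl, h, -⟩
      exact ⟨j, rfl, h, rfl, (lt_length_of_digit_eq (a := sep) h).le⟩
    · rintro ⟨_, rfl, h, rfl, -⟩
      exact ⟨rfl, h, by omega⟩
  | succ m ih =>
    rw [show encodeNat (m + 1) = tick :: encodeNat m from rfl, cons_iff]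
    simp only [← ih]
    constructor
    · rintro ⟨rfl, h1, h2⟩
      exact ⟨j + 1 + m, rfl, h2 m (by omega), rfl, h1, fun l hl => h2 l (by omega)⟩
    · rintro ⟨_, rfl, h, rfl, h1, h2⟩
      refine ⟨rfl, h1, fun l hl => ?_⟩
      rcases Nat.lt_succ_iff_lt_or_eq.1 hl with hl | rfl
      · exact h2 l hl
      · exact h

theorem bitsAt_iff : BitsAt (num u) i j m ↔ ∃ f : Fin m → Bool, Reads u i j (encodeBits f) := by
  induction m generalizing i with
  | zero =>
    simp only [encodeBits, ofFn_zero, map_nil, nil_append, cons_iff, nil_iff, exists_const]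
    constructor
    · rintro ⟨rfl, h, -⟩
      exact ⟨j, rfl, h, rfl, (lt_length_of_digit_eq (a := sep) h).le⟩
    · rintro ⟨_, rfl, h, rfl, -⟩
      exact ⟨rfl, h, by omega⟩
  | succ m ih =>
    have hcons : ∀ f : Fin (m + 1) → Bool,
        encodeBits f = bit (f 0) :: encodeBits fun i => f i.succ := fun f => by
      simp [encodeBits, ofFn_succ]
    simp only [hcons, cons_iff]
    constructor
    · rintro ⟨rfl, h1, h2⟩
      obtain ⟨b, hb⟩ : ∃ b, digit (num u) (j + 1 + m) = (bit b).code :=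
        (h2 m (by omega)).elim (fun h => ⟨false, h⟩) fun h => ⟨true, h⟩
      obtain ⟨f, hf⟩ := ih.1 ⟨rfl, h1, fun l hl => h2 l (by omega)⟩
      exact ⟨Fin.cons b f, j + 1 + m, rfl, by simpa using hb, by simpa using hf⟩
    · rintro ⟨f, _, rfl, h, h'⟩
      obtain ⟨rfl, h1, h2⟩ := ih.2 ⟨_, h'⟩
      refine ⟨rfl, h1, fun l hl => ?_⟩
      rcases Nat.lt_succ_iff_lt_or_eq.1 hl with hl | rfl
      · exact h2 l hl
      · rw [h]
        cases f 0
        · exact .inl rfl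
        · exact .inr rfl

theorem varAt_iff (c : GameSym) (z s : ℕ) {t : ℕ} (ht : t < 2) :
    VarAt (num u) c.code n z s i j t ↔
      ∃ a : Fin n, Reads u i j (encodeVar c a) ∧ (z.testBit (s + a)).toNat = t := by
  have hb : ∀ b : Bool, (t = 1 ↔ b = true) ↔ b.toNat = t := by
    intro b
    cases b <;> simp <;> omega
  simp only [VarAt, hb, encodeVar, cons_iff, ← natAt_iff]
  constructor
  · rintro ⟨m, hm, h1, h2, h3, h4⟩
    exact ⟨⟨m, hm⟩, ⟨_, h1, h2, h3⟩, h4⟩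
  · rintro ⟨a, ⟨i', rfl, h2, h3⟩, h4⟩
    obtain rfl := h3.1
    exact ⟨a, a.isLt, rfl, h2, h3, h4⟩

end Reads

theorem encodeNat_append_inj {m n : ℕ} {s t : List GameSym}
    (h : encodeNat m ++ s = encodeNat n ++ t) : m = n ∧ s = t := by
  induction m generalizing n with
  | zero =>
    cases n with
    | zero => simpa [encodeNat] using h
    | succ n => simp [encodeNat, replicate_succ] at h
  | succ m ih =>
    cases n with
    | zero => simp [encodeNat, replicate_succ] at h
    | succ n =>
      simp only [encodeNat, replicate_succ, cons_append, cons.injEq, true_and] at h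
      exact (ih h).imp_left fun h => by rw [h]

/-- The requirements on the notation for variables that make formulas in prefix notation uniquely
readable. -/
structure VarCode {α : Type} (enc : α → List GameSym) : Prop where
  append_inj : ∀ a b s t, enc a ++ s = enc b ++ t → a = b ∧ s = t
  exists_cons : ∀ a, ∃ c l, enc a = c :: l ∧ 23 ≤ c.code

theorem VarCode.encodeVar {n : ℕ} {c : GameSym} (hc : 23 ≤ c.code) :
    VarCode (encodeVar c : Fin n → List GameSym) where
  append_inj a b s t h := by
    simp only [_root_.encodeVar, cons_append, cons.injEq, true_and] at h
    exact (encodeNat_append_inj h).imp_left Fin.ext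
  exists_cons a := ⟨c, _, rfl, hc⟩

theorem VarCode.sumElim {α β : Type} {f : α → List GameSym} {g : β → List GameSym}
    (hf : VarCode f) (hg : VarCode g) (hfg : ∀ a b, (f a).head? ≠ (g b).head?) :
    VarCode (Sum.elim f g) where
  append_inj := by
    have hd : ∀ a b s t, f a ++ s ≠ g b ++ t := fun a b s t h => by
      obtain ⟨c, l, hc, -⟩ := hf.exists_cons a
      obtain ⟨d, r, hd, -⟩ := hg.exists_cons b
      apply hfg a b
      rw [hc, hd] at h ⊢
      simp only [cons_append, cons.injEq] at h
      simp [h.1]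
    rintro (a | a) (b | b) s t h
    · exact (hf.append_inj a b s t h).imp_left (congrArg _)
    · exact (hd a b s t h).elim
    · exact (hd b a t s h.symm).elim
    · exact (hg.append_inj a b s t h).imp_left (congrArg _)
  exists_cons := by
    rintro (a | a)
    · exact hf.exists_cons a
    · exact hg.exists_cons a

theorem BoolFormula.encode_append_inj {α : Type} {enc : α → List GameSym} (henc : VarCode enc)
    {φ ψ : BoolFormula α} {s t : List GameSym} (h : φ.encode enc ++ s = ψ.encode enc ++ t) :
    φ = ψ ∧ s = t := by
  have hv : ∀ a (b : GameSym) s t, b.code < 23 → enc a ++ s ≠ b :: t := fun a b s t hb h => by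
    obtain ⟨c, l, hc, hc'⟩ := henc.exists_cons a
    rw [hc] at h
    simp only [cons_append, cons.injEq] at h
    rw [h.1] at hc'
    omega
  have hn : ∀ (b : GameSym), b = .neg ∨ b = .conj ∨ b = .disj ∨ (∃ x, b = bit x) → b.code < 23 := by
    rintro b (rfl | rfl | rfl | ⟨_ | _, rfl⟩) <;> simp [code]
  induction φ generalizing ψ s t with
  | var a =>
    cases ψ with
    | var b => exact (henc.append_inj a b s t h).imp_left (congrArg _)
    | _ => exact (hv _ _ _ _ (hn _ (by simp)) h).elim
  | const a =>
    cases ψ with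
    | var b => exact (hv _ _ _ _ (hn _ (by simp)) h.symm).elim
    | const b => simpa [encode] using h
    | _ => simp [encode] at h
  | neg φ ih =>
    cases ψ with
    | var b => exact (hv _ _ _ _ (hn _ (by simp)) h.symm).elim
    | neg ψ =>
      simp only [encode, cons_append, cons.injEq, true_and] at h
      exact (ih h).imp_left (congrArg _)
    | _ => simp [encode] at h
  | conj φ φ' ih ih' =>
    cases ψ with
    | var b => exact (hv _ _ _ _ (hn _ (by simp)) h.symm).elim
    | conj ψ ψ' =>
      simp only [encode, cons_append, cons.injEq, true_and, append_assoc] at h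
      obtain ⟨rfl, h'⟩ := ih h
      exact (ih' h').imp_left (congrArg _)
    | _ => simp [encode] at h
  | disj φ φ' ih ih' =>
    cases ψ with
    | var b => exact (hv _ _ _ _ (hn _ (by simp)) h.symm).elim
    | disj ψ ψ' =>
      simp only [encode, cons_append, cons.injEq, true_and, append_assoc] at h
      obtain ⟨rfl, h'⟩ := ih h
      exact (ih' h').imp_left (congrArg _)
    | _ => simp [encode] at h

theorem two_mul_lt_expBound (W : ℕ) : 2 * W + 1 < expBound W := by
  have := Nat.lt_two_pow_self (n := W)
  rw [expBound, pow_succ]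
  omega

namespace Layout

/-- The numeric evaluation of formulas finds the parses of the word and their values: the triples of
positions and values of parsed formulas form the least set that is closed under `EvalClosed`. -/
theorem eval_iff_exists {u : List GameSym} {q : Layout} (hu : u ≠ []) (hW : q.W = num u)
    (hK : q.K = expBound (num u)) (hM : q.M = dexpBound (num u)) {n₁ n₂ n₃ x v y : ℕ} {α : Type}
    {enc : α → List GameSym} {val : α → Bool}
    (hvar : ∀ i j t, t < 2 → ((VarAt q.W 23 q.nX x 0 i j t ∨ VarAt q.W 24 n₁ v 0 i j t ∨
      VarAt q.W 25 n₂ y 0 i j t ∨ VarAt q.W 26 n₃ y n₂ i j t) ↔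
        ∃ a, Reads u i j (enc a) ∧ (val a).toNat = t)) {i j t : ℕ} (hi : i < num u)
    (hj : j < num u) (ht : t < 2) :
    q.Eval n₁ n₂ n₃ x v y i j t ↔
      ∃ φ : BoolFormula α, Reads u i j (φ.encode enc) ∧ (φ.eval val).toNat = t := by
  have hlen : u.length < num u := Nat.lt_two_pow_self.trans_le (two_pow_length_le u hu)
  have hK1 := two_mul_lt_expBound (num u)
  constructor
  · intro h
    obtain ⟨Z, hZ, hZ'⟩ := exists_testBit_pair (num u) fun a b =>
      ∃ φ : BoolFormula α, Reads u a (b / 2) (φ.encode enc) ∧ (φ.eval val).toNat = b % 2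
    have key : ∀ i j t, i ≤ num u → j < num u → t < 2 →
        (Z.testBit (i * q.K + (2 * j + t)) = true ↔
          ∃ φ : BoolFormula α, Reads u i j (φ.encode enc) ∧ (φ.eval val).toNat = t) := by
      intro i j t hi hj ht
      rw [hK, hZ' i (by omega) _ (by omega), show (2 * j + t) / 2 = j by omega,
        show (2 * j + t) % 2 = t by omega]
    refine (key i j t hi.le hj ht).1 (h Z (by rw [hM]; exact hZ) ⟨?_, ?_, ?_⟩)
    · intro i hi j hj t ht h
      rw [hW] at hi hj
      rw [key i j t hi.le hj ht]
      simp only [← or_assoc] at h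
      rcases h with h | ⟨rfl, h⟩
      · simp only [or_assoc] at h
        obtain ⟨a, h1, h2⟩ := (hvar i j t ht).1 h
        exact ⟨.var a, h1, h2⟩
      · obtain ⟨b, rfl⟩ : ∃ b : Bool, b.toNat = t := ⟨t == 1, by interval_cases t <;> rfl⟩
        rw [hW] at h
        refine ⟨.const b, Reads.cons_iff.2 ⟨j, rfl, h, Reads.nil_iff.2 ⟨rfl, ?_⟩⟩, rfl⟩
        by_contra hc
        rw [digit_of_length_le (by omega)] at h
        omega
    · intro i hi j hj t ht h hd
      rw [hW] at hi hj hd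
      rw [key i j t hi.le hj ht] at h
      rw [key (i + 1) j _ hi hj (by omega)]
      obtain ⟨φ, h1, rfl⟩ := h
      exact ⟨.neg φ, Reads.cons_iff.2 ⟨i, rfl, hd, h1⟩, by
        simp only [BoolFormula.eval]; cases φ.eval val <;> rfl⟩
    · intro i hi j hj k hk t ht s hs h h'
      rw [hW] at hi hj hk ⊢
      rw [key i j t hi.le hj ht] at h
      rw [key j k s hj.le hk hs] at h'
      obtain ⟨φ, h1, rfl⟩ := h
      obtain ⟨ψ, h2, rfl⟩ := h'
      have hb : ∀ a b : Bool, a.toNat * b.toNat = (a && b).toNat := by decide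
      have hb' : ∀ a b : Bool, a.toNat + b.toNat - (a && b).toNat = (a || b).toNat := by decide
      rw [hb, hb', key (i + 1) k _ hi hk (Bool.toNat_lt _), key (i + 1) k _ hi hk (Bool.toNat_lt _)]
      exact ⟨fun hd => ⟨.conj φ ψ, Reads.cons_iff.2 ⟨i, rfl, hd, Reads.append_iff.2 ⟨j, h1, h2⟩⟩,
        rfl⟩, fun hd => ⟨.disj φ ψ, Reads.cons_iff.2 ⟨i, rfl, hd, Reads.append_iff.2
        ⟨j, h1, h2⟩⟩, rfl⟩⟩
  · rintro ⟨φ, h, rfl⟩ Z - hZ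
    clear hi hj ht
    have lt : ∀ {i}, i ≤ u.length → i < q.W := fun h => by omega
    induction φ generalizing i j with
    | var a =>
      refine hZ.1 i (lt h.1) j (lt h.2.1) _ (Bool.toNat_lt _) ?_
      have := (hvar i j _ (Bool.toNat_lt _)).2 ⟨a, h, rfl⟩
      tauto
    | const b =>
      refine hZ.1 i (lt h.1) j (lt h.2.1) _ (Bool.toNat_lt _) ?_
      obtain ⟨i', rfl, h1, h2⟩ := Reads.cons_iff.1 h
      obtain rfl := (Reads.nil_iff.1 h2).1
      rw [hW]
      exact .inr (.inr (.inr (.inr ⟨rfl, h1⟩)))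
    | neg φ ih =>
      obtain ⟨i', rfl, h1, h2⟩ := Reads.cons_iff.1 h
      rw [← hW] at h1
      have := hZ.2.1 i' (lt h2.1) j (lt h.2.1) _ (Bool.toNat_lt _)
        (ih h2) h1
      rw [show 1 - (φ.eval val).toNat = ((BoolFormula.neg φ).eval val).toNat by
        simp only [BoolFormula.eval]; cases φ.eval val <;> rfl] at this
      exact this
    | conj φ ψ ih ih' =>
      obtain ⟨i', rfl, h1, h2⟩ := Reads.cons_iff.1 h
      obtain ⟨k, h2, h3⟩ := Reads.append_iff.1 h2
      rw [← hW] at h1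
      have := (hZ.2.2 i' (lt h2.1) k (lt h3.1) j (lt h.2.1) _ (Bool.toNat_lt _) _ (Bool.toNat_lt _)
        (ih h2) (ih' h3)).1 h1
      rw [show (φ.eval val).toNat * (ψ.eval val).toNat = ((φ.conj ψ).eval val).toNat by
        simp only [BoolFormula.eval]; cases φ.eval val <;> cases ψ.eval val <;> rfl] at this
      exact this
    | disj φ ψ ih ih' =>
      obtain ⟨i', rfl, h1, h2⟩ := Reads.cons_iff.1 h
      obtain ⟨k, h2, h3⟩ := Reads.append_iff.1 h2
      rw [← hW] at h1
      have := (hZ.2.2 i' (lt h2.1) k (lt h3.1) j (lt h.2.1) _ (Bool.toNat_lt _) _ (Bool.toNat_lt _)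
        (ih h2) (ih' h3)).2 h1
      rw [show (φ.eval val).toNat + (ψ.eval val).toNat - (φ.eval val).toNat * (ψ.eval val).toNat =
        ((φ.disj ψ).eval val).toNat by
          simp only [BoolFormula.eval]; cases φ.eval val <;> cases ψ.eval val <;> rfl] at this
      exact this

/-- As formulas are uniquely readable, the numeric evaluation finds the value of a formula. -/
theorem eval_iff_eval {u : List GameSym} {q : Layout} (hu : u ≠ []) (hW : q.W = num u)
    (hK : q.K = expBound (num u)) (hM : q.M = dexpBound (num u)) {n₁ n₂ n₃ x v y : ℕ} {α : Type}
    {enc : α → List GameSym} (henc : VarCode enc) {val : α → Bool}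
    (hvar : ∀ i j t, t < 2 → ((VarAt q.W 23 q.nX x 0 i j t ∨ VarAt q.W 24 n₁ v 0 i j t ∨
      VarAt q.W 25 n₂ y 0 i j t ∨ VarAt q.W 26 n₃ y n₂ i j t) ↔
        ∃ a, Reads u i j (enc a) ∧ (val a).toNat = t)) {i j : ℕ} {φ : BoolFormula α}
    (hφ : Reads u i j (φ.encode enc)) :
    q.Eval n₁ n₂ n₃ x v y i j 1 ↔ φ.eval val = true := by
  have hlen : u.length < num u := Nat.lt_two_pow_self.trans_le (two_pow_length_le u hu)
  rw [eval_iff_exists hu hW hK hM hvar (hφ.1.trans_lt hlen) (hφ.2.1.trans_lt hlen) (by omega)]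
  constructor
  · rintro ⟨ψ, h, h1⟩
    rw [← (BoolFormula.encode_append_inj henc (h.2.2.symm.trans hφ.2.2)).1]
    simpa using h1
  · intro h
    exact ⟨φ, hφ, by rw [h]; rfl⟩

end Layout

/-! ### Truth assignments as numbers -/

/-- The truth assignment given by the `n` binary digits of `z` from digit `s` on. -/
def bits (n z s : ℕ) : Fin n → Bool := fun i => z.testBit (s + i)

theorem exists_bits_bits {m n b : ℕ} (h : m + n ≤ b) (f : Fin m → Bool) (g : Fin n → Bool) :
    ∃ z < 2 ^ b, bits m z 0 = f ∧ bits n z m = g := by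
  obtain ⟨z, hz, hz'⟩ := exists_testBit b fun i =>
    (∃ k : Fin m, i = k ∧ f k = true) ∨ ∃ k : Fin n, i = m + k ∧ g k = true
  refine ⟨z, hz, funext fun k => ?_, funext fun k => ?_⟩
  · rw [bits, Bool.eq_iff_iff, hz' _ (by omega)]
    constructor
    · rintro (⟨k', h1, h2⟩ | ⟨k', h1, -⟩)
      · rwa [show k = k' from Fin.ext (by omega)]
      · omega
    · exact fun h => .inl ⟨k, by omega, h⟩
  · rw [bits, Bool.eq_iff_iff, hz' _ (by omega)]
    constructor
    · rintro (⟨k', h1, -⟩ | ⟨k', h1, h2⟩)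
      · omega
      · rwa [show k = k' from Fin.ext (by omega)]
    · exact fun h => .inr ⟨k, by omega, h⟩

theorem exists_bits {n b : ℕ} (h : n ≤ b) (f : Fin n → Bool) : ∃ z < 2 ^ b, bits n z 0 = f := by
  obtain ⟨z, hz, h, -⟩ := exists_bits_bits (n := 0) h f Fin.elim0
  exact ⟨z, hz, h⟩

/-- The notation for variables in the formula `F`. -/
abbrev encF (nX nX' nY0 nY1 : ℕ) : Fin nX ⊕ Fin nX' ⊕ Fin nY0 ⊕ Fin nY1 → List GameSym :=
  Sum.elim (encodeVar varX) (Sum.elim (encodeVar varX')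
    (Sum.elim (encodeVar (varY 0)) (encodeVar (varY 1))))

/-- The notation for variables in the formula `F'`. -/
abbrev encF' (nX nX' : ℕ) : Fin nX ⊕ Fin nX' → List GameSym :=
  Sum.elim (encodeVar varX) (encodeVar varX')

/-- The notation for variables in the formula `G`. -/
abbrev encG (nX : ℕ) : Fin nX → List GameSym := encodeVar varX

theorem varCode_encG (nX : ℕ) : VarCode (encG nX) := .encodeVar (by simp [code])

theorem varCode_encF' (nX nX' : ℕ) : VarCode (encF' nX nX') :=
  .sumElim (varCode_encG nX) (.encodeVar (by simp [code])) (by simp [encodeVar])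

theorem varCode_encF (nX nX' nY0 nY1 : ℕ) : VarCode (encF nX nX' nY0 nY1) :=
  .sumElim (varCode_encG nX) (.sumElim (.encodeVar (by simp [code]))
    (.sumElim (.encodeVar (by simp [code])) (.encodeVar (by simp [code])) (by simp [encodeVar]))
    (by simp [encodeVar])) (by simp [encodeVar])

theorem not_varAt_zero {w c z s i j t : ℕ} : ¬ VarAt w c 0 z s i j t := by
  rintro ⟨m, hm, -⟩
  exact Nat.not_lt_zero m hm

theorem varAt_encF {u : List GameSym} (nX nX' nY0 nY1 x v y i j : ℕ) {t : ℕ} (ht : t < 2) :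
    (VarAt (num u) 23 nX x 0 i j t ∨ VarAt (num u) 24 nX' v 0 i j t ∨
      VarAt (num u) 25 nY0 y 0 i j t ∨ VarAt (num u) 26 nY1 y nY0 i j t) ↔
      ∃ a, Reads u i j (encF nX nX' nY0 nY1 a) ∧ (Sum.elim (bits nX x 0) (Sum.elim (bits nX' v 0)
        (Sum.elim (bits nY0 y 0) (bits nY1 y nY0))) a).toNat = t := by
  simp only [Sum.exists, Sum.elim_inl, Sum.elim_inr]
  exact or_congr (Reads.varAt_iff varX _ _ ht) <| or_congr (Reads.varAt_iff varX' _ _ ht) <|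
    or_congr (Reads.varAt_iff (varY 0) _ _ ht) (Reads.varAt_iff (varY 1) _ _ ht)

theorem varAt_encF' {u : List GameSym} (nX nX' x v y i j : ℕ) {t : ℕ} (ht : t < 2) :
    (VarAt (num u) 23 nX x 0 i j t ∨ VarAt (num u) 24 nX' v 0 i j t ∨
      VarAt (num u) 25 0 y 0 i j t ∨ VarAt (num u) 26 0 y 0 i j t) ↔
      ∃ a, Reads u i j (encF' nX nX' a) ∧
        (Sum.elim (bits nX x 0) (bits nX' v 0) a).toNat = t := by
  simp only [Sum.exists, Sum.elim_inl, Sum.elim_inr, not_varAt_zero, or_false]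
  exact or_congr (Reads.varAt_iff varX _ _ ht) (Reads.varAt_iff varX' _ _ ht)

theorem varAt_encG {u : List GameSym} (nX x v y i j : ℕ) {t : ℕ} (ht : t < 2) :
    (VarAt (num u) 23 nX x 0 i j t ∨ VarAt (num u) 24 0 v 0 i j t ∨
      VarAt (num u) 25 0 y 0 i j t ∨ VarAt (num u) 26 0 y 0 i j t) ↔
      ∃ a, Reads u i j (encG nX a) ∧ (bits nX x 0 a).toNat = t := by
  simp only [not_varAt_zero, or_false]
  exact Reads.varAt_iff varX _ _ ht

namespace Layout

/-- The layout of an instance that is written as the word `u`. -/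
structure IsFor (q : Layout) (u : List GameSym) : Prop where
  ne_nil : u ≠ []
  W : q.W = num u
  K : q.K = expBound (num u)
  M : q.M = dexpBound (num u)

variable {q : Layout} {u : List GameSym} {x v y : ℕ}

theorem IsFor.length_lt (hq : q.IsFor u) : u.length < q.W := by
  rw [hq.W]
  exact Nat.lt_two_pow_self.trans_le (two_pow_length_le u hq.ne_nil)

theorem IsFor.exists_bits (hq : q.IsFor u) {n : ℕ} (hn : n ≤ u.length) (f : Fin n → Bool) :
    ∃ z < q.W, bits n z 0 = f := by
  obtain ⟨z, hz, h⟩ := _root_.exists_bits hn f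
  exact ⟨z, by rw [hq.W]; exact hz.trans_le (two_pow_length_le u hq.ne_nil), h⟩

theorem evalF_iff (hq : q.IsFor u) {φ : BoolFormula (Fin q.nX ⊕ Fin q.nX' ⊕ Fin q.nY0 ⊕ Fin q.nY1)}
    (hφ : Reads u q.pF q.pF' (φ.encode (encF _ _ _ _))) :
    q.EvalF x v y ↔ φ.eval (Sum.elim (bits _ x 0) (Sum.elim (bits _ v 0)
      (Sum.elim (bits _ y 0) (bits _ y q.nY0)))) = true :=
  eval_iff_eval hq.ne_nil hq.W hq.K hq.M (varCode_encF _ _ _ _)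
    (fun i j t ht => by rw [hq.W]; exact varAt_encF _ _ _ _ _ _ _ _ _ ht) hφ

theorem evalF'_iff (hq : q.IsFor u) {φ : BoolFormula (Fin q.nX ⊕ Fin q.nX')}
    (hφ : Reads u q.pF' q.pG (φ.encode (encF' _ _))) :
    q.EvalF' x v ↔ φ.eval (Sum.elim (bits _ x 0) (bits _ v 0)) = true :=
  eval_iff_eval hq.ne_nil hq.W hq.K hq.M (varCode_encF' _ _)
    (fun i j t ht => by rw [hq.W]; exact varAt_encF' _ _ _ _ _ _ _ ht) hφ

theorem evalG_iff (hq : q.IsFor u) {φ : BoolFormula (Fin q.nX)}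
    (hφ : Reads u q.pG q.pP (φ.encode (encG _))) :
    q.EvalG x ↔ φ.eval (bits _ x 0) = true :=
  eval_iff_eval hq.ne_nil hq.W hq.K hq.M (varCode_encG _)
    (fun i j t ht => by rw [hq.W]; exact varAt_encG _ _ _ _ _ _ ht) hφ

theorem formulaAt_iff (hq : q.IsFor u) {n₁ n₂ n₃ : ℕ} {α : Type}
    {enc : α → List GameSym} {val : α → Bool}
    (hvar : ∀ i j t, t < 2 → ((VarAt q.W 23 q.nX 0 0 i j t ∨ VarAt q.W 24 n₁ 0 0 i j t ∨
      VarAt q.W 25 n₂ 0 0 i j t ∨ VarAt q.W 26 n₃ 0 n₂ i j t) ↔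
        ∃ a, Reads u i j (enc a) ∧ (val a).toNat = t)) {i j : ℕ} (hi : i < num u)
    (hj : j < num u) :
    q.FormulaAt n₁ n₂ n₃ i j ↔ ∃ φ : BoolFormula α, Reads u i j (φ.encode enc) := by
  constructor
  · rintro ⟨t, ht, h⟩
    obtain ⟨φ, hφ, -⟩ := (eval_iff_exists hq.ne_nil hq.W hq.K hq.M hvar hi hj ht).1 h
    exact ⟨φ, hφ⟩
  · rintro ⟨φ, hφ⟩
    exact ⟨_, Bool.toNat_lt _,
      (eval_iff_exists hq.ne_nil hq.W hq.K hq.M hvar hi hj (Bool.toNat_lt _)).2 ⟨φ, hφ, rfl⟩⟩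

/-- A row of the table of a policy with one-bit mid-round exchanges only. -/
def row (r : ℕ) : List GameSym :=
  encodeNat r ++ encodeNat 1 ++ encodeNat 1 ++ encodeNat 0 ++ encodeNat 0

theorem reads_row_iff {i j r : ℕ} : Reads u i j (row r) ↔
    NatAt (num u) i (j + 6) r ∧ NatAt (num u) (j + 6) (j + 4) 1 ∧
      NatAt (num u) (j + 4) (j + 2) 1 ∧ NatAt (num u) (j + 2) (j + 1) 0 ∧
      NatAt (num u) (j + 1) j 0 := by
  simp only [row, Reads.append_iff, ← Reads.natAt_iff]
  constructor
  · rintro ⟨a, ⟨b, ⟨c, ⟨d, h1, h2⟩, h3⟩, h4⟩, h5⟩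
    obtain rfl := h5.1
    obtain rfl := h4.1
    obtain rfl := h3.1
    obtain rfl := h2.1
    exact ⟨h1, h2, h3, h4, h5⟩
  · rintro ⟨h1, h2, h3, h4, h5⟩
    exact ⟨_, ⟨_, ⟨_, ⟨_, h1, h2⟩, h3⟩, h4⟩, h5⟩

theorem rows_iff (hq : q.IsFor u) {N m i : ℕ} (hm : m ≤ u.length) (hi : i ≤ u.length) :
    q.Rows N m i ↔ ∃ l : List ℕ, l.length = m ∧ (∀ r ∈ l, r < N) ∧
      Reads u i 0 (l.map row).flatten := by
  have hlen := hq.length_lt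
  have hK1 := two_mul_lt_expBound (num u)
  rw [← hq.K, ← hq.W] at hK1
  constructor
  · intro h
    obtain ⟨Z, hZ, hZ'⟩ := exists_testBit_pair (num u) fun m i => ∃ l : List ℕ, l.length = m ∧
      (∀ r ∈ l, r < N) ∧ Reads u i 0 (l.map row).flatten
    rw [← hq.K] at hZ'
    rw [← hq.M] at hZ
    refine (hZ' m (by omega) i (by omega)).1 (h Z hZ ?_ ?_)
    · have := hZ' 0 (by omega) 0 (by omega)
      rw [Nat.zero_mul] at this
      exact this.2 ⟨[], rfl, by simp, Reads.nil_iff.2 ⟨rfl, Nat.zero_le _⟩⟩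
    · intro m hm i hi j hj r hr h h1 h2 h3 h4 h5
      rw [hq.W] at h1 h2 h3 h4 h5
      obtain ⟨l, rfl, hl, hl'⟩ := (hZ' m (by omega) j (by omega)).1 h
      refine (hZ' _ (by omega) i (by omega)).2 ⟨r :: l, rfl, by simpa using ⟨hr, hl⟩, ?_⟩
      rw [map_cons, flatten_cons]
      exact Reads.append_iff.2 ⟨j, reads_row_iff.2 ⟨h1, h2, h3, h4, h5⟩, hl'⟩
  · rintro ⟨l, rfl, hl, h⟩ Z - h0 hZ
    clear hi
    induction l generalizing i with
    | nil =>
      obtain rfl := (Reads.nil_iff.1 h).1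
      simpa using h0
    | cons r l ih =>
      rw [map_cons, flatten_cons, Reads.append_iff] at h
      obtain ⟨j, hj, h⟩ := h
      rw [length_cons] at hm
      obtain ⟨h1, h2, h3, h4, h5⟩ := reads_row_iff.1 hj
      rw [← hq.W] at h1 h2 h3 h4 h5
      exact hZ _ (by omega) i (hj.1.trans_lt hlen) j (hj.2.1.trans_lt hlen) r (hl r (by simp))
        (ih (by omega) (fun r hr => hl r (by simp [hr])) h) h1 h2 h3 h4 h5

end Layout

/-! ### The numeric game -/

namespace TeamFormulaGame

variable (I : TeamFormulaGame)

/-- The values of `Y₀` and `Y₁` that are given by the digits of `y`. -/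
def yBits (y : ℕ) : ∀ i, Fin (I.nY i) → Bool
  | 0 => bits _ y 0
  | 1 => bits _ y (I.nY 0)

/-- The layout for the instance `I`, written as part of the word `u`. -/
def layout (u : List GameSym) (pF pF' pG pP : ℕ) : Layout :=
  ⟨dexpBound (num u), expBound (num u), num u, I.nX, I.nX', I.nY 0, I.nY 1, I.h 0, I.h 1,
    pF, pF', pG, pP⟩

variable {I} {u : List GameSym} {pF pF' pG pP : ℕ}

theorem isFor_layout (hu : u ≠ []) : (I.layout u pF pF' pG pP).IsFor u := ⟨hu, rfl, rfl, rfl⟩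

theorem surjective_bits (hu : u ≠ []) {n : ℕ} (hn : n ≤ u.length) :
    Function.Surjective fun v : Fin (num u) => bits n v 0 := fun f => by
  obtain ⟨z, hz, rfl⟩ := exists_bits hn f
  exact ⟨⟨z, hz.trans_le (two_pow_length_le u hu)⟩, rfl⟩

theorem surjective_yBits (hu : u ≠ []) (hY : I.nY 0 + I.nY 1 ≤ u.length) :
    Function.Surjective fun y : Fin (num u) => I.yBits y := fun f => by
  obtain ⟨z, hz, h0, h1⟩ := exists_bits_bits hY (f 0) (f 1)
  refine ⟨⟨z, hz.trans_le (two_pow_length_le u hu)⟩, funext fun i => ?_⟩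
  match i with
  | 0 => exact h0
  | 1 => exact h1

/-- The numeric game is the game of a single player with partial information. The winning positions
are the least set closed under `WinClosed`, and numbers below `num u` name all choices and all
states, because these are lists of fewer truth values than `u` has letters. -/
theorem win_iff (hu : u ≠ []) (hX : I.nX ≤ u.length) (hX' : I.nX' ≤ u.length)
    (hY : I.nY 0 + I.nY 1 ≤ u.length) (hF : Reads u pF pF' (I.F.encode (encF _ _ _ _)))
    (hF' : Reads u pF' pG (I.F'.encode (encF' _ _))) (hG : Reads u pG pP (I.G.encode (encG _)))
    {y S : ℕ} (hy : y < num u) (hS : S < expBound (num u)) :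
    (I.layout u pF pF' pG pP).Win y S ↔ ∃ n, BeliefWin I.Bad I.Step n (I.yBits y)
      ((fun v : Fin (num u) => bits I.nX' v 0) '' {v | S.testBit v = true}) := by
  set q := I.layout u pF pF' pG pP with hq
  have hqu : q.IsFor u := isFor_layout hu
  have eF : ∀ x v y, q.EvalF x v y ↔
      I.evalF ⟨bits _ v 0, I.yBits y, fun _ => []⟩ (bits _ x 0) = true := fun x v y =>
    Layout.evalF_iff (q := q) hqu hF
  have eF' : ∀ x v, q.EvalF' x v ↔ I.F'.eval (Sum.elim (bits _ x 0) (bits _ v 0)) = true :=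
    fun x v => Layout.evalF'_iff (q := q) hqu hF'
  have eG : ∀ x, q.EvalG x ↔ I.G.eval (bits _ x 0) = true :=
    fun x => Layout.evalG_iff (q := q) hqu hG
  let bad : Fin (num u) → Fin (num u) → Prop := fun v y => I.Bad (bits _ v 0) (I.yBits y)
  let step : Fin (num u) → Fin (num u) → (Fin 2 → Bool) → Fin (num u) → Prop :=
    fun v y o v' => I.Step (bits _ v 0) (I.yBits y) o (bits _ v' 0)
  let set (S : ℕ) : Set (Fin (num u)) := {v | S.testBit v = true}
  have hbad : ∀ (y : Fin (num u)) S, (∀ v < q.W, S.testBit v = true → ∀ x < q.W,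
      q.EvalF x v y → ¬ q.EvalG x) ↔ ∀ v ∈ set S, ¬ bad v y := by
    intro y S
    constructor
    · rintro h v hv ⟨x, h1, h2⟩
      obtain ⟨x, rfl⟩ := surjective_bits hu hX x
      exact h v v.isLt hv x x.isLt ((eF _ _ _).2 h1) ((eG _).2 h2)
    · intro h v hv hvS x hx h1 h2
      exact h ⟨v, hv⟩ hvS ⟨_, (eF _ _ _).1 h1, (eG _).1 h2⟩
  have hsucc : ∀ (y : Fin (num u)) S (o : Fin 2 → Bool) (v' : Fin (num u)),
      q.Succ y S (o 0).toNat (o 1).toNat v' ↔ v' ∈ beliefSucc step y (set S) o := by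
    intro y S o v'
    have hobs : ∀ x, ((x.testBit q.h0 = true ↔ (o 0).toNat = 1) ∧
        (x.testBit q.h1 = true ↔ (o 1).toNat = 1)) ↔ ∀ i, bits I.nX x 0 (I.h i) = o i := by
      intro x
      simp only [Fin.forall_fin_two, bits, Nat.zero_add, Bool.toNat_eq_one, ← Bool.eq_iff_iff]
      rfl
    simp only [Layout.Succ, hobs, eF, eF']
    constructor
    · rintro ⟨v, hv, hvS, x, -, h⟩
      exact ⟨⟨v, hv⟩, hvS, _, h⟩
    · rintro ⟨v, hvS, x, h⟩
      obtain ⟨x, rfl⟩ := surjective_bits hu hX x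
      exact ⟨v, v.isLt, hvS, x, x.isLt, h⟩
  have hset : ∀ A : Set (Fin (num u)), ∃ S < q.K, set S = A := fun A => by
    obtain ⟨S, hS, h⟩ := exists_testBit (num u + 1) fun v => ∃ w ∈ A, (w : ℕ) = v
    refine ⟨S, hS, Set.ext fun v => (h v (by omega)).trans ?_⟩
    constructor
    · rintro ⟨w, hw, h⟩
      rwa [← Fin.ext h]
    · exact fun hv => ⟨v, hv, rfl⟩
  rw [show y = (⟨y, hy⟩ : Fin (num u)) from rfl]
  generalize (⟨y, hy⟩ : Fin (num u)) = y
  have hcomp : ∀ n, BeliefWin bad step n y (set S) ↔ BeliefWin I.Bad I.Step n (I.yBits y)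
      ((fun v : Fin (num u) => bits I.nX' v 0) '' set S) := fun n =>
    beliefWin_comp_iff (surjective_bits hu hX') (surjective_yBits hu hY) n y (set S)
  refine Iff.trans ?_ (exists_congr hcomp)
  clear hcomp
  constructor
  · intro h
    obtain ⟨T, hT, hT'⟩ := exists_testBit_pair (num u) fun y S =>
      ∃ (h : y < num u) (n : ℕ), BeliefWin bad step n ⟨y, h⟩ (set S)
    have key : ∀ (y : Fin (num u)) S, S < q.K →
        (T.testBit (y * q.K + S) = true ↔ ∃ n, BeliefWin bad step n y (set S)) := fun y S hS => by
      refine (hT' y (y.isLt.trans (lt_expBound _)) S hS).trans ?_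
      simp
    refine (key y S hS).1 (h T hT fun y hy S hS h1 h2 => ?_)
    refine (key ⟨y, hy⟩ S hS).2 (exists_beliefWin ((hbad ⟨y, hy⟩ S).1 h1) fun o ho => ?_)
    obtain ⟨S', hS', h3, h4⟩ := h2 _ (Bool.toNat_lt (o 0)) _ (Bool.toNat_lt (o 1))
    have hS'' : set S' = beliefSucc step ⟨y, hy⟩ (set S) o :=
      Set.ext fun v => (h3 v v.isLt).trans (hsucc ⟨y, hy⟩ S o v)
    rw [← hS''] at ho ⊢
    obtain ⟨v, hv⟩ := ho
    obtain ⟨y', hy', h5⟩ := h4 ⟨v, v.isLt, hv⟩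
    exact ⟨⟨y', hy'⟩, (key ⟨y', hy'⟩ S' hS').1 h5⟩
  · rintro ⟨n, h⟩ T - hT
    induction n generalizing y S with
    | zero => exact h.elim
    | succ n ih =>
      refine hT y y.isLt S hS ((hbad y S).2 h.1) fun o₀ h₀ o₁ h₁ => ?_
      obtain ⟨b₀, rfl⟩ : ∃ b : Bool, b.toNat = o₀ := ⟨o₀ == 1, by interval_cases o₀ <;> rfl⟩
      obtain ⟨b₁, rfl⟩ : ∃ b : Bool, b.toNat = o₁ := ⟨o₁ == 1, by interval_cases o₁ <;> rfl⟩
      obtain ⟨S', hS', h'⟩ := hset (beliefSucc step y (set S) ![b₀, b₁])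
      refine ⟨S', hS', fun v hv => ?_, ?_⟩
      · exact (Set.ext_iff.1 h' ⟨v, hv⟩).trans (hsucc y S ![b₀, b₁] ⟨v, hv⟩).symm
      · rintro ⟨v, hv, hvS⟩
        obtain ⟨y', hy'⟩ := h.2 ![b₀, b₁] (h' ▸ ⟨⟨v, hv⟩, hvS⟩)
        rw [← h'] at hy'
        exact ⟨y', y'.isLt, ih hS' y' hy'⟩

end TeamFormulaGame

/-! ### Accepted numbers are the numbers of won instances -/

theorem reads_all_iff {u l : List GameSym} : Reads u u.length 0 l ↔ u = l := by
  simp [Reads, rtake]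

theorem Reads.bitsMatch_iff {u : List GameSym} {i j m : ℕ} {f : Fin m → Bool}
    (hf : Reads u i j (encodeBits f)) (z s : ℕ) : BitsMatch (num u) j m z s ↔ bits m z s = f := by
  have hd : ∀ k : Fin m, digit (num u) (j + m - k) = (bit (f k)).code := fun k => by
    have h1 : encodeBits f = ((ofFn f).take k).map bit ++
        bit (f k) :: (((ofFn f).drop (k + 1)).map bit ++ [sep]) := by
      conv_lhs => rw [encodeBits, ← take_append_drop k (ofFn f),
        drop_eq_getElem_cons (by simp)]
      simp
    rw [h1] at hf
    obtain ⟨p, -, hf⟩ := Reads.append_iff.1 hf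
    obtain ⟨p, rfl, hd, hf⟩ := Reads.cons_iff.1 hf
    rw [← hd, hf.length_eq]
    congr 1
    simp
    omega
  rw [BitsMatch, funext_iff]
  constructor
  · intro h k
    rw [bits, Bool.eq_iff_iff, h k k.isLt, hd]
    cases f k <;> simp [code]
  · intro h k hk
    rw [hd ⟨k, hk⟩, ← h ⟨k, hk⟩, bits]
    cases z.testBit (s + k) <;> simp [code]

theorem encodeBits_length {n : ℕ} (f : Fin n → Bool) : (encodeBits f).length = n + 1 := by
  simp [encodeBits]

theorem encodeNat_length (n : ℕ) : (encodeNat n).length = n + 1 := by simp [encodeNat]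

/-- The policies with a one-bit exchange in the middle of every round and no other communication. -/
def IsOneBitPolicy (P : CommPolicy) : Prop := ∀ p, P.midRound p = (1, 1) ∧ P.endRound p = (0, 0)

theorem IsOneBitPolicy.encode_eq {P : CommPolicy} (hP : IsOneBitPolicy P) :
    P.encode = encodeNat P.numStates ++ (encodeNat P.start ++
      ((ofFn fun p => (P.next p : ℕ)).map Layout.row).flatten) := by
  rw [CommPolicy.encode, append_assoc]
  congr 4
  rw [map_ofFn]
  congr 1
  funext p
  simp [Layout.row, hP p]

theorem Layout.policyAt_iff {q : Layout} {u : List GameSym} (hq : q.IsFor u) :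
    q.PolicyAt ↔ ∃ P, IsOneBitPolicy P ∧ Reads u q.pP 0 P.encode := by
  have hlen := hq.length_lt
  simp only [PolicyAt, hq.W, Reads.natAt_iff]
  constructor
  · rintro ⟨pN, -, pS, -, N, -, st, hst, h1, h2, h3⟩
    have hN : N ≤ u.length := by
      have := h1.length_eq
      have := h1.1
      rw [encodeNat_length] at *
      omega
    obtain ⟨l, rfl, hl, h⟩ := (rows_iff hq hN h2.2.1).1 h3
    let P : CommPolicy := ⟨l.length, ⟨st, hst⟩, fun p => ⟨l[p], hl _ (getElem_mem _)⟩,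
      fun _ => (1, 1), fun _ => (0, 0)⟩
    have hP : IsOneBitPolicy P := fun _ => ⟨rfl, rfl⟩
    refine ⟨P, hP, ?_⟩
    rw [hP.encode_eq, show (ofFn fun p => (P.next p : ℕ)) = l from ofFn_getElem]
    exact Reads.append_iff.2 ⟨pN, h1, Reads.append_iff.2 ⟨pS, h2, h⟩⟩
  · rintro ⟨P, hP, h⟩
    rw [hP.encode_eq, Reads.append_iff] at h
    obtain ⟨pN, h1, h⟩ := h
    obtain ⟨pS, h2, h⟩ := Reads.append_iff.1 h
    have hN : P.numStates ≤ u.length := by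
      have := h1.length_eq
      have := h1.1
      rw [encodeNat_length] at *
      omega
    rw [hq.W] at hlen
    refine ⟨pN, h1.2.1.trans_lt hlen, pS, h2.2.1.trans_lt hlen, P.numStates, by omega, P.start,
      P.start.isLt, h1, h2, (rows_iff hq hN h.1).2 ⟨_, by simp, ?_, h⟩⟩
    simp

namespace TeamFormulaGame

variable {I : TeamFormulaGame} {u : List GameSym} {pF pF' pG pP : ℕ}

theorem winInit_iff (hu : u ≠ []) (hX : I.nX ≤ u.length) {j j' j₀ j₁ : ℕ}
    (hX' : Reads u j j' (encodeBits I.initX')) (h₀ : Reads u j' j₀ (encodeBits (I.initY 0)))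
    (h₁ : Reads u j₀ j₁ (encodeBits (I.initY 1))) (hF : Reads u pF pF' (I.F.encode (encF _ _ _ _)))
    (hF' : Reads u pF' pG (I.F'.encode (encF' _ _))) (hG : Reads u pG pP (I.G.encode (encG _))) :
    (I.layout u pF pF' pG pP).WinInit j' j₀ j₁ ↔
      ∃ n, BeliefWin I.Bad I.Step n I.initY {I.initX'} := by
  have e1 := hX'.length_eq
  have e2 := h₀.length_eq
  have e3 := h₁.length_eq
  have e4 := hX'.1
  rw [encodeBits_length] at e1 e2 e3
  have sX' : I.nX' ≤ u.length := by omega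
  have sY : I.nY 0 + I.nY 1 ≤ u.length := by omega
  set q := I.layout u pF pF' pG pP with hq
  have b0 : ∀ y, BitsMatch q.W j₀ q.nY0 y 0 ↔ I.yBits y 0 = I.initY 0 :=
    fun y => h₀.bitsMatch_iff y 0
  have b1 : ∀ y, BitsMatch q.W j₁ q.nY1 y q.nY0 ↔ I.yBits y 1 = I.initY 1 :=
    fun y => h₁.bitsMatch_iff y _
  have bX' : ∀ v, BitsMatch q.W j' q.nX' v 0 ↔ bits _ v 0 = I.initX' :=
    fun v => hX'.bitsMatch_iff v 0
  have himage : ∀ S : ℕ, (∀ v < q.W, (S.testBit v = true ↔ bits _ v 0 = I.initX')) →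
      (fun v : Fin (num u) => bits I.nX' v 0) '' {v | S.testBit v = true} = {I.initX'} := by
    intro S hS
    rw [← Set.image_preimage_eq {I.initX'} (surjective_bits hu sX')]
    congr 1
    exact Set.ext fun v => hS v v.isLt
  simp only [Layout.WinInit, b0, b1, bX']
  constructor
  · rintro ⟨y, hy, S, hS, h0, h1, h2, h⟩
    obtain ⟨n, h⟩ := (win_iff hu hX sX' sY hF hF' hG hy hS).1 h
    refine ⟨n, ?_⟩
    rwa [himage S h2, show I.yBits y = I.initY from funext (Fin.forall_fin_two.2 ⟨h0, h1⟩)] at h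
  · rintro ⟨n, h⟩
    obtain ⟨⟨y, hy⟩, hy'⟩ := surjective_yBits hu sY I.initY
    replace hy' : I.yBits y = I.initY := hy'
    obtain ⟨S, hS, hS'⟩ := exists_testBit (num u + 1) fun v => bits _ v 0 = I.initX'
    have hS'' : ∀ v < q.W, (S.testBit v = true ↔ bits _ v 0 = I.initX') :=
      fun v hv => hS' v (Nat.lt_succ_of_lt hv)
    refine ⟨y, hy, S, hS, congrFun hy' 0, congrFun hy' 1, hS'',
      (win_iff hu hX sX' sY hF hF' hG hy hS).2 ⟨n, ?_⟩⟩
    rwa [himage S hS'', hy']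

end TeamFormulaGame

/-- The numeric predicate decides the game. -/
theorem accepts_iff (u : List GameSym) :
    Accepts (dexpBound (num u)) (expBound (num u)) (num u) ↔ u ∈ tfgcLanguage IsOneBitPolicy := by
  constructor
  · rintro ⟨n, hn, j, -, j', -, j₀, -, j₁, -, j₂, -, pF, -, pF', hpF', pG, hpG, pP, hpP, nX, -,
      nX', -, nY0, -, nY1, -, h0, -, h1, -, hlen, hX, hX', hY0, hY1, r0, r1,
      ⟨lt0, lt1, hF, hF', hG, himp⟩, hpol, hwin⟩
    have hu : u ≠ [] := by
      rintro rfl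
      exact Nat.not_lt_zero n hn
    obtain rfl := lengthIs_iff.1 hlen
    have hlt : u.length < num u := hn
    generalize hq : (⟨dexpBound (num u), expBound (num u), num u, nX, nX', nY0, nY1, h0, h1, pF,
      pF', pG, pP⟩ : Layout) = q at *
    have hqu : q.IsFor u := by subst hq; exact ⟨hu, rfl, rfl, rfl⟩
    obtain ⟨fX, hX⟩ := Reads.bitsAt_iff.1 hX
    obtain ⟨fX', hX'⟩ := Reads.bitsAt_iff.1 hX'
    obtain ⟨f0, hY0⟩ := Reads.bitsAt_iff.1 hY0
    obtain ⟨f1, hY1⟩ := Reads.bitsAt_iff.1 hY1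
    rw [Reads.natAt_iff] at r0 r1
    obtain ⟨P, hP, hP'⟩ := (Layout.policyAt_iff hqu).1 hpol
    have l0 := hX.length_eq
    have l1 := hX'.length_eq
    have l2 := hY0.length_eq
    have l3 := hY1.length_eq
    rw [encodeBits_length] at l0 l1 l2 l3
    subst hq
    obtain ⟨F, hF⟩ := (Layout.formulaAt_iff hqu (fun i j t => varAt_encF nX nX' nY0 nY1 0 0 0 i j)
      (r1.2.1.trans_lt hlt) hpF').1 hF
    obtain ⟨F', hF'⟩ := (Layout.formulaAt_iff hqu (fun i j t => varAt_encF' nX nX' 0 0 0 i j)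
      hpF' hpG).1 hF'
    obtain ⟨G, hG⟩ := (Layout.formulaAt_iff hqu (fun i j t => varAt_encG nX 0 0 0 i j)
      hpG hpP).1 hG
    let I : TeamFormulaGame :=
      { nX := nX
        nX' := nX'
        nY := fun | 0 => nY0 | 1 => nY1
        initX := fX
        initX' := fX'
        initY := fun | 0 => f0 | 1 => f1
        h := fun | 0 => ⟨h0, lt0⟩ | 1 => ⟨h1, lt1⟩
        F := F
        F' := F'
        G := G
        F_implies_not_F' := by
          intro x x' y hxy
          obtain ⟨x, hx, rfl⟩ := hqu.exists_bits (by omega) x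
          obtain ⟨v, hv, rfl⟩ := hqu.exists_bits (by omega) x'
          obtain ⟨z, hz, z0, z1⟩ := exists_bits_bits (m := nY0) (n := nY1)
            (b := u.length) (by omega) (y 0) (y 1)
          rw [← z0, ← z1] at hxy
          have := himp x hx v hv z (hz.trans_le (two_pow_length_le u hu))
            ((Layout.evalF_iff hqu hF).2 hxy)
          rw [Layout.evalF'_iff hqu hF'] at this
          simpa using this }
    have hw := (TeamFormulaGame.winInit_iff (I := I) hu (by change nX ≤ _; omega) hX' hY0 hY1
      hF hF' hG).1 hwin
    refine ⟨I, P, hP, (TeamFormulaGame.whiteHasForcedWin_iff hP).2 hw, reads_all_iff.1 ?_⟩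
    rw [TeamFormulaGame.encode]
    simp only [Reads.append_iff]
    exact ⟨pP, ⟨pG, ⟨pF', ⟨pF, ⟨j₂, ⟨j₁, ⟨j₀, ⟨j', ⟨j, hX, hX'⟩, hY0⟩, hY1⟩, r0⟩, r1⟩, hF⟩, hF'⟩,
      hG⟩, hP'⟩
  · rintro ⟨I, P, hP, hw, h⟩
    have hu : u ≠ [] := by
      rintro rfl
      have := congrArg length h
      simp [TeamFormulaGame.encode, encodeBits] at this
    have hlt : u.length < num u := Nat.lt_two_pow_self.trans_le (two_pow_length_le u hu)
    have h' := reads_all_iff.2 h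
    rw [TeamFormulaGame.encode] at h'
    simp only [Reads.append_iff] at h'
    obtain ⟨pP, ⟨pG, ⟨pF', ⟨pF, ⟨j₂, ⟨j₁, ⟨j₀, ⟨j', ⟨j, hX, hX'⟩, hY0⟩, hY1⟩, r0⟩, r1⟩, hF⟩, hF'⟩,
      hG⟩, hP'⟩ := h'
    have l0 := hX.length_eq
    have l1 := hX'.length_eq
    have l2 := hY0.length_eq
    have l3 := hY1.length_eq
    have l4 := r0.length_eq
    have l5 := r1.length_eq
    rw [encodeBits_length] at l0 l1 l2 l3
    rw [encodeNat_length] at l4 l5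
    have hqu : (I.layout u pF pF' pG pP).IsFor u := TeamFormulaGame.isFor_layout hu
    have lt : ∀ {i}, i ≤ u.length → i < num u := fun h => by omega
    refine ⟨u.length, hlt, j, lt hX.2.1, j', lt hX'.2.1, j₀, lt hY0.2.1, j₁, lt hY1.2.1, j₂,
      lt r0.2.1, pF, lt r1.2.1, pF', lt hF.2.1, pG, lt hF'.2.1, pP, lt hG.2.1, I.nX, by omega,
      I.nX', by omega, I.nY 0, by omega, I.nY 1, by omega, I.h 0, by omega, I.h 1, by omega,
      lengthIs_iff.2 rfl, Reads.bitsAt_iff.2 ⟨_, hX⟩, Reads.bitsAt_iff.2 ⟨_, hX'⟩,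
      Reads.bitsAt_iff.2 ⟨_, hY0⟩, Reads.bitsAt_iff.2 ⟨_, hY1⟩, Reads.natAt_iff.2 r0,
      Reads.natAt_iff.2 r1, ⟨(I.h 0).isLt, (I.h 1).isLt, ?_, ?_, ?_, ?_⟩, ?_, ?_⟩
    · exact (Layout.formulaAt_iff hqu (fun i j t => varAt_encF _ _ _ _ 0 0 0 i j)
        (lt hF.1) (lt hF.2.1)).2 ⟨_, hF⟩
    · exact (Layout.formulaAt_iff hqu (fun i j t => varAt_encF' _ _ 0 0 0 i j)
        (lt hF'.1) (lt hF'.2.1)).2 ⟨_, hF'⟩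
    · exact (Layout.formulaAt_iff hqu (fun i j t => varAt_encG _ 0 0 0 i j)
        (lt hG.1) (lt hG.2.1)).2 ⟨_, hG⟩
    · intro x _ v _ y _ h1 h2
      have h1' := (Layout.evalF_iff hqu hF).1 h1
      have h2' := (Layout.evalF'_iff hqu hF').1 h2
      have := I.F_implies_not_F' _ _ (I.yBits y) h1'
      exact absurd (h2'.symm.trans this) (by simp)
    · exact (Layout.policyAt_iff hqu).2 ⟨P, hP, hP'⟩
    · exact (TeamFormulaGame.winInit_iff hu (by omega) hX' hY0 hY1 hF hF' hG).2
        ((TeamFormulaGame.whiteHasForcedWin_iff hP).1 hw)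

theorem mainTheorem5 :
    InTwoEXPSPACE (tfgcLanguage fun P => ∀ p, P.midRound p = (1, 1) ∧ P.endRound p = (0, 0)) :=
  inTwoEXPSPACE_of_linDec code_bounds linDec_accepts fun u => (accepts_iff u).symm
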